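/- We work over $\mathbb{C}$. Let $C$ be a smooth projective curve of genus $1$ and let $\pi:\widetilde C\to C$ be a double cover (a finite morphism of degree $2$ from a smooth projective curve $\widetilde C$) branched in exactly six distinct points. Then there are a smooth cubic threefold $X=V(F)\subset\mathbb{P}^4$ and an involution $\tau$ of $X$ of non-Eckardt type, that is, in suitable coordinates $\tau:[x_0,x_1,x_2,x_3,x_4]\mapsto[x_0,x_1,x_2,-x_3,-x_4]$, such that the following holds. (1) The line $L=V(x_0,x_1,x_2)$ is contained in $X$, and it is the unique line on $X$ that is fixed pointwise by $\tau$. (2) Let $\pi_L:\mathrm{Bl}_LX\to\mathbb{P}^2$ be the conic fibration obtained by projecting $X$ from $L$, whose fibre over $x$ is the conic residual to $L$ in $X\cap\langle L,x\rangle$, and let $D_L\subset\mathbb{P}^2$ be its discriminant quintic. The equation of $D_L$ is the product of a cubic form $g$ and a nonzero quadratic form, where $V(g)\subset\mathbb{P}^2$ is a smooth cubic curve. (3) Let $\widetilde D_L\to D_L$ be the discriminant double cover: $\widetilde D_L$ is the curve of pairs $(x,m)$ with $x\in D_L$ and $m$ a line contained in the singular conic over $x$, and the map is $(x,m)\mapsto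 x$. Its restriction to the component $V(g)$ (the curve of the pairs $(x,m)$ with $x\in V(g)$, with its reduced structure) is isomorphic to $\pi:\widetilde C\to C$; that is, there are isomorphisms $\widetilde C\cong \widetilde D_L|_{V(g)}$ and $C\cong V(g)$ of curves over $\mathbb{C}$ compatible with the covering maps. -/

import Mathlib

open AlgebraicGeometry CategoryTheory CategoryTheory.Limits TopologicalSpace

noncomputable section

namespace CubicThreefold

/-! ### Genus of a curve over `ℂ` -/

section Repartitions

variable {k K ι : Type} [Field k] [CommRing K] [Algebra k K] (O : ι → Subalgebra k K)

/-- The families `(rₓ)` of elements of `K` with `rₓ ∈ Oₓ` for all but finitely many `x`. -/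
def repartitions : Submodule k (ι → K) where
  carrier := {r | {x | r x ∉ O x}.Finite}
  add_mem' := fun {r s} hr hs => (hr.union hs).subset fun x hx => by
    by_contra h
    simp only [Set.mem_union, Set.mem_ofPred_eq, not_or, not_not] at h
    exact hx ((O x).add_mem h.1 h.2)
  zero_mem' := by simp
  smul_mem' := fun c r hr => hr.subset fun x hx h => hx ((O x).smul_mem h c)

/-- The families `(rₓ)` with `rₓ ∈ Oₓ` for all `x`. -/
def regularRepartitions : Submodule k (ι → K) :=
  Submodule.pi Set.univ fun x => Subalgebra.toSubmodule (O x)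

/-- The constant families. -/
def constantRepartitions (k K ι : Type) [Field k] [CommRing K] [Algebra k K] :
    Submodule k (ι → K) :=
  LinearMap.range (LinearMap.pi fun _ : ι => (LinearMap.id : K →ₗ[k] K))

/-- The cokernel of the diagonal map `K ⟶ ⨁ₓ K / Oₓ`, as the space of repartitions modulo the sum
of the regular and the constant ones. -/
abbrev RepartitionCohomology : Type :=
  repartitions O ⧸
    (regularRepartitions O ⊔ constantRepartitions k K ι).comap (repartitions O).subtype

end Repartitions

section Genus

variable {C : Scheme.{0}} [IsIntegral C] (p : C ⟶ Spec (.of ℂ))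

/-- The constants as global functions on `C`, for a scheme `p : C ⟶ Spec ℂ`. -/
def constantFunction : ℂ →+* Γ(C, ⊤) :=
  p.appTop.hom.comp (Scheme.ΓSpecIso (.of ℂ)).inv.hom

/-- The function field of an integral scheme `p : C ⟶ Spec ℂ` as a `ℂ`-algebra. -/
abbrev functionFieldAlgebra : Algebra ℂ C.functionField :=
  ((C.presheaf.germ ⊤ (genericPoint C) trivial).hom.comp (constantFunction p)).toAlgebra

/-- The local ring `𝒪_{C,x}` as a subalgebra of the function field of `C`. -/
def localRing (x : C) :
    @Subalgebra ℂ C.functionField _ _ (functionFieldAlgebra p) :=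
  letI := functionFieldAlgebra p
  { (algebraMap (C.presheaf.stalk x) C.functionField).range with
    algebraMap_mem' := fun c =>
      ⟨C.presheaf.germ ⊤ x trivial (constantFunction p c),
        congr($(C.presheaf.germ_stalkSpecializes (U := ⊤) (y := x) trivial
          ((genericPoint_spec C).specializes trivial)) (constantFunction p c))⟩ }

/-- The genus of an integral proper smooth curve `p : C ⟶ Spec ℂ`, that is the dimension of
`H¹(C, 𝒪_C)`. The cohomology is computed by the flasque resolution
`0 ⟶ 𝒪_C ⟶ K ⟶ ⨁ₓ K / 𝒪_{C,x} ⟶ 0`, where `K` is the constant sheaf of rational functions, `x` runs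
through the closed points, and `K / 𝒪_{C,x}` stands for the skyscraper sheaf at `x`. -/
def genus : Cardinal :=
  letI := functionFieldAlgebra p
  Module.rank ℂ (RepartitionCohomology fun x : closedPoints C => localRing p x.1)

end Genus

/-! ### Double covers and their branch points -/

/-- The set of ramification points of a morphism `π` between smooth curves over `ℂ`: the points `x`
at which the maximal ideal of `𝒪_{π x}` does not generate the maximal ideal of `𝒪_x`. -/
def ramificationPoints {C' C : Scheme.{0}} (π : C' ⟶ C) : Set C' :=
  {x | (IsLocalRing.maximalIdeal (C.presheaf.stalk (π x))).map (π.stalkMap x).hom ≠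
    IsLocalRing.maximalIdeal (C'.presheaf.stalk x)}

/-- The set of branch points: the images of the ramification points. -/
def branchPoints {C' C : Scheme.{0}} (π : C' ⟶ C) : Set C :=
  π '' ramificationPoints π

/-! ### Projective space over `ℂ` as a scheme -/

attribute [local instance] MvPolynomial.gradedAlgebra

/-- The projective space over `ℂ` with homogeneous coordinates indexed by `σ`. -/
abbrev ProjSpace (σ : Type) : Scheme.{0} :=
  Proj (MvPolynomial.homogeneousSubmodule σ ℂ)

/-- The structure morphism of projective space. -/
def ProjSpace.toSpec (σ : Type) : ProjSpace σ ⟶ Spec (.of ℂ) :=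
  Proj.toSpecZero (MvPolynomial.homogeneousSubmodule σ ℂ) ≫
    Spec.map (CommRingCat.ofHom
      (algebraMap ℂ (MvPolynomial.homogeneousSubmodule σ ℂ 0)))

/-- `HasCoords P v` says that `P` is the closed point of projective space with homogeneous
coordinates `v`: a form vanishes at `P` if and only if its value at `v` is zero. -/
def HasCoords {σ : Type} (P : ProjSpace σ) (v : σ → ℂ) : Prop :=
  v ≠ 0 ∧ ∀ (n : ℕ) (f : MvPolynomial σ ℂ), f.IsHomogeneous n →
    (f ∈ ProjectiveSpectrum.asHomogeneousIdeal P ↔ MvPolynomial.eval v f = 0)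

/-- The closure of a set `S` of points of a scheme, with its reduced scheme structure. -/
def reducedClosure {Y : Scheme.{0}} (S : Set Y) : Y.IdealSheafData :=
  Scheme.IdealSheafData.vanishingIdeal ⟨closure S, isClosed_closure⟩

/-! ### Smooth forms, plane curves -/

/-- A form whose zero locus in projective space is a smooth hypersurface (Jacobian criterion). -/
def IsSmoothForm {σ : Type} (F : MvPolynomial σ ℂ) : Prop :=
  ∀ v : σ → ℂ, v ≠ 0 → MvPolynomial.eval v F = 0 →
    ∃ i, MvPolynomial.eval v (MvPolynomial.pderiv i F) ≠ 0

/-- The closed points of the plane curve `V(g)`. -/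
def planeCurvePoints (g : MvPolynomial (Fin 3) ℂ) : Set (ProjSpace (Fin 3)) :=
  {P | ∃ x, HasCoords P x ∧ MvPolynomial.eval x g = 0}

/-- The plane curve `V(g)`, as a reduced closed subscheme of the projective plane. -/
def planeCurve (g : MvPolynomial (Fin 3) ℂ) : (ProjSpace (Fin 3)).IdealSheafData :=
  reducedClosure (planeCurvePoints g)

/-! ### Involutions of non-Eckardt type -/

/-- The involution `[x₀,x₁,x₂,x₃,x₄] ↦ [x₀,x₁,x₂,-x₃,-x₄]`. -/
def nonEckardtInvolution : (Fin 5 → ℂ) →ₗ[ℂ] (Fin 5 → ℂ) :=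
  Matrix.toLin' (Matrix.diagonal ![1, 1, 1, -1, -1])

/-- The projection `(x₀,x₁,x₂,x₃,x₄) ↦ (x₀,x₁,x₂)`, whose centre is the line `x₀ = x₁ = x₂ = 0`. -/
def projection : (Fin 5 → ℂ) →ₗ[ℂ] (Fin 3 → ℂ) :=
  LinearMap.funLeft ℂ ℂ ![0, 1, 2]

/-- The line `L = V(x₀,x₁,x₂)` of `ℙ⁴`, as a two-dimensional linear subspace. -/
def fixedLine : Submodule ℂ (Fin 5 → ℂ) := LinearMap.ker projection

/-- The line `ℙ(M)` of `ℙ⁴` lies on the hypersurface `V(F)`, and the involution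
`nonEckardtInvolution` fixes each of its points. -/
def IsPointwiseFixedLine (F : MvPolynomial (Fin 5) ℂ) (M : Submodule ℂ (Fin 5 → ℂ)) : Prop :=
  Module.finrank ℂ M = 2 ∧ (∀ v ∈ M, MvPolynomial.eval v F = 0) ∧
    ∀ v ∈ M, ∃ c : ℂ, nonEckardtInvolution v = c • v

/-! ### The conic fibration and its discriminant double cover -/

/-- For a form `F = ℓ₁x₃² + ℓ₂x₄² + 2ℓ₃x₃x₄ + 2q₁x₃ + 2q₂x₄ + c`, with `ℓᵢ, qᵢ, c` forms in
`x₀,x₁,x₂` of degrees `1, 2, 3`, that is for a cubic form vanishing on `L = V(x₀,x₁,x₂)`, the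
symmetric matrix with rows `(ℓ₁,ℓ₃,q₁), (ℓ₃,ℓ₂,q₂), (q₁,q₂,c)` of the conic fibration given by the
projection from `L`. Its determinant is the equation of the discriminant quintic. -/
def conicMatrix (F : MvPolynomial (Fin 5) ℂ) : Matrix (Fin 3) (Fin 3) (MvPolynomial (Fin 3) ℂ) :=
  let r : MvPolynomial (Fin 5) ℂ → MvPolynomial (Fin 3) ℂ :=
    MvPolynomial.aeval ![MvPolynomial.X 0, MvPolynomial.X 1, MvPolynomial.X 2, 0, 0]
  let d : Fin 5 → MvPolynomial (Fin 5) ℂ → MvPolynomial (Fin 5) ℂ := fun i => MvPolynomial.pderiv i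
  let h : MvPolynomial (Fin 3) ℂ := MvPolynomial.C (1 / 2)
  !![h * r (d 3 (d 3 F)), h * r (d 3 (d 4 F)), h * r (d 3 F);
     h * r (d 3 (d 4 F)), h * r (d 4 (d 4 F)), h * r (d 4 F);
     h * r (d 3 F), h * r (d 4 F), r F]

/-- The plane of `ℙ⁴` spanned by the line `L` and the point `[x]` of the target plane of the
projection from `L`, as a three-dimensional linear subspace (for `x ≠ 0`). -/
def planeThroughLine (x : Fin 3 → ℂ) : Submodule ℂ (Fin 5 → ℂ) :=
  (Submodule.span ℂ {x}).comap projection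

/-- The line `m` is contained in the residual conic of `L` in the plane section `X ∩ ⟨L, x⟩` of
`X = V(F)`: on this plane `F` is a product `a b c` of linear forms, with `L = V(a)` and `m = V(b)`,
so that `X ∩ ⟨L, x⟩ = L + m + m'`. -/
def IsResidualLine (F : MvPolynomial (Fin 5) ℂ) (x : Fin 3 → ℂ)
    (m : Submodule ℂ (Fin 5 → ℂ)) : Prop :=
  Module.finrank ℂ m = 2 ∧ ∃ a b c : Module.Dual ℂ (Fin 5 → ℂ),
    planeThroughLine x ⊓ LinearMap.ker a = fixedLine ∧
    planeThroughLine x ⊓ LinearMap.ker b = m ∧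
    ∀ v ∈ planeThroughLine x, MvPolynomial.eval v F = a v * b v * c v

/-- Plücker coordinates of the line spanned by `u` and `w`. -/
def plucker (u w : Fin 5 → ℂ) : Fin 5 × Fin 5 → ℂ :=
  fun ij => u ij.1 * w ij.2 - u ij.2 * w ij.1

/-- The product of the projective plane with the Plücker space of lines of `ℙ⁴`. -/
abbrev PlaneTimesPlucker : Scheme.{0} :=
  pullback (ProjSpace.toSpec (Fin 3)) (ProjSpace.toSpec (Fin 5 × Fin 5))

/-- The pairs `(x, m)` of a point `x` of the plane and a residual line `m` in the fibre over `x`, as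
closed points of the product. -/
def residualPairs (F : MvPolynomial (Fin 5) ℂ) : Set PlaneTimesPlucker :=
  {z | IsClosed {z} ∧ ∃ (x : Fin 3 → ℂ) (u w : Fin 5 → ℂ),
    HasCoords (pullback.fst (ProjSpace.toSpec (Fin 3)) (ProjSpace.toSpec (Fin 5 × Fin 5)) z) x ∧
    HasCoords (pullback.snd (ProjSpace.toSpec (Fin 3)) (ProjSpace.toSpec (Fin 5 × Fin 5)) z)
      (plucker u w) ∧
    IsResidualLine F x (Submodule.span ℂ {u, w})}

/-- For a subset `Z` of the plane, the reduced closed subscheme of the pairs `(x, m)`, where `x ∈ Z`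
and `m` is a component of the singular conic over `x`. If `Z` is the whole plane, this is the source
`D̃` of the discriminant double cover `D̃ ⟶ D`, `(x, m) ↦ x`, of the projection of `V(F)` from `L`.
If `Z` is a component of the discriminant curve `D`, it is the restriction of `D̃` to `Z`. -/
def discriminantCoverOver (F : MvPolynomial (Fin 5) ℂ) (Z : Set (ProjSpace (Fin 3))) :
    PlaneTimesPlucker.IdealSheafData :=
  reducedClosure (residualPairs F ∩
    pullback.fst (ProjSpace.toSpec (Fin 3)) (ProjSpace.toSpec (Fin 5 × Fin 5)) ⁻¹' Z)

/-- The covering map `(x, m) ↦ x` to the plane. -/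
def discriminantCoverOver.toPlane (F : MvPolynomial (Fin 5) ℂ) (Z : Set (ProjSpace (Fin 3))) :
    (discriminantCoverOver F Z).subscheme ⟶ ProjSpace (Fin 3) :=
  (discriminantCoverOver F Z).subschemeι ≫
    pullback.fst (ProjSpace.toSpec (Fin 3)) (ProjSpace.toSpec (Fin 5 × Fin 5))

end CubicThreefold

end

/-! Let `K` be the function field of `C`. In characteristic zero the function field of the double
cover is `K(y)` with `y² = f`. The branch points are exactly the points where `f` has odd order, so
`div f = B - 2N`, where `B` is the reduced divisor of the six branch points; as principal divisors
have degree 0, `deg N = 3` (`exists_isSqrtCover`).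

On a curve of genus 1 a divisor `N` of degree 3 embeds `C` as a smooth plane cubic `V(g)`, and forms
of degree `n` restrict onto all of `L(nN)` (`exists_isPlaneModel`). In particular `-f`, which lies
in `L(2N)`, is the restriction of a quadratic form `q`. As a section of `2N` it has divisor `B`,
which is reduced, so `V(q)` is transversal to `V(g)`; and `q` is not a square because `f` is not. A
ternary quadratic form over `ℂ` that is not a square can be written `q = ℓ₁ℓ₂ - ℓ₃²`
(`exists_eq_mul_sub_sq`, `IsSqrtCover.exists_isTransversal`).

The threefold is `F = ℓ₁x₃² + ℓ₂x₄² + 2ℓ₃x₃x₄ + g`. It is even in `(x₃, x₄)`, hence invariant under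
the involution, and its conic matrix is block diagonal with determinant `g q`. Smoothness follows
from smoothness of `V(g)`, transversality, and the fact that no nontrivial relation among the `ℓᵢ`
involves `ℓ₁` or `ℓ₂` (`IsTransversal.isSmoothForm_threefoldForm`). A pointwise fixed line is either
`L` or lies in the plane `x₃ = x₄ = 0`, which meets `X` in the smooth cubic `V(g)`, and this
contains no line.

Over a point of `V(g)` the residual conic is the binary form `ℓ₁x₃² + 2ℓ₃x₃x₄ + ℓ₂x₄²`, that is, a
pair of lines. A line with direction `(α : β)` is the same as the kernel of the matrix with rows
`(ℓ₁, ℓ₃ - y)` and `(ℓ₃ + y, ℓ₂)` for one choice of the root `y` of `y² = ℓ₃² - ℓ₁ℓ₂ = f`;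
generically `(α : β) = (y - ℓ₃ : ℓ₁)`. So lines correspond to square roots of `f`, that is, to
points of the cover. `IsSqrtCover.exists_coverMap` turns this into a morphism from the cover to the
product of the plane with Plücker space, and `IsSqrtCover.exists_iso` shows that it is a closed
immersion onto the discriminant cover over `V(g)`.

The arguments on curves are carried out with the discrete valuations of the function field
(`IsCurve`). Two tools lead back to schemes: a rational map from a smooth curve to a proper scheme
extends (`exists_extension`), and a closed map from a separated integral scheme that is surjective
on stalks is a closed immersion (`isClosedImmersion_of_stalkMap_surjective`). -/

open AlgebraicGeometry CategoryTheory CategoryTheory.Limits TopologicalSpace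

noncomputable section

namespace CubicThreefold

/-! ### Riemann-Roch in genus one, via repartitions -/

section RiemannRoch

open WithZero

variable {k K X : Type*} [Field k] [Field K] [Algebra k K]

/-- The closed points of a complete regular curve over an algebraically closed field `k`, with
function field `K`, seen as a family of discrete valuations of `K`. -/
structure IsCurve (k : Type*) {K X : Type*} [Field k] [Field K] [Algebra k K]
    (v : X → Valuation K ℤᵐ⁰) : Prop where
  uniformizer : ∀ x, ∃ t, v x t = exp (-1)
  residue : ∀ x f, v x f ≤ 1 → ∃ c : k, v x (f - algebraMap k K c) < 1
  const : ∀ x (c : k), c ≠ 0 → v x (algebraMap k K c) = 1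
  finite : ∀ f, {x | 1 < v x f}.Finite
  regular : ∀ f, (∀ x, v x f ≤ 1) → ∃ c, f = algebraMap k K c

lemma lt_exp_iff {a : ℤᵐ⁰} {n : ℤ} : a < exp n ↔ a ≤ exp (n - 1) := by
  rcases eq_or_ne a 0 with rfl | h
  · simp
  · rw [← exp_log h, exp_lt_exp, exp_le_exp]; omega

lemma exists_exp_eq {a : ℤᵐ⁰} (h : a ≠ 0) : ∃ n, a = exp n := ⟨_, (exp_log h).symm⟩

lemma eq_exp_iff {a : ℤᵐ⁰} {n : ℤ} : a = exp n ↔ a ≤ exp n ∧ ¬ a ≤ exp (n - 1) := by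
  rw [← lt_exp_iff, not_lt, le_antisymm_iff]

namespace IsCurve

variable {v : X → Valuation K ℤᵐ⁰}

lemma const_le (hv : IsCurve k v) (x : X) (c : k) : v x (algebraMap k K c) ≤ 1 := by
  rcases eq_or_ne c 0 with rfl | h
  · simp
  · exact (hv.const x c h).le

lemma smul_le (hv : IsCurve k v) (x : X) (c : k) (f : K) : v x (c • f) ≤ v x f := by
  rw [Algebra.smul_def, map_mul]
  exact mul_le_of_le_one_left' (hv.const_le x c)

lemma map_smul (hv : IsCurve k v) (x : X) {c : k} (hc : c ≠ 0) (f : K) : v x (c • f) = v x f := by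
  rw [Algebra.smul_def, map_mul, hv.const x c hc, one_mul]

/-- The space `L(D)` of functions with poles bounded by the divisor `D`. -/
def sections (hv : IsCurve k v) (D : X →₀ ℤ) : Submodule k K where
  carrier := {f | ∀ x, v x f ≤ exp (D x)}
  add_mem' {f g} hf hg x := (v x).map_add_le (hf x) (hg x)
  zero_mem' := by simp
  smul_mem' c f hf x := (hv.smul_le x c f).trans (hf x)

lemma mem_sections (hv : IsCurve k v) {D : X →₀ ℤ} {f : K} :
    f ∈ hv.sections D ↔ ∀ x, v x f ≤ exp (D x) := Iff.rfl

lemma sections_mono (hv : IsCurve k v) {D E : X →₀ ℤ} (h : D ≤ E) :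
    hv.sections D ≤ hv.sections E :=
  fun _ hf x => (hf x).trans (exp_le_exp.2 (h x))

lemma mul_mem_sections (hv : IsCurve k v) {D E : X →₀ ℤ} {f g : K} (hf : f ∈ hv.sections D)
    (hg : g ∈ hv.sections E) : f * g ∈ hv.sections (D + E) := fun x => by
  rw [map_mul, Finsupp.add_apply, exp_add]
  exact mul_le_mul' (hf x) (hg x)

/-- Two functions of the same order differ by a scalar up to higher order. -/
lemma exists_sub_lt (hv : IsCurve k v) (x : X) {f g : K} (hf : f ≠ 0) (h : v x g ≤ v x f) :
    ∃ c : k, v x (g - c • f) < v x f := by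
  have hf' : v x f ≠ 0 := (v x).ne_zero_iff.2 hf
  obtain ⟨c, hc⟩ := hv.residue x (g / f) (by rw [map_div₀]; exact div_le_one_of_le₀ h zero_le)
  refine ⟨c, ?_⟩
  have : g - c • f = (g / f - algebraMap k K c) * f := by
    rw [sub_mul, div_mul_cancel₀ _ hf, Algebra.smul_def]
  rw [this, map_mul]
  exact mul_lt_of_lt_one_left (zero_lt_iff.2 hf') hc

lemma add_single_apply_self (D : X →₀ ℤ) (x : X) (n : ℤ) :
    (D + Finsupp.single x n) x = D x + n := by simp

lemma add_single_apply_ne (D : X →₀ ℤ) {x y : X} (n : ℤ) (h : y ≠ x) :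
    (D + Finsupp.single x n) y = D y := by
  classical
  rw [Finsupp.add_apply, Finsupp.single_apply, if_neg h.symm, add_zero]

lemma mem_sections_of_add_single (hv : IsCurve k v) {D : X →₀ ℤ} {x : X} {n : ℤ} {f : K}
    (hf : f ∈ hv.sections (D + Finsupp.single x n)) (h : v x f ≤ exp (D x)) :
    f ∈ hv.sections D := fun y => by
  rcases eq_or_ne y x with rfl | hy
  · exact h
  · exact (hf y).trans_eq (by rw [add_single_apply_ne _ _ hy])

lemma le_add_single (D : X →₀ ℤ) (x : X) {n : ℤ} (hn : 0 ≤ n) : D ≤ D + Finsupp.single x n :=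
  le_add_of_nonneg_right (Finsupp.single_nonneg.2 hn)

/-- Allowing one more pole adds at most one function. -/
lemma sections_add_single (hv : IsCurve k v) {D : X →₀ ℤ} {x : X} {f : K}
    (hf : f ∈ hv.sections (D + Finsupp.single x 1)) (hf' : f ∉ hv.sections D) :
    hv.sections (D + Finsupp.single x 1) = hv.sections D ⊔ Submodule.span k {f} := by
  have hfx : v x f = exp (D x + 1) := by
    rw [eq_exp_iff, add_sub_cancel_right]
    exact ⟨(hf x).trans_eq (by rw [add_single_apply_self]),
      fun h => hf' (hv.mem_sections_of_add_single hf h)⟩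
  refine le_antisymm (fun g hg => ?_) (sup_le (hv.sections_mono (le_add_single D x zero_le_one))
    (by simpa using hf))
  have hf0 : f ≠ 0 := by rintro rfl; exact hf' (zero_mem _)
  obtain ⟨c, hc⟩ := hv.exists_sub_lt x (f := f) (g := g) hf0
    (by rw [hfx]; exact (hg x).trans_eq (by rw [add_single_apply_self]))
  rw [hfx, lt_exp_iff, add_sub_cancel_right] at hc
  rw [Submodule.mem_sup]
  refine ⟨g - c • f, hv.mem_sections_of_add_single
    (Submodule.sub_mem _ hg (Submodule.smul_mem _ c hf)) hc, c • f,
    Submodule.mem_span_singleton.2 ⟨c, rfl⟩, by simp⟩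

lemma finite_finrank_add_single (hv : IsCurve k v) {D : X →₀ ℤ} {x : X} {f : K}
    (hf : f ∈ hv.sections (D + Finsupp.single x 1)) (hf' : f ∉ hv.sections D)
    [FiniteDimensional k (hv.sections D)] :
    FiniteDimensional k (hv.sections (D + Finsupp.single x 1)) ∧
    Module.finrank k (hv.sections (D + Finsupp.single x 1)) =
      Module.finrank k (hv.sections D) + 1 := by
  have hf0 : f ≠ 0 := by rintro rfl; exact hf' (zero_mem _)
  rw [hv.sections_add_single hf hf']
  refine ⟨inferInstance, ?_⟩
  have h := Submodule.finrank_sup_add_finrank_inf_eq (hv.sections D) (Submodule.span k {f})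
  have h2 : hv.sections D ⊓ Submodule.span k {f} = ⊥ := by
    rw [eq_bot_iff]
    rintro g ⟨hg, hg'⟩
    obtain ⟨c, rfl⟩ := Submodule.mem_span_singleton.1 hg'
    rcases eq_or_ne c 0 with rfl | hc
    · simp
    · exact absurd ((Submodule.smul_mem_iff _ hc).1 hg) hf'
  rw [h2, finrank_bot, add_zero, finrank_span_singleton hf0] at h
  exact h

lemma finite_finrank_add_single_le (hv : IsCurve k v) (D : X →₀ ℤ) (x : X)
    [FiniteDimensional k (hv.sections D)] :
    FiniteDimensional k (hv.sections (D + Finsupp.single x 1)) ∧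
    Module.finrank k (hv.sections (D + Finsupp.single x 1)) ≤
      Module.finrank k (hv.sections D) + 1 := by
  by_cases h : hv.sections (D + Finsupp.single x 1) ≤ hv.sections D
  · have h' : hv.sections (D + Finsupp.single x 1) = hv.sections D :=
      le_antisymm h (hv.sections_mono (le_add_single D x zero_le_one))
    rw [h']
    exact ⟨inferInstance, by omega⟩
  · obtain ⟨f, hf, hf'⟩ := SetLike.not_le_iff_exists.1 h
    obtain ⟨h1, h2⟩ := hv.finite_finrank_add_single hf hf'
    exact ⟨h1, h2.le⟩

/-- The degree of a divisor. -/
def degree : (X →₀ ℤ) →+ ℤ := Finsupp.liftAddHom fun _ => AddMonoidHom.id ℤ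

@[simp] lemma degree_single (x : X) (n : ℤ) : degree (Finsupp.single x n) = n := by
  simp [degree]

lemma degree_nonneg {D : X →₀ ℤ} (h : 0 ≤ D) : 0 ≤ degree D := by
  rw [degree, Finsupp.liftAddHom_apply]
  exact Finset.sum_nonneg fun x _ => h x

lemma degree_mono {D E : X →₀ ℤ} (h : D ≤ E) : degree D ≤ degree E := by
  have := degree_nonneg (sub_nonneg.2 h)
  rw [map_sub] at this
  omega

lemma exists_pos_of_degree_pos {D : X →₀ ℤ} (h : 0 < degree D) : ∃ x, 0 < D x := by
  by_contra! hD
  have := degree_mono (D := D) (E := 0) hD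
  simp at this
  omega

/-- Induction from a divisor upwards, point by point. -/
lemma divisor_induction {P : (X →₀ ℤ) → Prop} (D : X →₀ ℤ) (h0 : P D)
    (h1 : ∀ E x, D ≤ E → P E → P (E + Finsupp.single x 1)) {E : X →₀ ℤ} (hE : D ≤ E) : P E := by
  obtain ⟨n, hn⟩ : ∃ n : ℕ, degree (E - D) = n :=
    ⟨_, (Int.toNat_of_nonneg (degree_nonneg (sub_nonneg.2 hE))).symm⟩
  induction n generalizing E with
  | zero =>
    have : E = D := by
      by_contra hne
      have : ∃ x, D x < E x := by
        by_contra! h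
        exact hne (le_antisymm h hE)
      obtain ⟨x, hx⟩ := this
      have h2 : Finsupp.single x 1 ≤ E - D := by
        classical
        intro y
        rw [Finsupp.single_apply, Finsupp.sub_apply]
        have := hE y
        split_ifs with hxy
        · subst hxy; omega
        · omega
      have := degree_mono h2
      rw [degree_single, hn] at this
      simp at this
    rwa [this]
  | succ n ih =>
    obtain ⟨x, hx⟩ := exists_pos_of_degree_pos (D := E - D) (by omega)
    have h2 : D ≤ E - Finsupp.single x 1 := by
      classical
      intro y
      rw [Finsupp.sub_apply] at hx
      rw [Finsupp.sub_apply, Finsupp.single_apply]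
      have := hE y
      split_ifs with hxy
      · subst hxy; omega
      · omega
    have := h1 _ x h2 (ih h2 (by
      rw [sub_right_comm, map_sub, degree_single, hn]; push_cast; ring))
    rwa [sub_add_cancel] at this

lemma finite_finrank_le (hv : IsCurve k v) {D E : X →₀ ℤ} (hE : D ≤ E)
    [FiniteDimensional k (hv.sections D)] :
    FiniteDimensional k (hv.sections E) ∧
    (Module.finrank k (hv.sections E) : ℤ) ≤
      Module.finrank k (hv.sections D) + degree (E - D) := by
  refine divisor_induction (P := fun E => FiniteDimensional k (hv.sections E) ∧
    (Module.finrank k (hv.sections E) : ℤ) ≤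
      Module.finrank k (hv.sections D) + degree (E - D)) D ⟨inferInstance, by simp⟩ ?_ hE
  rintro E x - ⟨h1, h2⟩
  obtain ⟨h3, h4⟩ := hv.finite_finrank_add_single_le E x
  refine ⟨h3, ?_⟩
  rw [add_sub_right_comm, map_add, degree_single]
  omega

lemma sections_zero (hv : IsCurve k v) : hv.sections 0 = Submodule.span k {1} := by
  ext f
  rw [Submodule.mem_span_singleton]
  constructor
  · intro h
    obtain ⟨c, rfl⟩ := hv.regular f fun x => (h x).trans_eq (by simp)
    exact ⟨c, by rw [Algebra.smul_def, mul_one]⟩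
  · rintro ⟨c, rfl⟩ x
    rw [Algebra.smul_def, mul_one]
    exact hv.const_le x c

lemma sections_of_le_zero (hv : IsCurve k v) {D : X →₀ ℤ} (h : D ≤ 0) :
    FiniteDimensional k (hv.sections D) := by
  have : FiniteDimensional k (hv.sections 0) := by rw [hv.sections_zero]; infer_instance
  exact Submodule.finiteDimensional_of_le (hv.sections_mono h)

lemma finiteDimensional_sections (hv : IsCurve k v) (D : X →₀ ℤ) :
    FiniteDimensional k (hv.sections D) := by
  have := hv.sections_of_le_zero (inf_le_right : D ⊓ 0 ≤ 0)
  exact (hv.finite_finrank_le (inf_le_left : D ⊓ 0 ≤ D)).1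

lemma finrank_sections_zero (hv : IsCurve k v) : Module.finrank k (hv.sections 0) = 1 := by
  rw [hv.sections_zero, finrank_span_singleton one_ne_zero]

/-- The repartition `r` is the sum of a rational function and of a repartition bounded by `D`. -/
def IsPrincipalMod (v : X → Valuation K ℤᵐ⁰) (D : X →₀ ℤ) (r : X → K) : Prop :=
  ∃ f, ∀ x, v x (r x - f) ≤ exp (D x)

/-- Almost all components of `r` are regular. -/
def IsRepartition (v : X → Valuation K ℤᵐ⁰) (r : X → K) : Prop := {x | 1 < v x (r x)}.Finite

/-- The curve has genus one: repartitions modulo the regular and constant ones form a line. -/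
def IsGenusOne (k : Type*) {K X : Type*} [Field k] [Field K] [Algebra k K]
    (v : X → Valuation K ℤᵐ⁰) : Prop :=
  ∃ r₀, IsRepartition v r₀ ∧ ¬ IsPrincipalMod v 0 r₀ ∧
    ∀ r, IsRepartition v r → ∃ c : k, IsPrincipalMod v 0 (r - c • r₀)

lemma IsPrincipalMod.add {D : X →₀ ℤ} {r s : X → K} (hr : IsPrincipalMod v D r)
    (hs : IsPrincipalMod v D s) : IsPrincipalMod v D (r + s) := by
  obtain ⟨f, hf⟩ := hr
  obtain ⟨g, hg⟩ := hs
  refine ⟨f + g, fun x => ?_⟩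
  rw [Pi.add_apply, add_sub_add_comm]
  exact (v x).map_add_le (hf x) (hg x)

lemma IsPrincipalMod.smul (hv : IsCurve k v) {D : X →₀ ℤ} {r : X → K} (hr : IsPrincipalMod v D r)
    (c : k) : IsPrincipalMod v D (c • r) := by
  obtain ⟨f, hf⟩ := hr
  refine ⟨c • f, fun x => ?_⟩
  rw [Pi.smul_apply, ← smul_sub]
  exact (hv.smul_le x c _).trans (hf x)

lemma IsPrincipalMod.mono {D E : X →₀ ℤ} {r : X → K} (hr : IsPrincipalMod v D r) (h : D ≤ E) :
    IsPrincipalMod v E r := by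
  obtain ⟨f, hf⟩ := hr
  exact ⟨f, fun x => (hf x).trans (exp_le_exp.2 (h x))⟩

lemma IsRepartition.mul (hv : IsCurve k v) {r : X → K} (hr : IsRepartition v r) (f : K) :
    IsRepartition v (fun x => f * r x) := by
  refine (hr.union (hv.finite f)).subset fun x hx => ?_
  by_contra h
  simp only [Set.mem_union, Set.mem_ofPred_eq, not_or, not_lt] at h hx
  rw [map_mul] at hx
  exact hx.not_ge (mul_le_one' h.2 h.1)

open Classical in
/-- A repartition concentrated at one point. -/
lemma isRepartition_single (v : X → Valuation K ℤᵐ⁰) (x : X) (f : K) :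
    IsRepartition v (Pi.single x f) := by
  refine (Set.finite_singleton x).subset fun y hy => ?_
  by_contra h
  simp [Pi.single_eq_of_ne h] at hy

/-- There is no function with a single simple pole. -/
lemma sections_single (hv : IsCurve k v) (hg : IsGenusOne k v) (x : X) :
    hv.sections (Finsupp.single x 1) = hv.sections 0 := by
  refine le_antisymm (fun f hf => ?_) (hv.sections_mono (Finsupp.single_nonneg.2 zero_le_one))
  by_contra hf'
  rw [← zero_add (Finsupp.single x 1)] at hf
  have hf0 : f ≠ 0 := by rintro rfl; exact hf' (zero_mem _)
  have hfx : v x f = exp 1 := by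
    rw [eq_exp_iff]
    exact ⟨(hf x).trans_eq (by simp), fun h => hf' (hv.mem_sections_of_add_single hf h)⟩
  have hfy : ∀ y, y ≠ x → v y f ≤ 1 := fun y hy =>
    (hf y).trans_eq (by rw [add_single_apply_ne _ _ hy]; simp)
  -- If `f` had a single simple pole at `x`, multiples of `f` would absorb any simple pole at `x`,
  -- so working modulo `x` or modulo 0 would make no difference. Multiplication by `f` would then
  -- act on the one-dimensional space of repartition classes, hence as a scalar `c`.
  have key : ∀ r, IsPrincipalMod v (Finsupp.single x 1) r → IsPrincipalMod v 0 r := by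
    rintro r ⟨g, hr⟩
    obtain ⟨c, hc⟩ := hv.exists_sub_lt x (f := f) (g := r x - g) hf0
      (by rw [hfx]; exact (hr x).trans_eq (by simp))
    refine ⟨g + c • f, fun y => ?_⟩
    rw [← sub_sub]
    rcases eq_or_ne y x with rfl | hy
    · rw [hfx, lt_exp_iff] at hc
      simpa using hc
    · refine (v y).map_sub_le ((hr y).trans_eq ?_) ((hv.smul_le y c f).trans (by simpa using hfy y hy))
      simp [Finsupp.single_eq_of_ne hy]
  have hmul : ∀ r, IsPrincipalMod v 0 r → IsPrincipalMod v 0 (fun y => f * r y) := by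
    rintro r ⟨g, hr⟩
    refine key _ ⟨f * g, fun y => ?_⟩
    rw [← mul_sub, map_mul]
    rcases eq_or_ne y x with rfl | hy
    · rw [hfx]
      exact (mul_le_mul_right (hr y) _).trans_eq (by simp)
    · exact (mul_le_mul' (hfy y hy) (hr y)).trans_eq (by simp [Finsupp.single_eq_of_ne hy])
  obtain ⟨r₀, h1, h2, h3⟩ := hg
  obtain ⟨c, hc⟩ := h3 _ (h1.mul hv f)
  have hne : f - algebraMap k K c ≠ 0 := by
    intro h
    rw [sub_eq_zero] at h
    exact hf' (by rw [h]; exact fun y => hv.const_le y c)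
  -- Multiplication by `f - c` kills every class, but it is invertible on repartitions since `f` is
  -- not constant; so all classes vanish, against genus one.
  have all : ∀ r, IsRepartition v r → IsPrincipalMod v 0 (fun y => (f - algebraMap k K c) * r y) := by
    intro r hr
    obtain ⟨d, hd⟩ := h3 r hr
    convert ((hmul _ hd).add (hd.smul hv (-c))).add (hc.smul hv d) using 1
    ext y
    simp only [Pi.add_apply, Pi.smul_apply, Pi.sub_apply]
    simp only [Algebra.smul_def, map_neg]
    ring
  apply h2
  convert all _ (h1.mul hv (f - algebraMap k K c)⁻¹) using 1
  ext y
  rw [mul_inv_cancel_left₀ hne]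

/-- Every repartition is principal modulo a nontrivial effective divisor. -/
lemma isPrincipalMod_of_pos (hv : IsCurve k v) (hg : IsGenusOne k v) {x : X} {D : X →₀ ℤ}
    (hD : Finsupp.single x 1 ≤ D) {r : X → K} (hr : IsRepartition v r) : IsPrincipalMod v D r := by
  classical
  refine IsPrincipalMod.mono ?_ hD
  obtain ⟨t, ht⟩ := hv.uniformizer x
  have htinv : v x t⁻¹ = exp 1 := by rw [map_inv₀, ht, ← exp_neg, neg_neg]
  -- A simple pole at `x` alone gives a nonzero class, as otherwise some function would have just
  -- this pole. The class therefore generates, and it dies modulo `x`.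
  have hδ : ¬ IsPrincipalMod v 0 (Pi.single x t⁻¹) := by
    rintro ⟨f, hf⟩
    have h1 : f ∈ hv.sections (Finsupp.single x 1) := by
      intro y
      rcases eq_or_ne y x with rfl | hy
      · have := hf y
        rw [Pi.single_eq_same] at this
        have h2 := (v y).map_sub_le (g := exp 1) htinv.le (this.trans (exp_le_exp.2 zero_le_one))
        simpa using h2
      · have := hf y
        rw [Pi.single_eq_of_ne hy, zero_sub, Valuation.map_neg] at this
        exact this.trans (exp_le_exp.2 ((Finsupp.single_nonneg.2 zero_le_one : (0 : X →₀ ℤ) ≤ _) y))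
    rw [hv.sections_single hg] at h1
    have h3 := hf x
    rw [Pi.single_eq_same] at h3
    have h4 := (v x).map_add_le h3 (h1 x)
    rw [sub_add_cancel, htinv, exp_le_exp] at h4
    simp at h4
  obtain ⟨r₀, h1, h2, h3⟩ := hg
  obtain ⟨c, hc⟩ := h3 _ (isRepartition_single v x t⁻¹)
  obtain ⟨d, hd⟩ := h3 r hr
  have hc0 : c ≠ 0 := by
    rintro rfl
    exact hδ (by simpa using hc)
  have hδ' : IsPrincipalMod v (Finsupp.single x 1) (Pi.single x t⁻¹) := by
    refine ⟨0, fun y => ?_⟩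
    rcases eq_or_ne y x with rfl | hy
    · simp [ht]
    · simp [Pi.single_eq_of_ne hy]
  have h0 : (0 : X →₀ ℤ) ≤ Finsupp.single x 1 := Finsupp.single_nonneg.2 zero_le_one
  convert ((hd.mono h0).add ((hc.mono h0).smul hv (-d / c))).add (hδ'.smul hv (d / c)) using 1
  ext y
  simp only [Pi.add_apply, Pi.smul_apply, Pi.sub_apply]
  simp only [Algebra.smul_def, map_neg, map_div₀]
  have : algebraMap k K c ≠ 0 := by simpa using hc0
  field_simp
  ring

lemma exists_zpow (hv : IsCurve k v) (x : X) (n : ℤ) : ∃ t, v x t = exp n := by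
  obtain ⟨t, ht⟩ := hv.uniformizer x
  exact ⟨t ^ (-n), by rw [map_zpow₀, ht, ← exp_zsmul]; simp⟩

/-- The repartition with a pole of order `D y + 1` at `y` only is principal modulo `D`, since the
obstruction space of `D` vanishes. The function that realises this has precisely the new pole. -/
lemma exists_mem_add_single_notMem (hv : IsCurve k v) (hg : IsGenusOne k v) {x : X} {D : X →₀ ℤ}
    (hD : Finsupp.single x 1 ≤ D) (y : X) :
    ∃ f ∈ hv.sections (D + Finsupp.single y 1), f ∉ hv.sections D := by
  classical
  obtain ⟨t, ht⟩ := hv.exists_zpow y (D y + 1)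
  obtain ⟨f, hf⟩ := hv.isPrincipalMod_of_pos hg hD (isRepartition_single v y t)
  refine ⟨f, fun z => ?_, fun h => ?_⟩
  · rcases eq_or_ne z y with rfl | hz
    · have := hf z
      rw [Pi.single_eq_same] at this
      rw [add_single_apply_self]
      simpa using (v z).map_sub_le ht.le (this.trans (exp_le_exp.2 (by omega)))
    · have := hf z
      rw [Pi.single_eq_of_ne hz, zero_sub, Valuation.map_neg] at this
      rwa [add_single_apply_ne _ _ hz]
  · have := (v y).map_add_le (hf y) (h y)
    rw [Pi.single_eq_same, sub_add_cancel, ht, exp_le_exp] at this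
    omega

/-- At a single point the space is the constants, of dimension 1, and from there on each added point
contributes exactly one dimension. -/
lemma finrank_sections_of_pos (hv : IsCurve k v) (hg : IsGenusOne k v) {x : X} {D : X →₀ ℤ}
    (hD : Finsupp.single x 1 ≤ D) : (Module.finrank k (hv.sections D) : ℤ) = degree D := by
  refine divisor_induction (P := fun E => (Module.finrank k (hv.sections E) : ℤ) = degree E)
    (Finsupp.single x 1) ?_ (fun E y hE h => ?_) hD
  · rw [hv.sections_single hg, hv.finrank_sections_zero, degree_single]; rfl
  · have := hv.finiteDimensional_sections E
    obtain ⟨f, h1, h2⟩ := hv.exists_mem_add_single_notMem hg hE y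
    rw [(hv.finite_finrank_add_single h1 h2).2, map_add, degree_single, ← h]
    push_cast; ring

lemma finite_ne_one (hv : IsCurve k v) {f : K} (hf : f ≠ 0) : {x | v x f ≠ 1}.Finite := by
  refine ((hv.finite f).union (hv.finite f⁻¹)).subset fun x hx => ?_
  rcases lt_or_gt_of_ne (show v x f ≠ 1 from hx) with h | h
  · right
    change 1 < v x f⁻¹
    rw [map_inv₀]
    exact (one_lt_inv₀ (zero_lt_iff.2 ((v x).ne_zero_iff.2 hf))).2 h
  · left; exact h

/-- The principal divisor of a rational function. -/
def div (hv : IsCurve k v) (f : K) : X →₀ ℤ := by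
  classical
  exact if hf : f = 0 then 0 else
    Finsupp.onFinset (hv.finite_ne_one hf).toFinset (fun x => -log (v x f)) fun x hx => by
      simp only [Set.Finite.mem_toFinset, Set.mem_ofPred_eq]
      rintro h
      simp [h] at hx

lemma exp_div (hv : IsCurve k v) {f : K} (hf : f ≠ 0) (x : X) : v x f = exp (-(hv.div f x)) := by
  rw [div, dif_neg hf, Finsupp.onFinset_apply, neg_neg, exp_log ((v x).ne_zero_iff.2 hf)]

lemma mul_mem_sections_iff (hv : IsCurve k v) {f g : K} (hf : f ≠ 0) {D : X →₀ ℤ} :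
    f * g ∈ hv.sections D ↔ g ∈ hv.sections (D + hv.div f) := by
  refine forall_congr' fun x => ?_
  rw [map_mul, hv.exp_div hf, Finsupp.add_apply]
  rcases eq_or_ne (v x g) 0 with h | h
  · simp [h]
  · obtain ⟨n, hn⟩ := exists_exp_eq h
    rw [hn, ← exp_add, exp_le_exp, exp_le_exp]
    omega

lemma finrank_sections_add_div (hv : IsCurve k v) {f : K} (hf : f ≠ 0) (D : X →₀ ℤ) :
    Module.finrank k (hv.sections (D + hv.div f)) = Module.finrank k (hv.sections D) := by
  refine LinearEquiv.finrank_eq (LinearEquiv.ofBijective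
    ((LinearMap.mulLeft k f).restrict fun g hg => (hv.mul_mem_sections_iff hf).2 hg) ⟨?_, ?_⟩)
  · intro a b h
    exact Subtype.ext (mul_left_cancel₀ hf (congrArg Subtype.val h))
  · rintro ⟨g, hg⟩
    refine ⟨⟨f⁻¹ * g, (hv.mul_mem_sections_iff hf).1 (by rwa [mul_inv_cancel_left₀ hf])⟩, ?_⟩
    exact Subtype.ext (mul_inv_cancel_left₀ hf g)

lemma exists_point (hg : IsGenusOne k v) : Nonempty X := by
  by_contra h
  rw [not_nonempty_iff] at h
  obtain ⟨r, -, h2, -⟩ := hg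
  exact h2 ⟨0, fun x => h.elim x⟩

/-- The degree of a principal divisor is zero. -/
lemma degree_div (hv : IsCurve k v) (hg : IsGenusOne k v) {f : K} (hf : f ≠ 0) :
    degree (hv.div f) = 0 := by
  obtain ⟨x⟩ := exists_point hg
  -- `E` is chosen so that both `E` and `E + div f` dominate `x`; multiplication by `f` identifies
  -- their spaces of sections, so their degrees agree.
  set E := Finsupp.single x 1 ⊔ (Finsupp.single x 1 - hv.div f) with hE
  have h1 := hv.finrank_sections_of_pos hg (le_sup_left : _ ≤ E)
  have h2 := hv.finrank_sections_of_pos hg (D := E + hv.div f) (x := x)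
    (by rw [← sub_le_iff_le_add]; exact le_sup_right)
  rw [hv.finrank_sections_add_div hf, h1, map_add] at h2
  linarith

/-- **Riemann-Roch** for curves of genus one. -/
theorem finrank_sections (hv : IsCurve k v) (hg : IsGenusOne k v) {D : X →₀ ℤ}
    (hD : 0 < degree D) : (Module.finrank k (hv.sections D) : ℤ) = degree D := by
  obtain ⟨x⟩ := exists_point hg
  have := hv.finiteDimensional_sections D
  -- Comparison with a larger divisor of known dimension gives `dim L(D) ≥ deg D > 0`. A nonzero
  -- section then replaces `D` by a linearly equivalent divisor that is effective and contains a
  -- point.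
  have h1 := (hv.finite_finrank_le (le_sup_left : D ≤ D ⊔ Finsupp.single x 1)).2
  rw [hv.finrank_sections_of_pos hg le_sup_right, map_sub] at h1
  have h2 : 0 < Module.finrank k (hv.sections D) := by omega
  have h3 : hv.sections D ≠ ⊥ := by
    intro h; rw [h, finrank_bot] at h2; omega
  obtain ⟨f, hf, hf0⟩ := (Submodule.ne_bot_iff _).1 h3
  have h4 : 0 ≤ D + hv.div f := by
    intro y
    have := hf y
    rw [hv.exp_div hf0, exp_le_exp] at this
    rw [Finsupp.add_apply, Finsupp.zero_apply]
    omega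
  have hdeg : degree (D + hv.div f) = degree D := by rw [map_add, hv.degree_div hg hf0, add_zero]
  obtain ⟨y, hy⟩ := exists_pos_of_degree_pos (D := D + hv.div f) (by omega)
  rw [← hv.finrank_sections_add_div hf0, hv.finrank_sections_of_pos hg (x := y), hdeg]
  classical
  intro z
  rw [Finsupp.single_apply]
  split_ifs with hz
  · subst hz; omega
  · exact h4 z

lemma exists_ne_zero_mem_sections (hv : IsCurve k v) (hg : IsGenusOne k v) {D : X →₀ ℤ}
    (hD : 0 < degree D) : ∃ f ∈ hv.sections D, f ≠ 0 := by
  apply (Submodule.ne_bot_iff _).1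
  intro h
  have := hv.finrank_sections hg hD
  rw [h, finrank_bot] at this
  simp at this
  omega

lemma sections_sub_single_lt (hv : IsCurve k v) (hg : IsGenusOne k v) {D : X →₀ ℤ}
    (hD : 1 < degree D) (x : X) :
    hv.sections (D - Finsupp.single x 1) < hv.sections D := by
  refine lt_of_le_of_ne (hv.sections_mono (sub_le_self _ (Finsupp.single_nonneg.2 zero_le_one)))
    fun h => ?_
  have h1 := hv.finrank_sections hg (D := D - Finsupp.single x 1) (by
    rw [map_sub, degree_single]; omega)
  rw [h, hv.finrank_sections hg (by omega), map_sub, degree_single] at h1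
  omega

lemma apply_eq_of_notMem (hv : IsCurve k v) {D : X →₀ ℤ} {x : X} {f : K} (hf : f ∈ hv.sections D)
    (h : f ∉ hv.sections (D - Finsupp.single x 1)) : v x f = exp (D x) := by
  rw [eq_exp_iff]
  refine ⟨hf x, fun h' => h ?_⟩
  refine hv.mem_sections_of_add_single (x := x) (n := 1) (by rwa [sub_add_cancel]) ?_
  simpa using h'

/-- A section of a divisor of degree at least two with given order at two points. -/
lemma exists_mem_sections_apply_eq (hv : IsCurve k v) (hg : IsGenusOne k v) {D : X →₀ ℤ}
    (hD : 1 < degree D) (x y : X) :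
    ∃ f ∈ hv.sections D, v x f = exp (D x) ∧ v y f = exp (D y) := by
  obtain ⟨a, ha, ha'⟩ := SetLike.exists_of_lt (hv.sections_sub_single_lt hg hD x)
  obtain ⟨b, hb, hb'⟩ := SetLike.exists_of_lt (hv.sections_sub_single_lt hg hD y)
  -- A vector space is not the union of two proper subspaces: one of `a`, `b`, `a + b` avoids both.
  by_cases h1 : a ∈ hv.sections (D - Finsupp.single y 1)
  · by_cases h2 : b ∈ hv.sections (D - Finsupp.single x 1)
    · refine ⟨a + b, add_mem ha hb, hv.apply_eq_of_notMem (add_mem ha hb) fun h => ha' ?_,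
        hv.apply_eq_of_notMem (add_mem ha hb) fun h => hb' ?_⟩
      · simpa using sub_mem h h2
      · simpa using sub_mem h h1
    · exact ⟨b, hb, hv.apply_eq_of_notMem hb h2, hv.apply_eq_of_notMem hb hb'⟩
  · exact ⟨a, ha, hv.apply_eq_of_notMem ha ha', hv.apply_eq_of_notMem ha h1⟩

end IsCurve

end RiemannRoch

/-! ### Sections of a divisor of degree three: values at points and adapted bases -/

section PlaneCubic

open WithZero MvPolynomial

variable {k K S : Type*} [Field k] [Field K] [Algebra k K]

lemma aeval_smul_of_isHomogeneous {σ R A : Type*} [CommRing R] [CommRing A] [Algebra R A]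
    {F : MvPolynomial σ R} {n : ℕ} (hF : F.IsHomogeneous n) (t : A) (a : σ → A) :
    aeval (fun i => t * a i) F = t ^ n * aeval a F := by
  rw [aeval_def, aeval_def, eval₂_eq, eval₂_eq, Finset.mul_sum]
  refine Finset.sum_congr rfl fun d hd => ?_
  rw [hF.degree_eq_sum_deg_support hd]
  simp only [mul_pow, Finset.prod_mul_distrib, Finset.prod_pow_eq_pow_sum]
  ring

lemma eval_smul_of_isHomogeneous {σ R : Type*} [CommRing R]
    {F : MvPolynomial σ R} {n : ℕ} (hF : F.IsHomogeneous n) (t : R) (a : σ → R) :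
    MvPolynomial.eval (t • a) F = t ^ n * MvPolynomial.eval a F := by
  exact aeval_smul_of_isHomogeneous hF t a

lemma eval_zero_of_isHomogeneous {σ R : Type*} [CommRing R]
    {F : MvPolynomial σ R} {n : ℕ} (hF : F.IsHomogeneous n) (hn : n ≠ 0) : MvPolynomial.eval 0 F = 0 := by
  have := eval_smul_of_isHomogeneous hF 0 0
  rwa [zero_smul, zero_pow hn, zero_mul] at this

/-- A dual number point is a point with a tangent vector, and the `ε`-part is the derivative along
it. This allows singular points to be transported through changes of coordinates without the chain
rule. -/
lemma aeval_dualNumber_snd {σ R : Type*} [CommRing R] [Fintype σ] (F : MvPolynomial σ R)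
    (z : σ → DualNumber R) :
    (aeval z F).fst = MvPolynomial.eval (fun i => (z i).fst) F ∧
    (aeval z F).snd = ∑ i, (z i).snd * MvPolynomial.eval (fun i => (z i).fst) (pderiv i F) := by
  classical
  induction F using MvPolynomial.induction_on with
  | C a => simp [TrivSqZeroExt.algebraMap_eq_inl]
  | add p q hp hq =>
    simp only [map_add, TrivSqZeroExt.fst_add, TrivSqZeroExt.snd_add, hp.1, hp.2, hq.1, hq.2,
      mul_add, Finset.sum_add_distrib, and_self]
  | mul_X p j hp =>
    refine ⟨by simp [hp.1], ?_⟩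
    simp only [map_mul, aeval_X, TrivSqZeroExt.snd_mul, hp.1, hp.2, Derivation.leibniz, map_add,
      smul_eq_mul, eval_X, pderiv_X, mul_add, Finset.sum_add_distrib, MulOpposite.smul_eq_mul_unop,
      MulOpposite.unop_op]
    congr 1
    · rw [Finset.sum_eq_single j]
      · simp [mul_comm]
      · intro i _ hij; simp [hij.symm]
      · simp
    · rw [Finset.sum_mul]
      refine Finset.sum_congr rfl fun i _ => by ring

namespace IsCurve

variable {v : S → Valuation K ℤᵐ⁰}

lemma aeval_le_one (hv : IsCurve k v) {σ : Type*} (x : S) {a : σ → K} (ha : ∀ i, v x (a i) ≤ 1)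
    (F : MvPolynomial σ k) : v x (aeval a F) ≤ 1 := by
  induction F using MvPolynomial.induction_on with
  | C c => rw [aeval_C]; exact hv.const_le x c
  | add p q hp hq => rw [map_add]; exact (v x).map_add_le hp hq
  | mul_X p j hp => rw [map_mul, aeval_X, map_mul]; exact mul_le_one' hp (ha j)

lemma aeval_mem_sections (hv : IsCurve k v) {σ : Type*} {N : S →₀ ℤ} {s : σ → K}
    (hs : ∀ i, s i ∈ hv.sections N) {n : ℕ} {F : MvPolynomial σ k} (hF : F.IsHomogeneous n) :
    aeval s F ∈ hv.sections (n • N) := fun x => by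
  obtain ⟨t, ht⟩ := hv.exists_zpow x (N x)
  have ht0 : t ≠ 0 := by rintro rfl; exact exp_ne_zero ((v x).map_zero.symm.trans ht).symm
  have h : s = fun i => t * (t⁻¹ * s i) := by ext i; rw [mul_inv_cancel_left₀ ht0]
  rw [h, aeval_smul_of_isHomogeneous hF, map_mul, map_pow, ht, Finsupp.smul_apply, exp_nsmul]
  refine mul_le_of_le_one_right' (hv.aeval_le_one x (fun i => ?_) F)
  rw [map_mul, map_inv₀, ht]
  exact inv_mul_le_one_of_le₀ (hs i x) zero_le

lemma aeval_sub_le (hv : IsCurve k v) {σ : Type*} (x : S) {a : σ → K} {w : σ → k}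
    (ha : ∀ i, v x (a i - algebraMap k K (w i)) ≤ exp (-1))
    (F : MvPolynomial σ k) : v x (aeval a F - algebraMap k K (MvPolynomial.eval w F)) ≤ exp (-1) := by
  have ha' : ∀ i, v x (a i) ≤ 1 := fun i => by
    rw [← sub_add_cancel (a i) (algebraMap k K (w i))]
    exact (v x).map_add_le ((ha i).trans (exp_le_exp.2 (by norm_num))) (hv.const_le x _)
  induction F using MvPolynomial.induction_on with
  | C c => simp
  | add p q hp hq =>
    rw [map_add, map_add, map_add, add_sub_add_comm]; exact (v x).map_add_le hp hq
  | mul_X p j hp =>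
    have : aeval a (p * X j) - algebraMap k K (MvPolynomial.eval w (p * X j)) =
      (aeval a p - algebraMap k K (MvPolynomial.eval w p)) * a j +
        algebraMap k K (MvPolynomial.eval w p) * (a j - algebraMap k K (w j)) := by
      simp only [map_mul, aeval_X, eval_X]; ring
    rw [this]
    refine (v x).map_add_le ?_ ?_
    · rw [map_mul]; exact (mul_le_of_le_one_right' (ha' j)).trans hp
    · rw [map_mul]; exact (mul_le_of_le_one_left' (hv.const_le x _)).trans (ha j)

/-- First order Taylor expansion of a polynomial at a point of the curve. -/
lemma aeval_sub_sub_le (hv : IsCurve k v) {σ : Type*} [Fintype σ] (x : S) {a : σ → K} {w u : σ → k}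
    {τ : K} (hτ : v x τ = exp (-1))
    (ha : ∀ i, v x (a i - algebraMap k K (w i) - τ * algebraMap k K (u i)) ≤ exp (-2))
    (F : MvPolynomial σ k) :
    v x (aeval a F - algebraMap k K (MvPolynomial.eval w F) -
      τ * algebraMap k K (∑ i, u i * MvPolynomial.eval w (pderiv i F))) ≤ exp (-2) := by
  classical
  have hτ1 : v x τ ≤ 1 := hτ.le.trans (exp_le_exp.2 (by norm_num))
  have ha' : ∀ i, v x (a i) ≤ 1 := fun i => by
    rw [← sub_add_cancel (a i) (algebraMap k K (w i))]
    refine (v x).map_add_le ?_ (hv.const_le x _)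
    rw [← sub_add_cancel (a i - _) (τ * algebraMap k K (u i))]
    refine (v x).map_add_le ((ha i).trans (exp_le_exp.2 (by norm_num))) ?_
    rw [map_mul]
    exact mul_le_one' hτ1 (hv.const_le x _)
  induction F using MvPolynomial.induction_on with
  | C c => simp
  | add p q hp hq =>
    convert (v x).map_add_le hp hq using 2
    simp only [map_add, mul_add, Finset.sum_add_distrib]
    ring
  | mul_X p j hp =>
    set d := ∑ i, u i * MvPolynomial.eval w (pderiv i p) with hd
    have hd' : ∑ i, u i * MvPolynomial.eval w (pderiv i (p * X j)) = d * w j + MvPolynomial.eval w p * u j := by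
      simp only [Derivation.leibniz, map_add, smul_eq_mul, map_mul, eval_X, pderiv_X, mul_add,
        Finset.sum_add_distrib]
      rw [add_comm, hd, Finset.sum_mul]
      congr 1
      · refine Finset.sum_congr rfl fun i _ => by ring
      · rw [Finset.sum_eq_single j]
        · simp [mul_comm]
        · intro i _ hij; simp [hij.symm]
        · simp
    rw [hd']
    have : aeval a (p * X j) - algebraMap k K (MvPolynomial.eval w (p * X j)) -
        τ * algebraMap k K (d * w j + MvPolynomial.eval w p * u j) =
      (aeval a p - algebraMap k K (MvPolynomial.eval w p) - τ * algebraMap k K d) * a j +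
      (algebraMap k K (MvPolynomial.eval w p) + τ * algebraMap k K d) *
        (a j - algebraMap k K (w j) - τ * algebraMap k K (u j)) +
      τ ^ 2 * (algebraMap k K (d * u j)) := by
      simp only [map_mul, map_add, aeval_X, eval_X]; ring
    rw [this]
    refine (v x).map_add_le ((v x).map_add_le ?_ ?_) ?_
    · rw [map_mul]; exact (mul_le_of_le_one_right' (ha' j)).trans hp
    · rw [map_mul]
      refine (mul_le_of_le_one_left' ?_).trans (ha j)
      refine (v x).map_add_le (hv.const_le x _) ?_
      rw [map_mul]
      exact mul_le_one' hτ1 (hv.const_le x _)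
    · rw [map_mul, map_pow, hτ, ← exp_nsmul]
      exact mul_le_of_le_one_right' (hv.const_le x _)

/-- The vector `w` consists of the values at `x` of the sections `s` of `N`, with respect to the
local generator `t`. -/
structure IsValue (hv : IsCurve k v) {σ : Type*} (N : S →₀ ℤ) (s : σ → K) (x : S) (t : K)
    (w : σ → k) : Prop where
  gen : v x t = exp (N x)
  le : ∀ i, v x (s i - t * algebraMap k K (w i)) ≤ exp (N x - 1)

lemma const_eq_zero (hv : IsCurve k v) {x : S} {t : K} {n : ℤ} (ht : v x t = exp n) {c : k}
    (h : v x (t * algebraMap k K c) ≤ exp (n - 1)) : c = 0 := by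
  by_contra hc
  rw [map_mul, hv.const x c hc, mul_one, ht, exp_le_exp] at h
  omega

lemma ne_zero_of_eq_exp {x : S} {t : K} {n : ℤ} (ht : v x t = exp n) : t ≠ 0 := by
  rintro rfl; exact exp_ne_zero ((v x).map_zero.symm.trans ht).symm

lemma exists_isValue (hv : IsCurve k v) {σ : Type*} {N : S →₀ ℤ} {s : σ → K} {x : S} {t : K}
    (ht : v x t = exp (N x)) (hs : ∀ i, s i ∈ hv.sections N) : ∃ w, hv.IsValue N s x t w := by
  have h (i : σ) := hv.exists_sub_lt x (f := t) (g := s i) (ne_zero_of_eq_exp ht)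
    (by rw [ht]; exact hs i x)
  choose w hw using h
  refine ⟨w, ht, fun i => ?_⟩
  have := hw i
  rwa [ht, lt_exp_iff, Algebra.smul_def, mul_comm] at this

lemma IsValue.aeval_sub_le {hv : IsCurve k v} {σ : Type*} {N : S →₀ ℤ} {s : σ → K} {x : S} {t : K}
    {w : σ → k} (h : hv.IsValue N s x t w) {n : ℕ} {F : MvPolynomial σ k} (hF : F.IsHomogeneous n) :
    v x (aeval s F - t ^ n * algebraMap k K (MvPolynomial.eval w F)) ≤ exp ((n • N) x - 1) := by
  have ht0 := ne_zero_of_eq_exp h.gen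
  have hs : s = fun i => t * (t⁻¹ * s i) := by ext i; rw [mul_inv_cancel_left₀ ht0]
  rw [hs, aeval_smul_of_isHomogeneous hF, ← mul_sub, map_mul, map_pow, h.gen]
  have h1 : exp ((n • N) x - 1) = exp (N x) ^ n * exp (-1) := by
    rw [Finsupp.smul_apply, sub_eq_add_neg, exp_add, exp_nsmul]
  rw [h1]
  refine mul_le_mul_right (hv.aeval_sub_le x (fun i => ?_) F) _
  have : t⁻¹ * s i - algebraMap k K (w i) = t⁻¹ * (s i - t * algebraMap k K (w i)) := by
    rw [mul_sub, inv_mul_cancel_left₀ ht0]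
  rw [this, map_mul, map_inv₀, h.gen, ← exp_neg]
  refine (mul_le_mul_right (h.le i) _).trans_eq ?_
  rw [← exp_add]; congr 1; ring

lemma IsValue.gen_pow {hv : IsCurve k v} {σ : Type*} {N : S →₀ ℤ} {s : σ → K} {x : S} {t : K}
    {w : σ → k} (h : hv.IsValue N s x t w) (n : ℕ) : v x (t ^ n) = exp ((n • N) x) := by
  rw [map_pow, h.gen, Finsupp.smul_apply, exp_nsmul]

/-- A form vanishes at the values of the sections if and only if the corresponding section
vanishes. -/
lemma IsValue.eval_eq_zero_iff {hv : IsCurve k v} {σ : Type*} {N : S →₀ ℤ} {s : σ → K} {x : S}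
    {t : K} {w : σ → k} (h : hv.IsValue N s x t w) {n : ℕ} {F : MvPolynomial σ k}
    (hF : F.IsHomogeneous n) : MvPolynomial.eval w F = 0 ↔ v x (aeval s F) ≤ exp ((n • N) x - 1) := by
  have h1 := h.aeval_sub_le hF
  constructor
  · intro h2; simpa [h2] using h1
  · intro h2
    refine hv.const_eq_zero (h.gen_pow n) ?_
    have := (v x).map_sub_le h2 h1
    rwa [sub_sub_cancel] at this

lemma IsValue.eval_eq_zero {hv : IsCurve k v} {σ : Type*} {N : S →₀ ℤ} {s : σ → K} {x : S}
    {t : K} {w : σ → k} (h : hv.IsValue N s x t w) {n : ℕ} {F : MvPolynomial σ k}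
    (hF : F.IsHomogeneous n) (h0 : aeval s F = 0) : MvPolynomial.eval w F = 0 := by
  rw [h.eval_eq_zero_iff hF, h0]; simp

lemma IsValue.congr {hv : IsCurve k v} {σ τ : Type*} {N : S →₀ ℤ} {s : σ → K} {x : S}
    {t : K} {w : σ → k} (h : hv.IsValue N s x t w) {A : τ → MvPolynomial σ k}
    (hA : ∀ i, (A i).IsHomogeneous 1) {s' : τ → K} (hs : ∀ i, aeval s (A i) = s' i) :
    hv.IsValue N s' x t (fun i => MvPolynomial.eval w (A i)) := by
  refine ⟨h.gen, fun i => ?_⟩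
  have := h.aeval_sub_le (hA i)
  rwa [pow_one, one_smul, hs i] at this

lemma IsValue.unique {hv : IsCurve k v} {σ : Type*} {N : S →₀ ℤ} {s : σ → K} {x : S}
    {t : K} {w w' : σ → k} (h : hv.IsValue N s x t w) (h' : hv.IsValue N s x t w') : w = w' := by
  ext i
  refine sub_eq_zero.1 (hv.const_eq_zero h.gen ?_)
  convert (v x).map_sub_le (h'.le i) (h.le i) using 2
  rw [map_sub]; ring

lemma exists_sub_smul_mem (hv : IsCurve k v) {D : S →₀ ℤ} {x : S} {f g : K}
    (hf : f ∈ hv.sections D) (hfx : v x f = exp (D x)) (hg : g ∈ hv.sections D) :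
    ∃ c : k, g - c • f ∈ hv.sections (D - Finsupp.single x 1) := by
  obtain ⟨c, hc⟩ := hv.exists_sub_lt x (ne_zero_of_eq_exp hfx) ((hg x).trans_eq hfx.symm)
  refine ⟨c, hv.mem_sections_of_add_single (x := x) (n := 1) ?_ ?_⟩
  · rw [sub_add_cancel]; exact sub_mem hg (Submodule.smul_mem _ _ hf)
  · rw [hfx, lt_exp_iff] at hc; simpa using hc

lemma eq_zero_of_smul_mem (hv : IsCurve k v) {D : S →₀ ℤ} {x : S} {f : K}
    (hfx : v x f = exp (D x)) {c : k} (h : c • f ∈ hv.sections (D - Finsupp.single x 1)) :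
    c = 0 := by
  refine hv.const_eq_zero hfx ?_
  have := h x
  rw [Algebra.smul_def, mul_comm] at this
  simpa using this

lemma pow_mem_sections (hv : IsCurve k v) {D : S →₀ ℤ} {f : K} (hf : f ∈ hv.sections D) (n : ℕ) :
    f ^ n ∈ hv.sections (n • D) := fun x => by
  rw [map_pow, Finsupp.smul_apply, exp_nsmul]
  exact pow_le_pow_left₀ zero_le (hf x) n

/-- A basis of the sections of `N` that is adapted to the flag of sections vanishing at `P`. -/
structure IsAdapted (hv : IsCurve k v) (N : S →₀ ℤ) (P P' : S) (s : Fin 3 → K) : Prop where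
  div_zero : ∀ x, v x (s 0) =
    exp ((N - Finsupp.single P 1 - Finsupp.single P 1 - Finsupp.single P' 1 : S →₀ ℤ) x)
  mem_one : s 1 ∈ hv.sections (N - Finsupp.single P 1)
  one_left : v P (s 1) = exp ((N - Finsupp.single P 1 : S →₀ ℤ) P)
  one_right : v P' (s 1) = exp ((N - Finsupp.single P 1 : S →₀ ℤ) P')
  mem_two : s 2 ∈ hv.sections N
  two_left : v P (s 2) = exp (N P)
  two_right : v P' (s 2) = exp (N P')

lemma eq_of_degree_eq {D E : S →₀ ℤ} (h : D ≤ E) (hdeg : degree E = degree D) : D = E := by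
  refine divisor_induction (P := fun E => degree E = degree D → D = E) D (fun _ => rfl) ?_ h hdeg
  intro E x hE _ h'
  have := degree_mono hE
  rw [map_add, degree_single] at h'
  omega

/-- A nonzero section of `N - 2P` has a residual divisor that is effective of degree 1, a point
`P'`. Geometrically, `s 0` is the tangent line at `P`, and `P'` is its third intersection with the
cubic; `P' = P` is allowed. -/
lemma exists_isAdapted (hv : IsCurve k v) (hg : IsGenusOne k v) {N : S →₀ ℤ} (hN : degree N = 3)
    (P : S) : ∃ P' s, hv.IsAdapted N P P' s := by
  obtain ⟨s0, h0, h00⟩ := hv.exists_ne_zero_mem_sections hg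
    (D := N - Finsupp.single P 1 - Finsupp.single P 1) (by simp [hN])
  have h4 : 0 ≤ N - Finsupp.single P 1 - Finsupp.single P 1 + hv.div s0 := by
    intro y
    have := h0 y
    rw [hv.exp_div h00, exp_le_exp] at this
    rw [Finsupp.add_apply, Finsupp.zero_apply]
    omega
  have hdeg : degree (N - Finsupp.single P 1 - Finsupp.single P 1 + hv.div s0) = 1 := by
    rw [map_add, hv.degree_div hg h00]; simp [hN]
  obtain ⟨P', hP'⟩ := exists_pos_of_degree_pos (by rw [hdeg]; exact one_pos)
  have h5 : Finsupp.single P' 1 = N - Finsupp.single P 1 - Finsupp.single P 1 + hv.div s0 := by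
    refine eq_of_degree_eq ?_ (by rw [hdeg, degree_single])
    classical
    intro z
    rw [Finsupp.single_apply]
    split_ifs with hz
    · subst hz; omega
    · exact h4 z
  obtain ⟨s1, h1, h1P, h1P'⟩ := hv.exists_mem_sections_apply_eq hg (D := N - Finsupp.single P 1)
    (by simp [hN]) P P'
  obtain ⟨s2, h2, h2P, h2P'⟩ := hv.exists_mem_sections_apply_eq hg (D := N)
    (by simp [hN]) P P'
  refine ⟨P', ![s0, s1, s2], fun x => ?_, h1, h1P, h1P', h2, h2P, h2P'⟩
  rw [h5]
  simp [hv.exp_div h00]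

namespace IsAdapted

variable {hv : IsCurve k v} {N : S →₀ ℤ} {P P' : S} {s : Fin 3 → K}

lemma ne_zero (h : hv.IsAdapted N P P' s) : s 0 ≠ 0 := ne_zero_of_eq_exp (h.div_zero P)

lemma mem (h : hv.IsAdapted N P P' s) (i : Fin 3) : s i ∈ hv.sections N := by
  have h1 (x : S) : (0 : S →₀ ℤ) ≤ Finsupp.single x 1 := Finsupp.single_nonneg.2 zero_le_one
  fin_cases i
  · exact hv.sections_mono (((sub_le_self _ (h1 P')).trans (sub_le_self _ (h1 P))).trans
      (sub_le_self _ (h1 P))) (fun x => (h.div_zero x).le)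
  · exact hv.sections_mono (sub_le_self _ (h1 P)) h.mem_one
  · exact h.mem_two

/-- As a section of `N`, `s 0` has divisor exactly `2P + P'`, so vanishing there is the same as
divisibility by `s 0`. -/
lemma div_mem (h : hv.IsAdapted N P P' s) {D : S →₀ ℤ} {f : K} (hf : f ∈ hv.sections
    (D + N - Finsupp.single P 1 - Finsupp.single P 1 - Finsupp.single P' 1)) :
    ∃ f' ∈ hv.sections D, f = s 0 * f' := by
  refine ⟨(s 0)⁻¹ * f, fun x => ?_, by rw [mul_inv_cancel_left₀ h.ne_zero]⟩
  rw [map_mul, map_inv₀, h.div_zero, ← exp_neg]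
  refine (mul_le_mul_right (hf x) _).trans ?_
  rw [← exp_add, exp_le_exp]
  simp

lemma mul_mem (h : hv.IsAdapted N P P' s) {D : S →₀ ℤ} {f : K} (hf : f ∈ hv.sections D) :
    s 0 * f ∈ hv.sections
      (D + N - Finsupp.single P 1 - Finsupp.single P 1 - Finsupp.single P' 1) := fun x => by
  rw [map_mul, h.div_zero]
  refine (mul_le_mul_right (hf x) _).trans ?_
  rw [← exp_add, exp_le_exp]
  simp only [Finsupp.sub_apply, Finsupp.add_apply]
  linarith

lemma two_pow (h : hv.IsAdapted N P P' s) (n : ℕ) : s 2 ^ n ∈ hv.sections (n • N) ∧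
    v P (s 2 ^ n) = exp ((n • N) P) ∧ v P' (s 2 ^ n) = exp ((n • N) P') := by
  refine ⟨hv.pow_mem_sections h.mem_two n, ?_, ?_⟩
  · rw [map_pow, h.two_left, Finsupp.smul_apply, exp_nsmul]
  · rw [map_pow, h.two_right, Finsupp.smul_apply, exp_nsmul]

lemma one_mul_two_pow (h : hv.IsAdapted N P P' s) (n : ℕ) :
    s 1 * s 2 ^ n ∈ hv.sections ((n + 1) • N - Finsupp.single P 1) ∧
    v P (s 1 * s 2 ^ n) = exp (((n + 1) • N - Finsupp.single P 1 : S →₀ ℤ) P) ∧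
    v P' (s 1 * s 2 ^ n) = exp (((n + 1) • N - Finsupp.single P 1 : S →₀ ℤ) P') := by
  have h1 : (n + 1) • N - Finsupp.single P 1 = (N - Finsupp.single P 1) + n • N := by
    rw [succ_nsmul]; abel
  rw [h1]
  refine ⟨hv.mul_mem_sections h.mem_one (h.two_pow n).1, ?_, ?_⟩
  · rw [map_mul, h.one_left, (h.two_pow n).2.1, Finsupp.add_apply, exp_add]
  · rw [map_mul, h.one_right, (h.two_pow n).2.2, Finsupp.add_apply, exp_add]

lemma one_sq_mul_two_pow (h : hv.IsAdapted N P P' s) (n : ℕ) :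
    s 1 ^ 2 * s 2 ^ n ∈ hv.sections ((n + 2) • N - Finsupp.single P 1 - Finsupp.single P 1) ∧
    v P (s 1 ^ 2 * s 2 ^ n) =
      exp (((n + 2) • N - Finsupp.single P 1 - Finsupp.single P 1 : S →₀ ℤ) P) ∧
    v P' (s 1 ^ 2 * s 2 ^ n) =
      exp (((n + 2) • N - Finsupp.single P 1 - Finsupp.single P 1 : S →₀ ℤ) P') := by
  have h1 : (n + 2) • N - Finsupp.single P 1 - Finsupp.single P 1 =
      (N - Finsupp.single P 1) + ((n + 1) • N - Finsupp.single P 1) := by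
    rw [succ_nsmul]; abel
  have h2 : s 1 ^ 2 * s 2 ^ n = s 1 * (s 1 * s 2 ^ n) := by ring
  rw [h1, h2]
  refine ⟨hv.mul_mem_sections h.mem_one (h.one_mul_two_pow n).1, ?_, ?_⟩
  · rw [map_mul, h.one_left, (h.one_mul_two_pow n).2.1, Finsupp.add_apply, exp_add]
  · rw [map_mul, h.one_right, (h.one_mul_two_pow n).2.2, Finsupp.add_apply, exp_add]

/-- The three monomials generate the successive quotients of the filtration by vanishing at `P`, at
`2P` and at `2P + P'`. Subtracting multiples of them leaves a section divisible by `s 0`. -/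
lemma exists_eq (h : hv.IsAdapted N P P' s) (n : ℕ) {f : K} (hf : f ∈ hv.sections ((n + 2) • N)) :
    ∃ (a b c : k) (f' : K), f' ∈ hv.sections ((n + 1) • N) ∧
      f = s 0 * f' + a • s 2 ^ (n + 2) + b • (s 1 * s 2 ^ (n + 1)) + c • (s 1 ^ 2 * s 2 ^ n) := by
  obtain ⟨a1, a2, -⟩ := h.two_pow (n + 2)
  obtain ⟨b1, b2, -⟩ := h.one_mul_two_pow (n + 1)
  obtain ⟨c1, -, c2⟩ := h.one_sq_mul_two_pow n
  obtain ⟨a, ha⟩ := hv.exists_sub_smul_mem a1 a2 hf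
  obtain ⟨b, hb⟩ := hv.exists_sub_smul_mem b1 b2 ha
  obtain ⟨c, hc⟩ := hv.exists_sub_smul_mem c1 c2 hb
  rw [succ_nsmul N (n + 1)] at hc
  obtain ⟨f', hf', e⟩ := h.div_mem hc
  exact ⟨a, b, c, f', hf', by rw [← e]; abel⟩

/-- Uniqueness of the previous expansion: in each step of the filtration only one term survives, so
its coefficient vanishes. -/
lemma eq_zero (h : hv.IsAdapted N P P' s) (n : ℕ) {a b c : k} {f' : K}
    (hf' : f' ∈ hv.sections ((n + 1) • N))
    (e : s 0 * f' + a • s 2 ^ (n + 2) + b • (s 1 * s 2 ^ (n + 1)) + c • (s 1 ^ 2 * s 2 ^ n) = 0) :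
    a = 0 ∧ b = 0 ∧ c = 0 ∧ f' = 0 := by
  obtain ⟨a1, a2, -⟩ := h.two_pow (n + 2)
  obtain ⟨b1, b2, -⟩ := h.one_mul_two_pow (n + 1)
  obtain ⟨c1, -, c2⟩ := h.one_sq_mul_two_pow n
  have h1 (x : S) : (0 : S →₀ ℤ) ≤ Finsupp.single x 1 := Finsupp.single_nonneg.2 zero_le_one
  have h0 := h.mul_mem hf'
  rw [← succ_nsmul N (n + 1)] at h0
  have ha : a = 0 := by
    refine hv.eq_zero_of_smul_mem a2 ?_
    have := neg_mem (add_mem (add_mem (hv.sections_mono ((sub_le_self _ (h1 P')).trans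
      (sub_le_self _ (h1 P))) h0) (Submodule.smul_mem _ b b1))
      (Submodule.smul_mem _ c (hv.sections_mono (sub_le_self _ (h1 P)) c1)))
    convert this using 1
    rw [eq_neg_iff_add_eq_zero, ← e]; abel
  subst ha
  have hb : b = 0 := by
    refine hv.eq_zero_of_smul_mem b2 ?_
    have := neg_mem (add_mem (hv.sections_mono (sub_le_self _ (h1 P')) h0)
      (Submodule.smul_mem _ c c1))
    convert this using 1
    rw [eq_neg_iff_add_eq_zero, ← e, zero_smul]; abel
  subst hb
  have hc : c = 0 := by
    refine hv.eq_zero_of_smul_mem c2 ?_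
    convert neg_mem h0 using 1
    rw [eq_neg_iff_add_eq_zero, ← e, zero_smul, zero_smul]; abel
  subst hc
  refine ⟨rfl, rfl, rfl, ?_⟩
  simpa [h.ne_zero] using e

lemma exists_eq_linear (h : hv.IsAdapted N P P' s) (hg : IsGenusOne k v) {f : K}
    (hf : f ∈ hv.sections N) : ∃ a b c : k, f = a • s 2 + b • s 1 + c • s 0 := by
  obtain ⟨a, ha⟩ := hv.exists_sub_smul_mem h.mem_two h.two_left hf
  obtain ⟨b, hb⟩ := hv.exists_sub_smul_mem h.mem_one h.one_left ha
  have h2 : N - Finsupp.single P 1 - Finsupp.single P 1 = Finsupp.single P' 1 + N -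
      Finsupp.single P 1 - Finsupp.single P 1 - Finsupp.single P' 1 := by abel
  -- The quotient by `s 0` is a section of the single point `P'`, hence a constant; here the genus
  -- enters.
  rw [h2] at hb
  obtain ⟨f', hf', e⟩ := h.div_mem hb
  rw [hv.sections_single hg, hv.sections_zero, Submodule.mem_span_singleton] at hf'
  obtain ⟨c, rfl⟩ := hf'
  refine ⟨a, b, c, ?_⟩
  rw [mul_smul_comm, mul_one] at e
  rw [← e]; abel

lemma linear_eq_zero (h : hv.IsAdapted N P P' s) {a b c : k}
    (e : a • s 2 + b • s 1 + c • s 0 = 0) : a = 0 ∧ b = 0 ∧ c = 0 := by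
  -- A linear relation times `s 2` is a relation of degree two, for which uniqueness is known.
  have := h.eq_zero 0 (a := a) (b := b) (c := 0) (f' := c • s 2)
    (by simpa using Submodule.smul_mem _ c h.mem_two) ?_
  · refine ⟨this.1, this.2.1, ?_⟩
    have h3 := this.2.2.2
    rw [smul_eq_zero] at h3
    exact h3.resolve_right (ne_zero_of_eq_exp h.two_left)
  · simp only [Algebra.smul_def, map_zero] at e ⊢
    linear_combination s 2 * e

/-- Projective normality: the section ring of `N` is generated in degree one, by induction through
division by `s 0`. -/
lemma exists_form (h : hv.IsAdapted N P P' s) (hg : IsGenusOne k v) (n : ℕ) {f : K}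
    (hf : f ∈ hv.sections (n • N)) :
    ∃ F : MvPolynomial (Fin 3) k, F.IsHomogeneous n ∧ aeval s F = f := by
  have hX (i : Fin 3) (n : ℕ) : (X i ^ n : MvPolynomial (Fin 3) k).IsHomogeneous n :=
    isHomogeneous_X_pow i n
  have hsm (n : ℕ) (c : k) {F : MvPolynomial (Fin 3) k} (hF : F.IsHomogeneous n) :
    (c • F).IsHomogeneous n := Submodule.smul_mem (homogeneousSubmodule (Fin 3) k n) c hF
  induction n generalizing f with
  | zero =>
    rw [zero_smul, hv.sections_zero, Submodule.mem_span_singleton] at hf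
    obtain ⟨c, rfl⟩ := hf
    exact ⟨C c, isHomogeneous_C _ _, by rw [aeval_C, Algebra.smul_def, mul_one]⟩
  | succ n ih =>
    cases n with
    | zero =>
      rw [zero_add, one_smul] at hf
      obtain ⟨a, b, c, rfl⟩ := h.exists_eq_linear hg hf
      exact ⟨a • X 2 + b • X 1 + c • X 0, ((hsm 1 a (isHomogeneous_X _ _)).add
        (hsm 1 b (isHomogeneous_X _ _))).add (hsm 1 c (isHomogeneous_X _ _)), by simp⟩
    | succ n =>
      obtain ⟨a, b, c, f', hf', rfl⟩ := h.exists_eq n hf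
      obtain ⟨F, hF, rfl⟩ := ih hf'
      refine ⟨X 0 * F + a • X 2 ^ (n + 2) + b • (X 1 * X 2 ^ (n + 1)) + c • (X 1 ^ 2 * X 2 ^ n),
        ((IsHomogeneous.add ?_ (hsm _ a (hX _ _))).add (hsm _ b ?_)).add (hsm _ c ?_), by simp⟩
      · convert (isHomogeneous_X k (0 : Fin 3)).mul hF using 1; omega
      · convert (isHomogeneous_X k (1 : Fin 3)).mul (hX 2 (n + 1)) using 1; omega
      · convert (hX 1 2).mul (hX 2 n) using 1; omega

lemma linearForm_eq_zero (h : hv.IsAdapted N P P' s) {F : MvPolynomial (Fin 3) k}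
    (hF : F.IsHomogeneous 1) (h0 : aeval s F = 0) : F = 0 := by
  have : F ∈ homogeneousSubmodule (Fin 3) k 1 := hF
  rw [homogeneousSubmodule_one_eq_span_X, Submodule.mem_span_range_iff_exists_fun] at this
  obtain ⟨c, rfl⟩ := this
  simp only [Fin.sum_univ_three, map_add, _root_.map_smul, aeval_X] at h0
  obtain ⟨h1, h2, h3⟩ := h.linear_eq_zero (a := c 2) (b := c 1) (c := c 0) (by rw [← h0]; abel)
  simp [Fin.sum_univ_three, h1, h2, h3]

end IsAdapted

end IsCurve

end PlaneCubic

/-! ### The equation of the plane cubic, its smoothness, and local functions as quotients of forms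
-/

section PlaneCubic

open WithZero MvPolynomial

variable {k K S : Type*} [Field k] [Field K] [Algebra k K]

namespace IsCurve

variable {v : S → Valuation K ℤᵐ⁰} {hv : IsCurve k v} {N : S →₀ ℤ} {P P' : S} {s : Fin 3 → K}

/-- The cubic form attached to an adapted basis. -/
def cubic (c : k) (Q : MvPolynomial (Fin 3) k) : MvPolynomial (Fin 3) k :=
  X 1 ^ 3 - c • (X 1 ^ 2 * X 2) - X 0 * Q

lemma smul_isHomogeneous {σ R : Type*} [CommSemiring R] {n : ℕ} (c : R) {F : MvPolynomial σ R}
    (hF : F.IsHomogeneous n) : (c • F).IsHomogeneous n :=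
  Submodule.smul_mem (homogeneousSubmodule σ R n) c hF

lemma cubic_isHomogeneous (c : k) {Q : MvPolynomial (Fin 3) k} (hQ : Q.IsHomogeneous 2) :
    (cubic c Q).IsHomogeneous 3 :=
  ((isHomogeneous_X_pow 1 3).sub (smul_isHomogeneous c
    ((isHomogeneous_X_pow 1 2).mul (isHomogeneous_X k 2)))).sub ((isHomogeneous_X k 0).mul hQ)

/-- The forms of degree `n + 2` in normal form modulo a cubic. -/
def normalForms (g : MvPolynomial (Fin 3) k) (n : ℕ) : Submodule k (MvPolynomial (Fin 3) k) :=
  (Ideal.span {g}).restrictScalars k ⊔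
    ((homogeneousSubmodule (Fin 3) k (n + 1)).map (LinearMap.mulLeft k (X 0)) ⊔
      Submodule.span k {X 2 ^ (n + 2), X 1 * X 2 ^ (n + 1), X 1 ^ 2 * X 2 ^ n})

lemma mul_mem_normalForms (c : k) (Q : MvPolynomial (Fin 3) k) (n : ℕ)
    (F : MvPolynomial (Fin 3) k) : cubic c Q * F ∈ normalForms (cubic c Q) n :=
  Submodule.mem_sup_left (Ideal.mul_mem_right _ _ (Ideal.mem_span_singleton_self _))

lemma X_mul_mem_normalForms (g : MvPolynomial (Fin 3) k) {n : ℕ}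
    {F : MvPolynomial (Fin 3) k} (hF : F.IsHomogeneous (n + 1)) : X 0 * F ∈ normalForms g n :=
  Submodule.mem_sup_right (Submodule.mem_sup_left ⟨F, hF, rfl⟩)

lemma mem_normalForms_of_mem (g : MvPolynomial (Fin 3) k) {n : ℕ}
    {F : MvPolynomial (Fin 3) k}
    (hF : F ∈ ({X 2 ^ (n + 2), X 1 * X 2 ^ (n + 1), X 1 ^ 2 * X 2 ^ n} : Set _)) :
    F ∈ normalForms g n :=
  Submodule.mem_sup_right (Submodule.mem_sup_right (Submodule.subset_span hF))

lemma X_pow_mul_X_pow_mem_normalForms (c : k) {Q : MvPolynomial (Fin 3) k} (hQ : Q.IsHomogeneous 2)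
    (n i j : ℕ) (h : i + j = n + 2) : X 1 ^ i * X 2 ^ j ∈ normalForms (cubic c Q) n := by
  induction i generalizing j with
  | zero => exact mem_normalForms_of_mem _ (by rw [← h]; simp)
  | succ i ih =>
    rcases i with _ | _ | i
    · obtain rfl : j = n + 1 := by omega
      exact mem_normalForms_of_mem _ (by simp)
    · obtain rfl : j = n := by omega
      exact mem_normalForms_of_mem _ (by simp)
    -- The cubic trades `X 1 ^ 3` for `c X 1 ^ 2 X 2` and a multiple of `X 0`, which lowers the
    -- exponent of `X 1`.
    · have h1 := ih (j + 1) (by omega)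
      have h2 : (X 1 ^ i * X 2 ^ j * Q : MvPolynomial (Fin 3) k).IsHomogeneous (n + 1) := by
        convert ((isHomogeneous_X_pow (R := k) (1 : Fin 3) i).mul
          (isHomogeneous_X_pow (R := k) (2 : Fin 3) j)).mul hQ using 1
        omega
      convert add_mem (add_mem (mul_mem_normalForms c Q n (X 1 ^ i * X 2 ^ j))
        (Submodule.smul_mem _ c h1)) (X_mul_mem_normalForms (cubic c Q) h2) using 1
      simp only [cubic, smul_eq_C_mul]
      ring

lemma mem_normalForms (c : k) {Q : MvPolynomial (Fin 3) k} (hQ : Q.IsHomogeneous 2)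
    (n : ℕ) {F : MvPolynomial (Fin 3) k} (hF : F.IsHomogeneous (n + 2)) :
    F ∈ normalForms (cubic c Q) n := by
  rw [F.as_sum]
  refine Submodule.sum_mem _ fun d hd => ?_
  have hdeg := hF.degree_eq_sum_deg_support hd
  rw [Finset.sum_subset (Finset.subset_univ _) (fun i _ hi => by simpa using hi),
    Fin.sum_univ_three] at hdeg
  have hm : monomial d (coeff d F) = coeff d F • (X 0 ^ d 0 * X 1 ^ d 1 * X 2 ^ d 2) := by
    rw [monomial_eq, smul_eq_C_mul, Finsupp.prod_fintype _ _ (by simp), Fin.prod_univ_three]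
  rw [hm]
  refine Submodule.smul_mem _ _ ?_
  rcases Nat.eq_zero_or_pos (d 0) with h0 | h0
  · rw [h0, pow_zero, one_mul]
    exact X_pow_mul_X_pow_mem_normalForms c hQ n _ _ (by omega)
  · obtain ⟨m, hm⟩ := Nat.exists_eq_add_of_lt h0
    rw [zero_add] at hm
    rw [hm, pow_succ', mul_assoc, mul_assoc]
    refine X_mul_mem_normalForms _ ?_
    convert (isHomogeneous_X_pow (R := k) (0 : Fin 3) m).mul
      ((isHomogeneous_X_pow (R := k) (1 : Fin 3) (d 1)).mul
          (isHomogeneous_X_pow (R := k) (2 : Fin 3) (d 2))) using 1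
    omega

/-- The equation of the plane cubic in an adapted basis. -/
structure IsEquation (k : Type*) {K : Type*} [Field k] [Field K] [Algebra k K]
    (s : Fin 3 → K) (g : MvPolynomial (Fin 3) k) : Prop where
  isHomogeneous : g.IsHomogeneous 3
  aeval_eq_zero : aeval s g = 0
  dvd : ∀ (n : ℕ) (F : MvPolynomial (Fin 3) k), F.IsHomogeneous n → aeval s F = 0 → g ∣ F

namespace IsAdapted

/-- `s 1 ^ 3` vanishes at least twice at `P`. Subtracting a multiple of `s 1 ^ 2 * s 2` makes it
vanish on `2P + P'`, and the quotient by `s 0` is then a quadratic form in the sections. -/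
lemma exists_cubic (h : hv.IsAdapted N P P' s) (hg : IsGenusOne k v) :
    ∃ (c : k) (Q : MvPolynomial (Fin 3) k), Q.IsHomogeneous 2 ∧ aeval s (cubic c Q) = 0 := by
  have h3 := hv.mul_mem_sections h.mem_one (hv.pow_mem_sections h.mem_one 2)
  have h1 (x : S) : (0 : S →₀ ℤ) ≤ Finsupp.single x 1 := Finsupp.single_nonneg.2 zero_le_one
  have h4 : s 1 ^ 3 ∈ hv.sections (3 • N - Finsupp.single P 1 - Finsupp.single P 1) := by
    have e : s 1 ^ 3 = s 1 * s 1 ^ 2 := by ring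
    rw [e]
    refine hv.sections_mono ?_ h3
    have : N - Finsupp.single P 1 + 2 • (N - Finsupp.single P 1) =
      3 • N - Finsupp.single P 1 - Finsupp.single P 1 - Finsupp.single P 1 := by
      rw [succ_nsmul N 2, two_nsmul, two_nsmul]; abel
    rw [this]
    exact sub_le_self _ (h1 P)
  obtain ⟨c1, -, c2⟩ := h.one_sq_mul_two_pow 1
  obtain ⟨c, hc⟩ := hv.exists_sub_smul_mem c1 c2 h4
  rw [show 1 + 2 = 2 + 1 from rfl, succ_nsmul] at hc
  obtain ⟨f', hf', e⟩ := h.div_mem hc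
  obtain ⟨Q, hQ, rfl⟩ := h.exists_form hg 2 hf'
  refine ⟨c, Q, hQ, ?_⟩
  rw [pow_one] at e
  simp [cubic, ← e]

/-- Modulo the cubic a relation is in normal form. Uniqueness of the expansion kills the three
monomials, and the factor of `X 0` is a relation of smaller degree. -/
lemma isEquation (h : hv.IsAdapted N P P' s) {c : k} {Q : MvPolynomial (Fin 3) k}
    (hQ : Q.IsHomogeneous 2) (h0 : aeval s (cubic c Q) = 0) : IsEquation k s (cubic c Q) := by
  refine ⟨cubic_isHomogeneous c hQ, h0, fun n F hF hF0 => ?_⟩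
  induction n generalizing F with
  | zero =>
    rw [← mem_homogeneousSubmodule, homogeneousSubmodule_zero] at hF
    obtain ⟨a, rfl⟩ := Submodule.mem_one.1 hF
    have : a = 0 := by simpa [algebraMap_eq] using hF0
    simp [this]
  | succ n ih =>
    cases n with
    | zero => rw [h.linearForm_eq_zero hF hF0]; exact dvd_zero _
    | succ n =>
      have := mem_normalForms c hQ n hF
      obtain ⟨F1, hF1, F2, hF2, rfl⟩ := Submodule.mem_sup.1 this
      obtain ⟨-, ⟨F3, hF3, rfl⟩, F4, hF4, rfl⟩ := Submodule.mem_sup.1 hF2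
      obtain ⟨a, b, d, rfl⟩ := Submodule.mem_span_triple.1 hF4
      obtain ⟨G, rfl⟩ := Ideal.mem_span_singleton.1 hF1
      have hs : ∀ i, s i ∈ hv.sections N := h.mem
      obtain ⟨rfl, rfl, rfl, h4⟩ := h.eq_zero n (a := a) (b := b) (c := d)
        (hv.aeval_mem_sections hs (show F3.IsHomogeneous (n + 1) from hF3)) (by
          rw [← hF0]
          simp only [map_add, map_mul, h0, LinearMap.mulLeft_apply, _root_.map_smul, aeval_X,
            map_pow, zero_mul, zero_add]
          abel)
      have := ih F3 hF3 h4
      simp only [zero_smul, add_zero, LinearMap.mulLeft_apply]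
      exact dvd_add (dvd_mul_right _ _) (this.mul_left _)

/-- This is smoothness of the cubic at `P = [0, 0, 1]`. If `Q` vanished there, orders at `P` would
force `c = 0`, and then `s 1 ^ 3 = s 0 * Q` would have too high an order of vanishing at `P'`. -/
lemma eval_ne_zero (h : hv.IsAdapted N P P' s) {c : k} {Q : MvPolynomial (Fin 3) k}
    (hQ : Q.IsHomogeneous 2) (h0 : aeval s (cubic c Q) = 0) :
    MvPolynomial.eval ![0, 0, 1] Q ≠ 0 := by
  intro hQ0
  have h1 (x : S) : (0 : S →₀ ℤ) ≤ Finsupp.single x 1 := Finsupp.single_nonneg.2 zero_le_one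
  have hval : hv.IsValue N s P (s 2) ![0, 0, 1] := by
    refine ⟨h.two_left, fun i => ?_⟩
    fin_cases i
    · simp only [Fin.zero_eta, Fin.isValue, Matrix.cons_val_zero, map_zero, mul_zero, sub_zero]
      rw [h.div_zero, exp_le_exp]
      have := h1 P' P
      simp at this ⊢
      omega
    · simp only [Fin.mk_one, Fin.isValue, Matrix.cons_val_one, Matrix.cons_val_zero, map_zero,
        mul_zero, sub_zero]
      rw [h.one_left, exp_le_exp]
      simp
    · simp
  have hs : ∀ i, s i ∈ hv.sections N := h.mem
  have hQ1 : aeval s Q ∈ hv.sections (2 • N - Finsupp.single P 1) := by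
    refine hv.mem_sections_of_add_single (x := P) (n := 1) ?_ ?_
    · rw [sub_add_cancel]; exact hv.aeval_mem_sections hs hQ
    · simpa using (hval.eval_eq_zero_iff hQ).1 hQ0
  have hQ2 := h.mul_mem hQ1
  have e : s 1 ^ 3 = c • (s 1 ^ 2 * s 2) + s 0 * aeval s Q := by
    simp only [cubic, map_sub, map_mul, map_pow, aeval_X, _root_.map_smul] at h0
    rw [← sub_eq_zero, ← h0]; ring
  have h3 := hv.pow_mem_sections h.mem_one 3
  have hc : c = 0 := by
    refine hv.const_eq_zero (x := P) (t := s 1 ^ 2 * s 2) (n := (3 • N) P - 2) ?_ ?_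
    · rw [← pow_one (s 2), (h.one_sq_mul_two_pow 1).2.1, exp_inj]
      simp only [Finsupp.sub_apply, Finsupp.single_eq_same]
      ring
    · rw [mul_comm, ← Algebra.smul_def, eq_sub_of_add_eq e.symm]
      refine (v P).map_sub_le ((h3 P).trans (exp_le_exp.2 ?_)) ((hQ2 P).trans (exp_le_exp.2 ?_))
      · simp; omega
      · have := h1 P' P
        simp at this ⊢
        omega
  rw [hc, zero_smul, zero_add] at e
  have h4 := hQ2 P'
  rw [← e, map_pow, h.one_right, ← exp_nsmul, exp_le_exp] at h4
  simp at h4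
  omega

end IsAdapted

lemma exists_equation (hv : IsCurve k v) (hg : IsGenusOne k v) (hN : degree N = 3) :
    ∃ (P P' : S) (s : Fin 3 → K) (g : MvPolynomial (Fin 3) k), hv.IsAdapted N P P' s ∧
      IsEquation k s g := by
  obtain ⟨P⟩ := exists_point hg
  obtain ⟨P', s, h⟩ := hv.exists_isAdapted hg hN P
  obtain ⟨c, Q, hQ, h0⟩ := h.exists_cubic hg
  exact ⟨P, P', s, _, h, h.isEquation hQ h0⟩

/-- The plane cubic is smooth at the points coming from the curve. -/
lemma IsAdapted.exists_pderiv_ne_zero (h : hv.IsAdapted N P P' s) (hg : IsGenusOne k v)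
    (hN : degree N = 3) {g : MvPolynomial (Fin 3) k} (he : IsEquation k s g) {x : S} {t : K}
    {w : Fin 3 → k} (hw : hv.IsValue N s x t w) :
    ∃ i, MvPolynomial.eval w (pderiv i g) ≠ 0 := by
  by_contra! hcon
  -- Smoothness at `x` is visible in a basis `r` adapted to `x`. The forms `A` and `B` are the
  -- linear change of coordinates between `s` and `r`.
  obtain ⟨x', r, hr⟩ := hv.exists_isAdapted hg hN x
  obtain ⟨c, Q, hQ, h0⟩ := hr.exists_cubic hg
  have hQ0 := hr.eval_ne_zero hQ h0
  have hB (i : Fin 3) := h.exists_form hg 1 (f := r i) (by rw [one_smul]; exact hr.mem i)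
  have hA (i : Fin 3) := hr.exists_form hg 1 (f := s i) (by rw [one_smul]; exact h.mem i)
  choose B hB hB' using hB
  choose A hA hA' using hA
  have hBA : ∀ i, aeval A (B i) = X i := by
    intro i
    rw [← sub_eq_zero]
    refine hr.linearForm_eq_zero (((hB i).aeval A hA).sub (isHomogeneous_X _ _)) ?_
    rw [map_sub, aeval_X, ← AlgHom.comp_apply, comp_aeval, funext hA', hB', sub_self]
  have hu := hw.congr hB hB'
  set u : Fin 3 → k := fun i => MvPolynomial.eval w (B i)
  have hw' := hw.unique (hu.congr hA hA')
  have hu0 : u 0 = 0 := by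
    refine hv.const_eq_zero hw.gen ?_
    have h2 : v x (r 0) ≤ exp (N x - 1) := by
      rw [hr.div_zero, exp_le_exp]
      have : (0 : S →₀ ℤ) x ≤ Finsupp.single x' 1 x := Finsupp.single_nonneg.2 zero_le_one x
      simp at this ⊢; omega
    have := (v x).map_sub_le h2 (hu.le 0)
    rwa [sub_sub_cancel] at this
  have hu1 : u 1 = 0 := by
    refine hv.const_eq_zero hw.gen ?_
    have h2 : v x (r 1) ≤ exp (N x - 1) := by
      rw [hr.one_left, exp_le_exp]; simp
    have := (v x).map_sub_le h2 (hu.le 1)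
    rwa [sub_sub_cancel] at this
  have hu2 : u 2 ≠ 0 := by
    intro h2
    have := hu.le 2
    rw [h2, map_zero, mul_zero, sub_zero, hr.two_left, exp_le_exp] at this
    omega
  have hdvd : g ∣ aeval B (cubic c Q) := by
    refine he.dvd 3 _ ((cubic_isHomogeneous c hQ).aeval B hB) ?_
    rw [← AlgHom.comp_apply, comp_aeval, funext hB', h0]
  have hgw : MvPolynomial.eval w g = 0 := hw.eval_eq_zero he.isHomogeneous he.aeval_eq_zero
  -- The image of `x` moved infinitesimally in the direction of `X 0`. If `g` were singular at `w`,
  -- it would vanish at the transported point, and so would its multiple, the cubic in the basis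
  -- `r`. But the `ε`-part there is `-(u 2)²` times the nonzero value of `Q`, up to the same
  -- scaling.
  let y : Fin 3 → DualNumber k := ![DualNumber.eps, 0, TrivSqZeroExt.inl (u 2)]
  have hyu : (fun i => (y i).fst) = u := by
    ext i
    fin_cases i
    · simp [y, hu0]
    · simp [y, hu1]
    · simp [y]
  have hzw : (fun i => (aeval y (A i)).fst) = w := by
    ext i
    rw [(aeval_dualNumber_snd (A i) y).1, hyu]
    exact (congrFun hw' i).symm
  have hz : aeval (fun i => aeval y (A i)) g = 0 := by
    have := aeval_dualNumber_snd g (fun i => aeval y (A i))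
    rw [hzw] at this
    refine TrivSqZeroExt.ext (by rw [this.1, hgw]; rfl) ?_
    rw [this.2]
    simp [hcon]
  obtain ⟨G, hG⟩ := hdvd
  have h5 : aeval y (cubic c Q) = 0 := by
    have h6 : aeval (fun i => aeval y (A i)) (aeval B (cubic c Q)) = 0 := by
      rw [hG, map_mul, hz, zero_mul]
    rw [← AlgHom.comp_apply, comp_aeval] at h6
    have h9 : (fun i => aeval (fun j => aeval y (A j)) (B i)) = y := by
      ext1 i
      have := congrArg (aeval y) (hBA i)
      rwa [← AlgHom.comp_apply, comp_aeval, aeval_X] at this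
    rwa [h9] at h6
  have h7 := congrArg TrivSqZeroExt.snd h5
  have h8 : (aeval y Q).fst = u 2 ^ 2 * MvPolynomial.eval ![0, 0, 1] Q := by
    rw [(aeval_dualNumber_snd Q y).1, hyu, ← eval_smul_of_isHomogeneous hQ]
    congr 2
    ext i
    fin_cases i <;> simp [hu0, hu1]
  simp [cubic, y] at h7
  simp only [y] at h8
  rw [h8] at h7
  simp [hu2, hQ0] at h7

/-- If a quadratic form vanishes to first order at a point of the plane cubic, then its zero locus
is transversal to the cubic. -/
lemma IsValue.exists_transversal {x : S} {t : K} {w : Fin 3 → k} (hw : hv.IsValue N s x t w)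
    {g : MvPolynomial (Fin 3) k} {m n : ℕ} (hg : g.IsHomogeneous m)
    (h0 : aeval s g = 0) {q : MvPolynomial (Fin 3) k} (hq : q.IsHomogeneous n)
    (hqx : v x (aeval s q) = exp ((n • N) x - 1)) :
    ∃ u : Fin 3 → k, ∑ i, u i * MvPolynomial.eval w (pderiv i g) = 0 ∧
      ∑ i, u i * MvPolynomial.eval w (pderiv i q) ≠ 0 := by
  have ht0 := ne_zero_of_eq_exp hw.gen
  obtain ⟨τ, hτ⟩ := hv.uniformizer x
  have hτ0 := ne_zero_of_eq_exp hτ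
  -- The tangent vector `u` is the first order coefficient of the normalised coordinates along the
  -- uniformizer `τ`. A form that vanishes on the curve has derivative 0 along `u`; one with a
  -- simple zero does not.
  have hi (i : Fin 3) : ∃ c : k, v x (t⁻¹ * s i - algebraMap k K (w i) - τ * algebraMap k K c)
      ≤ exp (-2) := by
    obtain ⟨c, hc⟩ := hv.exists_sub_lt x (f := τ) (g := t⁻¹ * s i - algebraMap k K (w i)) hτ0 (by
      have : t⁻¹ * s i - algebraMap k K (w i) = t⁻¹ * (s i - t * algebraMap k K (w i)) := by
        rw [mul_sub, inv_mul_cancel_left₀ ht0]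
      rw [this, map_mul, map_inv₀, hw.gen, ← exp_neg, hτ]
      refine (mul_le_mul_right (hw.le i) _).trans_eq ?_
      rw [← exp_add]; congr 1; ring)
    refine ⟨c, ?_⟩
    rwa [hτ, lt_exp_iff, Algebra.smul_def, mul_comm _ τ] at hc
  choose u hu using hi
  have hs : s = fun i => t * (t⁻¹ * s i) := by ext i; rw [mul_inv_cancel_left₀ ht0]
  refine ⟨u, ?_, fun hu0 => ?_⟩
  · have := hv.aeval_sub_sub_le x hτ hu g
    rw [hw.eval_eq_zero hg h0] at this
    have h1 : aeval (fun i => t⁻¹ * s i) g = 0 := by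
      rw [hs, aeval_smul_of_isHomogeneous hg] at h0
      exact (mul_eq_zero.1 h0).resolve_left (pow_ne_zero _ ht0)
    rw [h1, map_zero, sub_zero, zero_sub, Valuation.map_neg] at this
    exact hv.const_eq_zero hτ this
  · have := hv.aeval_sub_sub_le x hτ hu q
    rw [(hw.eval_eq_zero_iff hq).2 hqx.le, hu0, map_zero, mul_zero, sub_zero, sub_zero] at this
    rw [hs, aeval_smul_of_isHomogeneous hq, map_mul, hw.gen_pow] at hqx
    have h2 := mul_le_mul_right this (exp ((n • N) x))
    rw [hqx, ← exp_add, exp_le_exp] at h2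
    omega

/-- A regular function at a point is a quotient of forms of the same degree, the denominator being
nonzero at the point. -/
lemma IsAdapted.exists_quotient (h : hv.IsAdapted N P P' s) (hg : IsGenusOne k v)
    (hN : degree N = 3) {x : S} {f : K} (hf : v x f ≤ 1) {t : K} {w : Fin 3 → k}
    (hw : hv.IsValue N s x t w) :
    ∃ (n : ℕ) (A B : MvPolynomial (Fin 3) k), A.IsHomogeneous n ∧ B.IsHomogeneous n ∧
      MvPolynomial.eval w B ≠ 0 ∧ f * aeval s B = aeval s A := by
  rcases eq_or_ne f 0 with rfl | hf0
  · exact ⟨0, 0, 1, isHomogeneous_zero _ _ _, isHomogeneous_one _ _, by simp, by simp⟩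
  -- `div f ⊓ 0` is minus the divisor of poles. A section `b` of `nN` vanishing on these poles makes
  -- `f * b` a section of `nN` too, and `b` can be taken nonzero at `x` since `f` is regular there.
  obtain ⟨n, hn⟩ : ∃ n : ℕ, 1 < degree (n • N + hv.div f ⊓ 0) := by
    refine ⟨(2 - degree (hv.div f ⊓ 0)).toNat, ?_⟩
    rw [map_add, map_nsmul, hN, nsmul_eq_mul]
    have := Int.self_le_toNat (2 - degree (hv.div f ⊓ 0))
    have h2 := Int.natCast_nonneg (2 - degree (hv.div f ⊓ 0)).toNat
    omega
  obtain ⟨b, hb, hbx, -⟩ := hv.exists_mem_sections_apply_eq hg hn x x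
  have hb' : b ∈ hv.sections (n • N) :=
    hv.sections_mono (add_le_of_nonpos_right inf_le_right) hb
  have ha : f * b ∈ hv.sections (n • N) := fun y => by
    rw [map_mul, hv.exp_div hf0]
    refine (mul_le_mul_right (hb y) _).trans ?_
    rw [← exp_add, exp_le_exp]
    simp
    omega
  have hx0 : 0 ≤ hv.div f x := by
    rw [hv.exp_div hf0, ← exp_zero, exp_le_exp] at hf
    omega
  obtain ⟨A, hA, hA'⟩ := h.exists_form hg n ha
  obtain ⟨B, hB, rfl⟩ := h.exists_form hg n hb'
  refine ⟨n, A, B, hA, hB, ?_, hA'.symm⟩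
  rw [Ne, hw.eval_eq_zero_iff hB, hbx, exp_le_exp]
  simp [hx0]

end IsCurve

end PlaneCubic

/-! ### Local rings of smooth curves are discrete valuation rings -/

section SmoothCurve

open IsLocalRing in
/-- The local ring of a smooth curve at a rational point is a discrete valuation ring. -/
lemma isDiscreteValuationRing_of_standardSmooth {k A R : Type*} [Field k] [CommRing A] [Algebra k A]
    [Algebra.IsStandardSmoothOfRelativeDimension 1 k A] (q : Ideal A) [q.IsPrime]
    [CommRing R] [IsLocalRing R] [IsDomain R] [IsNoetherianRing R] [Algebra A R] [Algebra k R]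
    [IsScalarTower k A R] [IsLocalization.AtPrime R q]
    (h : Function.Bijective (algebraMap k (ResidueField R))) : IsDiscreteValuationRing R := by
  have : Nontrivial A := (algebraMap A R).domain_nontrivial
  have hA : Algebra.IsStandardSmooth k A :=
    Algebra.IsStandardSmoothOfRelativeDimension.isStandardSmooth 1
  have hrA := Algebra.IsStandardSmoothOfRelativeDimension.rank_kaehlerDifferential
    (R := k) (S := A) 1
  have hAR : Algebra.FormallyEtale A R := Algebra.FormallyEtale.of_isLocalization q.primeCompl
  have : Algebra.FormallySmooth k R := Algebra.FormallySmooth.comp k A R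
  let e := KaehlerDifferential.tensorKaehlerEquivOfFormallyEtale k A R
  have : Module.Free R Ω[R⁄k] := Module.Free.of_equiv e
  have hrR : Module.finrank R Ω[R⁄k] = 1 := by
    rw [← e.finrank_eq, Module.finrank_baseChange, Module.finrank, hrA]; simp
  have : Algebra.FormallyEtale k (ResidueField R) := Algebra.FormallyEtale.of_equiv
    (AlgEquiv.ofBijective (Algebra.ofId k _) h)
  -- As `R` is formally smooth over `k` and its residue field is `k`, the cotangent space embeds
  -- into the fibre of `Ω[R⁄k]`, which has dimension one.
  have hinj : ∃ φ : (RingHom.ker (algebraMap R (ResidueField R))).Cotangent →ₗ[R]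
      TensorProduct R (ResidueField R) Ω[R⁄k], Function.Injective φ :=
    ⟨_, (Algebra.FormallySmooth.kerCotangentToTensor_injective_iff (R := k) (P := R)
      (A := ResidueField R) Ideal.Quotient.mk_surjective).2 inferInstance⟩
  rw [show RingHom.ker (algebraMap R (ResidueField R)) = maximalIdeal R from ker_residue] at hinj
  obtain ⟨φ, hφ⟩ := hinj
  have hle : Module.finrank (ResidueField R) (CotangentSpace R) ≤ 1 := by
    have : Module.Finite R Ω[R⁄k] := Module.finite_of_finrank_eq_succ hrR
    have := LinearMap.finrank_le_finrank_of_injective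
      (f := φ.extendScalarsOfSurjective (S := ResidueField R) residue_surjective) hφ
    rwa [Module.finrank_baseChange, hrR] at this
  -- A field with residue field `k` would be `k` itself, without differentials.
  have hR : ¬ IsField R := fun hR => by
    let := hR.toField
    have hb : Function.Bijective (algebraMap R (ResidueField R)) :=
      ⟨RingHom.injective _, residue_surjective⟩
    have hs : Function.Surjective (algebraMap k R) := fun r => by
      obtain ⟨c, hc⟩ := h.2 (algebraMap R _ r)
      exact ⟨c, hb.1 (by rw [← hc, ← IsScalarTower.algebraMap_apply])⟩
    have := KaehlerDifferential.subsingleton_of_surjective k R hs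
    simp [Module.finrank_zero_of_subsingleton] at hrR
  exact ((IsDiscreteValuationRing.TFAE R hR).out 0 4).2 (finrank_cotangentSpace_le_one_iff.1 hle)

end SmoothCurve

/-! ### Closed points of curves over `ℂ` and their valuations -/

section Points

variable {C : Scheme.{0}} (p : C ⟶ Spec (.of ℂ))

/-- The stalks of a scheme over `ℂ` as `ℂ`-algebras. -/
abbrev stalkAlgebra (x : C) : Algebra ℂ (C.presheaf.stalk x) :=
  ((C.presheaf.germ ⊤ x trivial).hom.comp (constantFunction p)).toAlgebra

lemma comp_eq_SpecMap {R : CommRingCat.{0}} (g : Spec R ⟶ C) :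
    g ≫ p = Spec.map (CommRingCat.ofHom (constantFunction p) ≫ g.appTop ≫ (Scheme.ΓSpecIso R).hom) := by
  have h : p.appTop = (Scheme.ΓSpecIso (.of ℂ)).hom ≫ CommRingCat.ofHom (constantFunction p) := by
    rw [← Iso.inv_comp_eq]; rfl
  rw [← cancel_mono (Scheme.toSpecΓ _), Category.assoc, Scheme.toSpecΓ_naturality,
    Scheme.toSpecΓ_naturality_assoc, h]
  simp [Scheme.toSpecΓ_naturality]
  rfl

lemma fromSpecStalk_comp (x : C) : C.fromSpecStalk x ≫ p =
    Spec.map (CommRingCat.ofHom (constantFunction p) ≫ C.presheaf.germ ⊤ x trivial) := by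
  rw [comp_eq_SpecMap, Scheme.fromSpecStalk_appTop]
  simp

/-- The residue field at a closed point of a curve over `ℂ` is `ℂ`. -/
lemma bijective_algebraMap_residueField [LocallyOfFiniteType p] {x : C} (hx : IsClosed {x}) :
    Function.Bijective ((IsLocalRing.residue (C.presheaf.stalk x)).comp
      ((C.presheaf.germ ⊤ x trivial).hom.comp (constantFunction p))) := by
  have h := SpecMap_residueFieldIsoBase_inv p x hx
  rw [Scheme.fromSpecResidueField, Category.assoc, fromSpecStalk_comp, ← Spec.map_comp,
    Spec.map_inj] at h
  have := ConcreteCategory.bijective_of_isIso (residueFieldIsoBase p x hx).inv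
  rw [h] at this
  exact this

lemma isDiscreteValuationRing_stalk [IsIntegral C] [SmoothOfRelativeDimension 1 p] {x : C}
    (hx : IsClosed {x}) : IsDiscreteValuationRing (C.presheaf.stalk x) := by
  have : Smooth p := SmoothOfRelativeDimension.smooth 1 p
  have : LocallyOfFiniteType p := inferInstance
  have : IsLocallyNoetherian C := LocallyOfFiniteType.isLocallyNoetherian p
  obtain ⟨U, hU, V, hV, hxV, hVU, h⟩ :=
    SmoothOfRelativeDimension.exists_isStandardSmoothOfRelativeDimension (n := 1) (f := p) x
  -- `Spec ℂ` is a single point.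
  obtain rfl : U = ⊤ := by
    ext y
    have : y = p x := Subsingleton.elim _ _
    simpa [this] using hVU hxV
  let φ : ℂ →+* Γ(C, V) := (C.presheaf.map (homOfLE le_top).op).hom.comp (constantFunction p)
  have hφ : φ.IsStandardSmoothOfRelativeDimension 1 := by
    have := RingHom.isStandardSmoothOfRelativeDimension_respectsIso.2 _
      (Scheme.ΓSpecIso (.of ℂ)).symm.commRingCatIsoToRingEquiv h
    convert! this
  let := φ.toAlgebra
  have : Algebra.IsStandardSmoothOfRelativeDimension 1 ℂ Γ(C, V) := hφ
  let := stalkAlgebra p x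
  let : Algebra Γ(C, V) (C.presheaf.stalk x) := (C.presheaf.germ V x hxV).hom.toAlgebra
  have : IsScalarTower ℂ Γ(C, V) (C.presheaf.stalk x) := .of_algebraMap_eq fun c =>
    congr($(C.presheaf.germ_res (homOfLE le_top) x hxV) (constantFunction p c)).symm
  have := hV.isLocalization_stalk ⟨x, hxV⟩
  exact isDiscreteValuationRing_of_standardSmooth (k := ℂ) (hV.primeIdealOf ⟨x, hxV⟩).asIdeal
    (bijective_algebraMap_residueField p hx)

/-- The valuation of the function field of a smooth curve given by a closed point. -/
def valuationAt [IsIntegral C] [SmoothOfRelativeDimension 1 p] (x : closedPoints C) :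
    Valuation C.functionField (WithZero (Multiplicative ℤ)) :=
  haveI := isDiscreteValuationRing_stalk p x.2
  (IsDiscreteValuationRing.maximalIdeal (C.presheaf.stalk x.1)).valuation C.functionField

variable [IsIntegral C] [SmoothOfRelativeDimension 1 p] (x : closedPoints C)

lemma valuationAt_le_one_iff {f : C.functionField} :
    valuationAt p x f ≤ 1 ↔ ∃ a, algebraMap (C.presheaf.stalk x.1) C.functionField a = f := by
  have := isDiscreteValuationRing_stalk p x.2
  constructor
  · exact fun h => IsDiscreteValuationRing.exists_lift_of_le_one h
  · rintro ⟨a, rfl⟩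
    exact IsDedekindDomain.HeightOneSpectrum.valuation_le_one _ a

lemma valuationAt_lt_one_iff {a : C.presheaf.stalk x.1} :
    valuationAt p x (algebraMap _ _ a) < 1 ↔ a ∈ IsLocalRing.maximalIdeal (C.presheaf.stalk x.1) := by
  have := isDiscreteValuationRing_stalk p x.2
  exact (IsDedekindDomain.HeightOneSpectrum.valuation_lt_one_iff_mem _ a)

lemma exists_valuationAt_eq_exp : ∃ t, valuationAt p x t = WithZero.exp (-1) := by
  have := isDiscreteValuationRing_stalk p x.2
  exact IsDedekindDomain.HeightOneSpectrum.valuation_exists_uniformizer _ _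

end Points

/-! ### A smooth proper curve satisfies the valuation-theoretic axioms -/

section Curve

variable {C : Scheme.{0}} [IsIntegral C]

lemma genericPoint_specializes (x : C) : genericPoint C ⤳ x :=
  (genericPoint_spec C).specializes trivial

/-- A point specializing to `x`, the spectrum of whose local ring has two points. -/
lemma eq_genericPoint_or_eq {x y : C} [IsDiscreteValuationRing (C.presheaf.stalk x)]
    (h : y ⤳ x) : y = genericPoint C ∨ y = x := by
  have hr := Scheme.range_fromSpecStalk (X := C) (x := x)
  obtain ⟨P, rfl⟩ : y ∈ Set.range (C.fromSpecStalk x) := hr ▸ h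
  by_cases hP : P.asIdeal = ⊥
  · left
    obtain ⟨Q, hQ⟩ : genericPoint C ∈ Set.range (C.fromSpecStalk x) :=
      hr ▸ genericPoint_specializes x
    refine ((genericPoint_specializes (C.fromSpecStalk x P)).antisymm ?_).eq.symm
    rw [← hQ]
    refine Specializes.map ?_ (C.fromSpecStalk x).continuous
    refine (PrimeSpectrum.le_iff_specializes P Q).1 ?_
    exact (PrimeSpectrum.asIdeal_le_asIdeal _ _).1 (hP.le.trans bot_le)
  · right
    have : P = IsLocalRing.closedPoint (C.presheaf.stalk x) := by
      apply PrimeSpectrum.ext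
      exact (IsLocalRing.eq_maximalIdeal (P.2.isMaximal hP))
    rw [this, Scheme.fromSpecStalk_closedPoint]

variable (p : C ⟶ Spec (.of ℂ))

lemma algebraMap_functionField (x : C) (c : ℂ) :
    letI := functionFieldAlgebra p
    algebraMap ℂ C.functionField c = algebraMap (C.presheaf.stalk x) C.functionField
      (C.presheaf.germ ⊤ x trivial (constantFunction p c)) :=
  congr($(C.presheaf.germ_stalkSpecializes (U := ⊤) (y := x) trivial
          ((genericPoint_spec C).specializes trivial)) (constantFunction p c)).symm

/-- A rational function which is regular at every point comes from a global section. -/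
lemma exists_germToFunctionField_eq {f : C.functionField}
    (h : ∀ x : C, ∃ a, algebraMap (C.presheaf.stalk x) C.functionField a = f) :
    ∃ s : Γ(C, ⊤), C.presheaf.germ ⊤ (genericPoint C) trivial s = f := by
  choose a ha using h
  choose U hU s hs using fun x => C.presheaf.exists_germ_eq (a x)
  have hne (x) : Nonempty (U x) := ⟨⟨x, hU x⟩⟩
  have hsf (x) : C.germToFunctionField (U x) (s x) = f := by
    rw [← C.algebraMap_germ_eq_germToFunctionField (hU x), hs, ha]
  obtain ⟨t, ht, -⟩ := C.sheaf.existsUnique_gluing' U ⊤ (fun x => homOfLE le_top)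
    (fun x _ => Opens.mem_iSup.2 ⟨x, hU x⟩) s (fun x y => by
      have hη : genericPoint C ∈ U x ⊓ U y :=
        ⟨(genericPoint_specializes x).mem_open (U x).2 (hU x),
          (genericPoint_specializes y).mem_open (U y).2 (hU y)⟩
      apply germ_injective_of_isIntegral _ _ hη
      have e1 := C.presheaf.germ_res_apply (Opens.infLELeft (U x) (U y)) _ hη (s x)
      have e2 := C.presheaf.germ_res_apply (Opens.infLERight (U x) (U y)) _ hη (s y)
      exact (e1.trans (hsf x)).trans (e2.trans (hsf y)).symm)
  let x₀ : C := genericPoint C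
  refine ⟨t, ?_⟩
  rw [← hsf x₀, ← ht x₀]
  exact (C.presheaf.germ_res_apply (homOfLE le_top) _ _ t).symm

/-- Global functions on a proper integral scheme form a domain finite over `ℂ`, which is
algebraically closed. -/
lemma bijective_constantFunction [IsProper p] : Function.Bijective (constantFunction p) := by
  have hf := finite_appTop_of_universallyClosed ℂ p
  have hb : Function.Bijective (constantFunction p) := by
    refine IsAlgClosed.ringHom_bijective_of_isIntegral _ ?_
    refine (RingHom.IsIntegral.trans _ _ ?_ hf.to_isIntegral)
    exact RingHom.isIntegral_of_surjective _
      (Scheme.ΓSpecIso (.of ℂ)).symm.commRingCatIsoToRingEquiv.surjective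
  exact hb

variable [SmoothOfRelativeDimension 1 p]

include p in
-- The closure of any point contains a closed point, and the local ring there has only two primes.
lemma eq_genericPoint_or_isClosed [CompactSpace C] (y : C) :
    y = genericPoint C ∨ IsClosed {y} := by
  obtain ⟨x, hx, hxc⟩ := (isClosed_closure (s := {y})).exists_closed_singleton
    ⟨y, subset_closure rfl⟩
  have := isDiscreteValuationRing_stalk p hxc
  rcases eq_genericPoint_or_eq (specializes_iff_mem_closure.2 hx) with h | rfl
  · exact .inl h
  · exact .inr hxc

include p in
-- The finitely many irreducible components of `Z` have generic points different from that of `C`,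
-- so these are closed and each component is a point.
lemma finite_of_isClosed [CompactSpace C] {Z : Set C} (hZ : IsClosed Z)
    (h : genericPoint C ∉ Z) : Z.Finite := by
  have : Smooth p := SmoothOfRelativeDimension.smooth 1 p
  have : IsLocallyNoetherian C := LocallyOfFiniteType.isLocallyNoetherian p
  have : AlgebraicGeometry.IsNoetherian C := {}
  obtain ⟨S, hS, hcl, hirr, rfl⟩ := NoetherianSpace.exists_finite_set_isClosed_irreducible hZ
  refine hS.sUnion fun t ht => ?_
  obtain ⟨z, hz⟩ := QuasiSober.sober (hirr t ht) (hcl t ht)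
  have hzt : z ∈ t := hz ▸ subset_closure rfl
  have hz' : IsClosed {z} := (eq_genericPoint_or_isClosed p z).resolve_left fun h' =>
    h (h' ▸ ⟨t, ht, hzt⟩)
  rw [← hz.def, hz'.closure_eq]
  exact Set.finite_singleton z

theorem isCurve [IsProper p] :
    letI := functionFieldAlgebra p
    IsCurve ℂ (valuationAt p) := by
  let := functionFieldAlgebra p
  have : CompactSpace C := by
    have : QuasiCompact p := inferInstance
    exact (quasiCompact_iff_compactSpace p).1 this
  have hc (x : closedPoints C) (c : ℂ) :
      valuationAt p x (algebraMap ℂ C.functionField c) ≤ 1 :=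
    (valuationAt_le_one_iff p x).2 ⟨_, (algebraMap_functionField p x.1 c).symm⟩
  refine ⟨exists_valuationAt_eq_exp p, fun x f hf => ?_, fun x c hc0 => ?_, fun f => ?_,
    fun f hf => ?_⟩
  · obtain ⟨a, rfl⟩ := (valuationAt_le_one_iff p x).1 hf
    obtain ⟨c, hc⟩ := (bijective_algebraMap_residueField p x.2).2
      (IsLocalRing.residue (C.presheaf.stalk x.1) a)
    refine ⟨c, ?_⟩
    rw [algebraMap_functionField p x.1, ← map_sub, valuationAt_lt_one_iff,
      ← IsLocalRing.residue_eq_zero_iff, map_sub, ← hc, sub_eq_zero]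
    rfl
  · refine le_antisymm (hc x c) ?_
    have := hc x c⁻¹
    rw [map_inv₀, map_inv₀] at this
    exact (inv_le_one₀ (zero_lt_iff.2 ((Valuation.ne_zero_iff _).2 (by simpa)))).1 this
  · rcases eq_or_ne f 0 with rfl | hf
    · simp
    -- A rational function is regular on a nonempty open set, whose complement is finite.
    obtain ⟨U, hU, f', hne, rfl, -⟩ := exists_isUnit_germ_eq _ f hf
    have hfin : ((U : Set C)ᶜ).Finite := finite_of_isClosed p U.2.isClosed_compl fun h => by
      obtain ⟨y⟩ := hne
      exact h ((genericPoint_specializes y.1).mem_open U.2 y.2)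
    refine (hfin.preimage Subtype.val_injective.injOn).subset fun x hx hxU => ?_
    exact not_le.2 hx ((valuationAt_le_one_iff p x).2
      ⟨_, C.algebraMap_germ_eq_germToFunctionField hxU f'⟩)
  · obtain ⟨s, rfl⟩ := exists_germToFunctionField_eq (f := f) fun x => by
      rcases eq_genericPoint_or_isClosed p x with rfl | hx
      · exact ⟨f, by
          rw [RingHom.algebraMap_toAlgebra]; simp⟩
      · exact (valuationAt_le_one_iff p ⟨x, hx⟩).1 (hf ⟨x, hx⟩)
    obtain ⟨c, rfl⟩ := (bijective_constantFunction p).2 s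
    exact ⟨c, rfl⟩

/-- Only a translation: membership in a local ring is `valuationAt p x f ≤ 1`, and rank one means a
nonzero class of which all others are multiples. -/
lemma isGenusOne (hgenus : genus p = 1) :
    letI := functionFieldAlgebra p
    IsCurve.IsGenusOne ℂ (valuationAt p) := by
  let := functionFieldAlgebra p
  have hmem (x : closedPoints C) (f : C.functionField) :
      f ∈ localRing p x.1 ↔ valuationAt p x f ≤ 1 := (valuationAt_le_one_iff p x).symm
  have hrep (r : closedPoints C → C.functionField) :
      r ∈ repartitions (fun x : closedPoints C => localRing p x.1) ↔
        IsCurve.IsRepartition (valuationAt p) r := by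
    simp only [IsCurve.IsRepartition, ← not_le, ← hmem]; rfl
  have hprin (r : closedPoints C → C.functionField) :
      r ∈ regularRepartitions (fun x : closedPoints C => localRing p x.1) ⊔
        constantRepartitions ℂ C.functionField (closedPoints C) ↔
        IsCurve.IsPrincipalMod (valuationAt p) 0 r := by
    simp only [IsCurve.IsPrincipalMod, Finsupp.zero_apply, WithZero.exp_zero, ← hmem]
    rw [Submodule.mem_sup]
    constructor
    · rintro ⟨s, hs, _, ⟨f, rfl⟩, rfl⟩
      refine ⟨f, fun x => ?_⟩
      have := Submodule.mem_pi.1 hs x trivial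
      simpa using this
    · rintro ⟨f, hf⟩
      exact ⟨r - fun _ => f, Submodule.mem_pi.2 fun x _ => hf x, fun _ => f, ⟨f, rfl⟩, by simp⟩
  obtain ⟨v₀, hv₀, h⟩ := rank_eq_one_iff.1 hgenus
  obtain ⟨⟨r₀, hr₀⟩, rfl⟩ := Submodule.Quotient.mk_surjective _ v₀
  refine ⟨r₀, (hrep _).1 hr₀, fun h0 => hv₀ ?_, fun r hr => ?_⟩
  · rw [Submodule.Quotient.mk_eq_zero]
    exact (hprin _).2 h0
  · obtain ⟨c, hc⟩ := h (Submodule.Quotient.mk ⟨r, (hrep _).2 hr⟩)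
    rw [← Submodule.Quotient.mk_smul, eq_comm, Submodule.Quotient.eq] at hc
    exact ⟨c, (hprin _).1 hc⟩

end Curve

/-! ### Extending rational maps from curves to proper schemes -/

section Extension

lemma isDominant_SpecMap {R S : CommRingCat.{0}} (f : R ⟶ S) (hf : Function.Injective f) :
    IsDominant (Spec.map f) :=
  ⟨(PrimeSpectrum.denseRange_comap_iff_ker_le_nilRadical f.hom).2 (by
    rw [(RingHom.injective_iff_ker_eq_bot _).1 hf]; exact bot_le)⟩

/-- Morphisms from the spectrum of a domain to a separated scheme are determined by their
restrictions to the spectrum of a larger ring. -/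
lemma ext_of_SpecMap_comp_eq {R S : CommRingCat.{0}} [IsDomain R] {Y : Scheme.{0}} [Y.IsSeparated]
    {f : R ⟶ S} (hf : Function.Injective f) {a b : Spec R ⟶ Y}
    (h : Spec.map f ≫ a = Spec.map f ≫ b) : a = b := by
  have := isDominant_SpecMap f hf
  exact ext_of_isDominant (Spec.map f) h

variable {C : Scheme.{0}} [IsIntegral C]

/-- The spectrum of the function field, as a scheme over the spectrum of a local ring. -/
abbrev toLocalRing (x : C) : Spec C.functionField ⟶ Spec (C.presheaf.stalk x) :=
  Spec.map (C.presheaf.stalkSpecializes (genericPoint_specializes x))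

lemma toLocalRing_fromSpecStalk (x : C) :
    toLocalRing x ≫ C.fromSpecStalk x = C.fromSpecStalk (genericPoint C) :=
  Scheme.SpecMap_stalkSpecializes_fromSpecStalk _

lemma ext_toLocalRing {Y : Scheme.{0}} [Y.IsSeparated] {x : C}
    {a b : Spec (C.presheaf.stalk x) ⟶ Y} (h : toLocalRing x ≫ a = toLocalRing x ≫ b) : a = b :=
  ext_of_SpecMap_comp_eq (IsFractionRing.injective (C.presheaf.stalk x) C.functionField) h

instance isDominant_fromSpecStalk_genericPoint : IsDominant (C.fromSpecStalk (genericPoint C)) := ⟨by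
  rw [DenseRange, Scheme.range_fromSpecStalk]
  exact (dense_iff_closure_eq.2 (genericPoint_spec C)).mono fun y hy => by
    rw [Set.mem_singleton_iff.1 hy]; exact specializes_rfl⟩

lemma toLocalRing_fromSpecStalkOfMem {x : C} (U : C.Opens) (hx : x ∈ U) :
    toLocalRing x ≫ U.fromSpecStalkOfMem x hx =
      U.fromSpecStalkOfMem (genericPoint C) ((genericPoint_specializes x).mem_open U.2 hx) := by
  rw [← cancel_mono U.ι, Category.assoc, Scheme.Opens.fromSpecStalkOfMem_ι,
    Scheme.Opens.fromSpecStalkOfMem_ι, toLocalRing_fromSpecStalk]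

lemma exists_lift_of_isProper {R K : Type} [CommRing R] [IsDomain R] [IsDiscreteValuationRing R]
    [Field K] [Algebra R K] [IsFractionRing R K] {S Y : Scheme.{0}} (sY : Y ⟶ S)
    [IsProper sY] (α : Spec (.of K) ⟶ Y) (γ : Spec (.of R) ⟶ S)
    (h : α ≫ sY = Spec.map (CommRingCat.ofHom (algebraMap R K)) ≫ γ) :
    ∃ β : Spec (.of R) ⟶ Y,
      Spec.map (CommRingCat.ofHom (algebraMap R K)) ≫ β = α ∧ β ≫ sY = γ := by
  have hcrit : ValuativeCriterion sY := by
    have : IsProper sY := inferInstance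
    rw [IsProper.eq_valuativeCriterion] at this
    exact this.1.1.1
  obtain ⟨⟨⟨β, hβ₁, hβ₂⟩, -⟩⟩ := hcrit { R := R, K := K, i₁ := α, i₂ := γ, commSq := ⟨h⟩ }
  exact ⟨β, hβ₁, hβ₂⟩

lemma exists_glue {C Y : Scheme.{0}} {ι : Type} (U : ι → C.Opens) (hU : ∀ x, ∃ i, x ∈ U i)
    (f : ∀ i, (U i).toScheme ⟶ Y)
    (h : ∀ i j, pullback.fst (U i).ι (U j).ι ≫ f i = pullback.snd (U i).ι (U j).ι ≫ f j) :
    ∃ φ : C ⟶ Y, ∀ i, (U i).ι ≫ φ = f i := by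
  let 𝒰 := C.openCoverOfIsOpenCover U (eq_top_iff.2 fun x _ => Opens.mem_iSup.2 (hU x))
  exact ⟨𝒰.glueMorphisms f h, 𝒰.ι_glueMorphisms f h⟩

lemma ext_of_opens {C Y : Scheme.{0}} {ι : Type} (U : ι → C.Opens) (hU : ∀ x, ∃ i, x ∈ U i)
    {a b : C ⟶ Y} (h : ∀ i, (U i).ι ≫ a = (U i).ι ≫ b) : a = b :=
  (C.openCoverOfIsOpenCover U (eq_top_iff.2 fun x _ => Opens.mem_iSup.2 (hU x))).hom_ext _ _ h

variable {S Y : Scheme.{0}} (sC : C ⟶ S) (sY : Y ⟶ S)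

lemma exists_extension_nhds [LocallyOfFiniteType sY] {x : C} (β : Spec (C.presheaf.stalk x) ⟶ Y)
    (hβ : β ≫ sY = C.fromSpecStalk x ≫ sC) :
    ∃ (U : C.Opens) (_ : x ∈ U) (hη : genericPoint C ∈ U) (f : U.toScheme ⟶ Y),
      U.fromSpecStalkOfMem _ hη ≫ f = toLocalRing x ≫ β ∧ f ≫ sY = U.ι ≫ sC := by
  obtain ⟨U, hxU, f, hf, hf'⟩ := spread_out_of_isGermInjective' sC sY β hβ
  refine ⟨U, hxU, (genericPoint_specializes x).mem_open U.2 hxU, f, ?_, hf'⟩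
  rw [hf, ← toLocalRing_fromSpecStalkOfMem U hxU, Category.assoc]

lemma exists_lift_stalk [IsProper sY] (x : C) [hx : IsDiscreteValuationRing (C.presheaf.stalk x)]
    (α : Spec C.functionField ⟶ Y) (hα : α ≫ sY = C.fromSpecStalk (genericPoint C) ≫ sC) :
    ∃ β : Spec (C.presheaf.stalk x) ⟶ Y,
      toLocalRing x ≫ β = α ∧ β ≫ sY = C.fromSpecStalk x ≫ sC := by
  have h := @exists_lift_of_isProper (C.presheaf.stalk x) C.functionField _ inferInstance hx _ _
    inferInstance S Y sY _ α (C.fromSpecStalk x ≫ sC)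
  rw [← toLocalRing_fromSpecStalk x, Category.assoc] at hα
  exact h hα

lemma isDominant_of_comp_isOpenImmersion {W P C : Scheme.{0}} (g : W ⟶ P) (j : P ⟶ C)
    [IsOpenImmersion j] [IsDominant (g ≫ j)] : IsDominant g := by
  refine ⟨dense_iff_inter_open.2 fun V hV hne => ?_⟩
  obtain ⟨_, ⟨v, hv, rfl⟩, w, hw⟩ := (IsDominant.denseRange (f := g ≫ j)).inter_open_nonempty
    _ (j.isOpenEmbedding.isOpenMap V hV) (hne.image _)
  rw [Scheme.Hom.comp_apply] at hw
  exact ⟨v, hv, w, j.isOpenEmbedding.injective hw⟩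

/-- A rational map from a curve to a proper scheme is a morphism. -/
theorem exists_extension [IsProper sY] [Y.IsSeparated]
    (hC : ∀ x : C, x = genericPoint C ∨ IsDiscreteValuationRing (C.presheaf.stalk x))
    (α : Spec C.functionField ⟶ Y) (hα : α ≫ sY = C.fromSpecStalk (genericPoint C) ≫ sC) :
    ∃ φ : C ⟶ Y, φ ≫ sY = sC ∧ C.fromSpecStalk (genericPoint C) ≫ φ = α := by
  have key (x : C) : ∃ (U : C.Opens) (_ : x ∈ U) (hη : genericPoint C ∈ U) (f : U.toScheme ⟶ Y),
      U.fromSpecStalkOfMem _ hη ≫ f = α ∧ f ≫ sY = U.ι ≫ sC := by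
    rcases hC x with rfl | hx
    · have h1 : toLocalRing (genericPoint C) = 𝟙 _ := by
        simp [toLocalRing]
      obtain ⟨U, h, hη, f, hf, hf'⟩ := exists_extension_nhds sC sY α hα
      exact ⟨U, h, hη, f, by rw [hf, h1, Category.id_comp], hf'⟩
    -- The valuative criterion extends the map to the spectrum of the local ring, and finite
    -- presentation spreads it out to a neighbourhood.
    · obtain ⟨β, hβ, hβ'⟩ := exists_lift_stalk sC sY x α hα
      obtain ⟨U, h, hη, f, hf, hf'⟩ := exists_extension_nhds sC sY β hβ'
      exact ⟨U, h, hη, f, hf.trans hβ, hf'⟩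
  choose U hU hη f hf hf' using key
  -- The local extensions agree at the generic point, which is dense in the reduced overlap, and the
  -- target is separated.
  have hglue (x y : C) : pullback.fst (U x).ι (U y).ι ≫ f x = pullback.snd (U x).ι (U y).ι ≫ f y := by
    let g : Spec C.functionField ⟶ pullback (U x).ι (U y).ι :=
      pullback.lift ((U x).fromSpecStalkOfMem _ (hη x)) ((U y).fromSpecStalkOfMem _ (hη y)) (by
        rw [Scheme.Opens.fromSpecStalkOfMem_ι, Scheme.Opens.fromSpecStalkOfMem_ι])
    have hg : g ≫ pullback.fst (U x).ι (U y).ι ≫ (U x).ι = C.fromSpecStalk (genericPoint C) := by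
      rw [pullback.lift_fst_assoc, Scheme.Opens.fromSpecStalkOfMem_ι]
    have : IsDominant (g ≫ pullback.fst (U x).ι (U y).ι ≫ (U x).ι) := hg ▸ inferInstance
    have := isDominant_of_comp_isOpenImmersion g (pullback.fst (U x).ι (U y).ι ≫ (U x).ι)
    have : IsReduced (pullback (U x).ι (U y).ι) :=
      isReduced_of_isOpenImmersion (pullback.fst (U x).ι (U y).ι ≫ (U x).ι)
    refine ext_of_isDominant g ?_
    rw [pullback.lift_fst_assoc, pullback.lift_snd_assoc, hf, hf]
  obtain ⟨φ, hφ⟩ := exists_glue U (fun x => ⟨x, hU x⟩) f hglue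
  refine ⟨φ, ext_of_opens U (fun x => ⟨x, hU x⟩) fun x => ?_, ?_⟩
  · rw [← Category.assoc, hφ, hf']
  · rw [← hf (genericPoint C), ← hφ, ← Category.assoc, Scheme.Opens.fromSpecStalkOfMem_ι]

end Extension

/-! ### A criterion for closed immersions -/

section ClosedImmersion

variable {C : Scheme.{0}} [IsIntegral C]

lemma SpecMap_comp_closedPoint {R S : CommRingCat.{0}} [IsLocalRing R] [IsLocalRing S] {Y : Scheme.{0}}
    (f : R ⟶ S) [IsLocalHom f.hom] (g : Spec R ⟶ Y) :
    (Spec.map f ≫ g) (IsLocalRing.closedPoint S) = g (IsLocalRing.closedPoint R) :=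
  (Scheme.Hom.comp_apply _ _ _).trans congr(g $(Spec_closedPoint (f := f)))

/-- A point of a separated integral scheme is determined by its local ring in the function field. -/
lemma eq_of_range_algebraMap_eq [C.IsSeparated] {x y : C}
    (h : (algebraMap (C.presheaf.stalk x) C.functionField).range =
      (algebraMap (C.presheaf.stalk y) C.functionField).range) : x = y := by
  have hinj (x : C) : Function.Injective (algebraMap (C.presheaf.stalk x) C.functionField) :=
    IsFractionRing.injective (C.presheaf.stalk x) C.functionField
  let e (x : C) : C.presheaf.stalk x ≃+* (algebraMap (C.presheaf.stalk x) C.functionField).range :=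
    RingEquiv.ofBijective (algebraMap (C.presheaf.stalk x) C.functionField).rangeRestrict
      ⟨fun a b hab => hinj x congr(($hab).1), RingHom.rangeRestrict_surjective _⟩
  let θ : C.presheaf.stalk y ≃+* C.presheaf.stalk x :=
    (e y).trans ((RingEquiv.subringCongr h.symm).trans (e x).symm)
  have hθ (a) : algebraMap _ C.functionField (θ a) = algebraMap _ C.functionField a := by
    have : (e x (θ a) : C.functionField) = e y a := by
      simp only [θ, RingEquiv.trans_apply, RingEquiv.apply_symm_apply]; rfl
    exact this
  let θ' : C.presheaf.stalk y ⟶ C.presheaf.stalk x := (RingEquiv.toCommRingCatIso θ).hom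
  have h1 : toLocalRing x ≫ Spec.map θ' = toLocalRing y := by
    rw [toLocalRing, ← Spec.map_comp]
    congr 1
    ext a
    exact hθ a
  -- Both maps from the spectrum of the local ring agree generically, so they are equal by
  -- separatedness; comparing images of the closed point gives `x = y`.
  have h2 : Spec.map θ' ≫ C.fromSpecStalk y = C.fromSpecStalk x := ext_toLocalRing (x := x) (by
    rw [reassoc_of% h1, toLocalRing_fromSpecStalk, toLocalRing_fromSpecStalk])
  have : IsLocalHom θ'.hom := isLocalHom_of_isIso θ'
  have h3 : (Spec.map θ' ≫ C.fromSpecStalk y)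
      (IsLocalRing.closedPoint (C.presheaf.stalk x)) = y :=
    (SpecMap_comp_closedPoint θ' _).trans Scheme.fromSpecStalk_closedPoint
  rw [h2] at h3
  exact Scheme.fromSpecStalk_closedPoint.symm.trans h3

variable {Y : Scheme.{0}} (ψ : C ⟶ Y)

/-- The right-hand side depends on `x` only through its image `y`. When the stalk maps are onto, two
points with the same image have the same local ring in the function field. -/
lemma range_stalkMap {x : C} {y : Y} (h : ψ x = y) :
    ((algebraMap (C.presheaf.stalk x) C.functionField).comp
      (ψ.stalkMap x).hom).range =
    ((ψ.stalkMap (genericPoint C)).hom.comp (Y.presheaf.stalkSpecializes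
      (h ▸ (genericPoint_specializes x).map ψ.continuous)).hom).range := by
  subst h
  exact congr($(ψ.stalkSpecializes_stalkMap _ _ (genericPoint_specializes x)).hom.range).symm

/-- A closed morphism from an integral separated scheme which is surjective on stalks is injective,
hence a closed immersion. -/
theorem isClosedImmersion_of_stalkMap_surjective [C.IsSeparated] [UniversallyClosed ψ]
    (h : ∀ x, Function.Surjective (ψ.stalkMap x)) : IsClosedImmersion ψ where
  stalkMap_surjective := h
  isClosedEmbedding := by
    refine .of_continuous_injective_isClosedMap ψ.continuous (fun x y hxy => ?_) ψ.isClosedMap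
    refine eq_of_range_algebraMap_eq ?_
    have hr (x : C) : (algebraMap (C.presheaf.stalk x) C.functionField).range =
        ((algebraMap (C.presheaf.stalk x) C.functionField).comp (ψ.stalkMap x).hom).range := by
      rw [← RingHom.map_range, RingHom.range_eq_top.2 (h x), RingHom.range_eq_map]
    rw [hr x, hr y, range_stalkMap ψ hxy, range_stalkMap ψ rfl]

/-- Surjectivity on stalks at one point implies surjectivity at the generic point. -/
lemma stalkMap_genericPoint_surjective {x : C} (h : Function.Surjective (ψ.stalkMap x)) :
    Function.Surjective (ψ.stalkMap (genericPoint C)) := by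
  have hx (a) : ∃ b, ψ.stalkMap (genericPoint C) b =
      algebraMap (C.presheaf.stalk x) C.functionField a := by
    obtain ⟨b, rfl⟩ := h a
    exact ⟨_, ψ.stalkSpecializes_stalkMap_apply _ _ (genericPoint_specializes x) b⟩
  intro f
  obtain ⟨a, b, hb, rfl⟩ := IsFractionRing.div_surjective (C.presheaf.stalk x)
    (K := C.functionField) f
  obtain ⟨a', ha'⟩ := hx a
  obtain ⟨b', hb'⟩ := hx b
  have hb0 : algebraMap (C.presheaf.stalk x) C.functionField b ≠ 0 :=
    IsFractionRing.to_map_ne_zero_of_mem_nonZeroDivisors hb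
  have hu : IsUnit b' := by
    refine isUnit_of_map_unit (ψ.stalkMap (genericPoint C)).hom _ ?_
    rw [hb']
    exact (isUnit_iff_ne_zero (G₀ := C.functionField)).2 hb0
  obtain ⟨u, rfl⟩ := hu
  refine ⟨a' * ↑u⁻¹, ?_⟩
  have h1 : ψ.stalkMap (genericPoint C) (↑u⁻¹) *
      algebraMap (C.presheaf.stalk x) C.functionField b = 1 := by
    rw [← hb', ← map_mul, Units.inv_mul, map_one]
  rw [map_mul, ha', div_eq_mul_inv]
  congr 1
  exact eq_inv_of_mul_eq_one_left h1

/-- A closed immersion of a reduced scheme identifies it with its image. -/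
theorem exists_iso_reducedClosure {C Y : Scheme.{0}} [IsReduced C] (ψ : C ⟶ Y) [IsClosedImmersion ψ]
    {S : Set Y} (hS : closure S = Set.range ψ) :
    ∃ e : C ≅ (reducedClosure S).subscheme, e.hom ≫ (reducedClosure S).subschemeι = ψ := by
  -- The kernel of a closed immersion of a reduced scheme is the vanishing ideal of its range.
  have h : reducedClosure S = ψ.ker := by
    have := Scheme.IdealSheafData.map_vanishingIdeal ψ ⊤
    rw [Scheme.IdealSheafData.vanishingIdeal_top, Scheme.nilradical_eq_bot,
      Scheme.IdealSheafData.map_bot] at this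
    rw [this, reducedClosure]
    congr 1
    ext1
    simp [hS, ψ.isClosedEmbedding.isClosed_range.closure_eq]
  rw [h]
  exact ⟨asIso ψ.toImage, ψ.toImage_imageι⟩

end ClosedImmersion

/-! ### Images of local rings in the function field -/

section ImageRing

variable {C : Scheme.{0}} [IsIntegral C] {Y Y' : Scheme.{0}}

/-- The image in the function field of the local ring of the target of a morphism. -/
def imageSubring (φ : C ⟶ Y) (x : C) : Subring C.functionField :=
  ((algebraMap (C.presheaf.stalk x) C.functionField).comp (φ.stalkMap x).hom).range

lemma imageSubring_comp_le (φ : C ⟶ Y) (g : Y ⟶ Y') (x : C) :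
    imageSubring (φ ≫ g) x ≤ imageSubring φ x := by
  rintro _ ⟨a, rfl⟩
  refine ⟨g.stalkMap (φ x) a, ?_⟩
  rw [RingHom.comp_apply, RingHom.comp_apply, Scheme.Hom.stalkMap_comp]
  rfl

lemma range_stalkClosedPointTo_le {R : CommRingCat.{0}} [IsLocalRing R] {y : Y}
    (f : Y.presheaf.stalk y ⟶ R) [IsLocalHom f.hom] :
    (Scheme.stalkClosedPointTo (Spec.map f ≫ Y.fromSpecStalk y)).hom.range ≤ f.hom.range := by
  rintro _ ⟨a, rfl⟩
  obtain ⟨U, hU, b, rfl⟩ := Y.presheaf.exists_germ_eq a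
  exact ⟨_, congr($(Scheme.germ_stalkClosedPointTo_Spec_fromSpecStalk f U hU) b).symm⟩

/-- An open immersion identifies the stalk of `Y` with a localization of `A`, through which `h`
factors. -/
lemma range_le_range_stalkClosedPointTo {R A : CommRingCat.{0}} [IsLocalRing R] (h : A ⟶ R)
    (j : Spec A ⟶ Y) [IsOpenImmersion j] :
    h.hom.range ≤ (Scheme.stalkClosedPointTo (Spec.map h ≫ j)).hom.range := by
  rintro _ ⟨a, rfl⟩
  rw [Scheme.stalkClosedPointTo_comp]
  obtain ⟨b, hb⟩ := (ConcreteCategory.bijective_of_isIso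
    (j.stalkMap (Spec.map h (IsLocalRing.closedPoint R)))).2
      ((Spec A).presheaf.germ ⊤ _ trivial ((Scheme.ΓSpecIso A).inv a))
  refine ⟨b, ?_⟩
  have := congr($(Scheme.germ_stalkClosedPointTo_Spec h) ((Scheme.ΓSpecIso A).inv a))
  exact (congrArg (Scheme.stalkClosedPointTo (Spec.map h)).hom hb).trans (this.trans (by simp))

/-- If `φ` is given near `x` by a ring homomorphism from the ring of a chart of `Y`, then its image
is contained in the image of the local ring. -/
lemma algebraMap_mem_imageSubring {φ : C ⟶ Y} {x : C} {A : CommRingCat.{0}}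
    (h : A ⟶ C.presheaf.stalk x) (j : Spec A ⟶ Y) [IsOpenImmersion j]
    (e : C.fromSpecStalk x ≫ φ = Spec.map h ≫ j) (a : A) :
    algebraMap (C.presheaf.stalk x) C.functionField (h a) ∈ imageSubring φ x := by
  have h1 : h a ∈ (Scheme.stalkClosedPointTo (Spec.map h ≫ j)).hom.range :=
    range_le_range_stalkClosedPointTo h j ⟨a, rfl⟩
  rw [← e, ← Scheme.SpecMap_stalkMap_fromSpecStalk] at h1
  obtain ⟨b, hb⟩ := range_stalkClosedPointTo_le _ h1
  exact ⟨b, congr(algebraMap (C.presheaf.stalk x) C.functionField $hb)⟩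

/-- The map on stalks is local, so a preimage of a unit is a unit. -/
lemma inv_mem_imageSubring {φ : C ⟶ Y} {x : C} {a : C.presheaf.stalk x} (ha : IsUnit a)
    (h : algebraMap (C.presheaf.stalk x) C.functionField a ∈ imageSubring φ x) :
    (algebraMap (C.presheaf.stalk x) C.functionField a)⁻¹ ∈ imageSubring φ x := by
  obtain ⟨b, hb⟩ := h
  have hb' : φ.stalkMap x b = a :=
    IsFractionRing.injective (C.presheaf.stalk x) C.functionField hb
  obtain ⟨u, rfl⟩ := isUnit_of_map_unit (φ.stalkMap x).hom b (by rw [hb']; exact ha)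
  refine ⟨↑u⁻¹, eq_inv_of_mul_eq_one_left ?_⟩
  rw [← hb, ← map_mul, Units.inv_mul, map_one]

lemma stalkMap_surjective_of_imageSubring {φ : C ⟶ Y} {x : C}
    (h : ∀ a : C.presheaf.stalk x,
      algebraMap (C.presheaf.stalk x) C.functionField a ∈ imageSubring φ x) :
    Function.Surjective (φ.stalkMap x) := fun a => by
  obtain ⟨b, hb⟩ := h a
  exact ⟨b, IsFractionRing.injective (C.presheaf.stalk x) C.functionField hb⟩

end ImageRing

/-! ### Points of projective space with values in a ring -/

section ProjPoint

attribute [local instance] MvPolynomial.gradedAlgebra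

open HomogeneousLocalization MvPolynomial

variable {σ : Type} {R R' : Type} [CommRing R] [Algebra ℂ R] [CommRing R'] [Algebra ℂ R']

/-- The evaluation at `w` of the fractions `a / f ^ n`, where `a` is a form. -/
def evalAway (w : σ → R) {f : MvPolynomial σ ℂ} (hf : IsUnit (aeval w f)) :
    Away (homogeneousSubmodule σ ℂ) f →+* R :=
  (IsLocalization.Away.lift (S := Localization.Away f) (g := (aeval w).toRingHom) f hf).comp
    (algebraMap (Away (homogeneousSubmodule σ ℂ) f) (Localization.Away f))

lemma evalAway_mk_mul (w : σ → R) {f : MvPolynomial σ ℂ} (hf : IsUnit (aeval w f)) {d : ℕ}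
    (hd : f ∈ homogeneousSubmodule σ ℂ d) (n : ℕ) (a : MvPolynomial σ ℂ) (ha) :
    evalAway w hf (Away.mk _ hd n a ha) * aeval w f ^ n = aeval w a := by
  let L : Localization.Away f →+* R :=
    IsLocalization.Away.lift (S := Localization.Away f) (g := (aeval w).toRingHom) f hf
  have hL (b) : L (algebraMap _ _ b) = aeval w b := IsLocalization.Away.lift_eq f hf b
  change L (Away.mk _ hd n a ha).val * aeval w f ^ n = aeval w a
  rw [← hL f, ← map_pow, ← map_pow, ← map_mul, Away.val_mk, ← hL a]
  congr 1
  rw [Localization.mk_eq_mk']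
  exact IsLocalization.mk'_spec _ a (⟨f ^ n, n, rfl⟩ : Submonoid.powers f)

lemma evalAway_ext {w : σ → R} {f : MvPolynomial σ ℂ} (hf : IsUnit (aeval w f)) {d : ℕ}
    (hd : f ∈ homogeneousSubmodule σ ℂ d) {φ : Away (homogeneousSubmodule σ ℂ) f →+* R}
    (h : ∀ n a ha, φ (Away.mk _ hd n a ha) * aeval w f ^ n = aeval w a) : φ = evalAway w hf := by
  ext x
  obtain ⟨n, a, ha, rfl⟩ := Away.mk_surjective _ hd x
  refine (hf.pow n).mul_right_cancel ?_
  rw [h, evalAway_mk_mul]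

/-- The point with homogeneous coordinates `w` in the chart where the form `f` does not vanish. -/
def projChart (w : σ → R) {f : MvPolynomial σ ℂ} {m : ℕ} (hd : f ∈ homogeneousSubmodule σ ℂ m)
    (hm : 0 < m) (hf : IsUnit (aeval w f)) : Spec (.of R) ⟶ ProjSpace σ :=
  Spec.map (CommRingCat.ofHom (evalAway w hf)) ≫ Proj.awayι _ f hd hm

section

variable (w : σ → R) {f g : MvPolynomial σ ℂ} {m l : ℕ} (hd : f ∈ homogeneousSubmodule σ ℂ m)
    (hm : 0 < m) (hf : IsUnit (aeval w f)) (hd' : g ∈ homogeneousSubmodule σ ℂ l)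
    (hl : 0 < l) (hg : IsUnit (aeval w g))

include hd' hg in
-- Restriction to the smaller chart where `f * g` does not vanish; any two charts are compared
-- through it.
lemma projChart_of_eq_mul {x : MvPolynomial σ ℂ} (hx : x = f * g) {n : ℕ} (hn : n = m + l)
    (hxd : x ∈ homogeneousSubmodule σ ℂ n) (hn' : 0 < n) (hxu : IsUnit (aeval w x)) :
    projChart w hd hm hf = projChart w hxd hn' hxu := by
  subst hn
  rw [projChart, projChart, ← Proj.SpecMap_awayMap_awayι (𝒜 := homogeneousSubmodule σ ℂ) hd hm hd' hx,
    ← Category.assoc, ← Spec.map_comp, ← CommRingCat.ofHom_comp]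
  congr 3
  symm
  refine evalAway_ext hf hd fun n a ha => (hg.pow n).mul_right_cancel ?_
  have e : aeval w f * aeval w g = aeval w x := by rw [hx, map_mul]
  rw [RingHom.comp_apply, awayMap_mk, mul_assoc, ← mul_pow, e, evalAway_mk_mul, map_mul, map_pow]

include hd' hl hg in
lemma projChart_eq : projChart w hd hm hf = projChart w hd' hl hg := by
  rw [projChart_of_eq_mul w hd hm hf hd' hg rfl rfl (SetLike.mul_mem_graded hd hd') (by omega)
    (by rw [map_mul]; exact hf.mul hg), projChart_of_eq_mul w hd' hl hg hd hf (mul_comm f g)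
    (add_comm m l)]

lemma SpecMap_projChart (φ : R →ₐ[ℂ] R') (hf' : IsUnit (aeval (fun i => φ (w i)) f)) :
    Spec.map (CommRingCat.ofHom φ.toRingHom) ≫ projChart w hd hm hf =
      projChart (fun i => φ (w i)) hd hm hf' := by
  rw [projChart, projChart, ← Category.assoc, ← Spec.map_comp, ← CommRingCat.ofHom_comp]
  congr 3
  have h (a : MvPolynomial σ ℂ) : aeval (fun i => φ (w i)) a = φ (aeval w a) := by
    rw [← AlgHom.comp_apply, comp_aeval]
  refine evalAway_ext hf' hd fun n a ha => ?_
  rw [h, h, ← evalAway_mk_mul w hf hd n a ha, map_mul, map_pow]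
  rfl

lemma projChart_smul {c : R} (hf' : IsUnit (aeval (fun i => c * w i) f)) :
    projChart (fun i => c * w i) hd hm hf' = projChart w hd hm hf := by
  rw [projChart, projChart]
  congr 3
  symm
  refine evalAway_ext hf' hd fun n a ha => ?_
  rw [aeval_smul_of_isHomogeneous hd, aeval_smul_of_isHomogeneous ha, mul_pow, ← pow_mul,
    mul_left_comm, evalAway_mk_mul, smul_eq_mul, mul_comm n m]

lemma projChart_toSpec :
    projChart w hd hm hf ≫ ProjSpace.toSpec σ = Spec.map (CommRingCat.ofHom (algebraMap ℂ R)) := by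
  rw [projChart, ProjSpace.toSpec, Category.assoc, Proj.awayι_toSpecZero_assoc, ← Spec.map_comp,
    ← Spec.map_comp, ← CommRingCat.ofHom_comp, ← CommRingCat.ofHom_comp]
  congr 2
  ext c
  have := evalAway_mk_mul w hf hd 0 (algebraMap ℂ _ c) (by
    rw [zero_smul]; exact isHomogeneous_C _ c)
  rw [pow_zero, mul_one, AlgHom.commutes] at this
  rw [← this]
  rfl

include hd' hl in
-- On the chart of `f`, a form `g` of degree `l` is represented by `g ^ m / f ^ l`, and `f` is a
-- unit at `w`.
lemma mem_asHomogeneousIdeal_projChart (𝔭 : Spec (.of R)) :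
    g ∈ (projChart w hd hm hf 𝔭).asHomogeneousIdeal ↔ aeval w g ∈ 𝔭.asIdeal := by
  rw [← not_iff_not, ← Proj.mem_basicOpen]
  have h : aeval w f ∉ 𝔭.asIdeal := fun h => 𝔭.2.ne_top (Ideal.eq_top_of_isUnit_mem _ h hf)
  refine (SetLike.ext_iff.1 (Proj.awayι_preimage_basicOpen (homogeneousSubmodule σ ℂ) hd hm hd' hl)
    (Spec.map (CommRingCat.ofHom (evalAway w hf)) 𝔭)).trans ?_
  change evalAway w hf _ ∉ 𝔭.asIdeal ↔ _
  refine not_congr ⟨fun h1 => ?_, fun h1 => ?_⟩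
  · refine 𝔭.2.mem_of_pow_mem m ?_
    rw [← map_pow, ← evalAway_mk_mul w hf hd l (g ^ m) (by
      rw [smul_eq_mul, mul_comm]; exact SetLike.pow_mem_graded m hd')]
    exact Ideal.mul_mem_right _ _ h1
  · refine (𝔭.2.mem_or_mem ?_).resolve_right (mt (𝔭.2.mem_of_pow_mem l) h)
    rw [evalAway_mk_mul, map_pow]
    exact Ideal.pow_mem_of_mem _ h1 _ hm

end

end ProjPoint

attribute [local instance] MvPolynomial.gradedAlgebra

/-! ### Projective space is proper over `ℂ` -/

section ProjSpace

open MvPolynomial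

variable (σ : Type)

instance : IsIso (CommRingCat.ofHom (algebraMap ℂ (homogeneousSubmodule σ ℂ 0))) := by
  rw [ConcreteCategory.isIso_iff_bijective]
  refine ⟨fun a b h => C_injective σ ℂ congr(($h).1), fun ⟨f, hf⟩ => ?_⟩
  refine ⟨coeff 0 f, Subtype.ext ?_⟩
  exact (totalDegree_eq_zero_iff_eq_C.1 (Nat.le_zero.1
    ((mem_homogeneousSubmodule 0 f).1 hf).totalDegree_le)).symm

instance [Finite σ] : IsProper (ProjSpace.toSpec σ) := by
  have : Algebra.FiniteType (homogeneousSubmodule σ ℂ 0) (MvPolynomial σ ℂ) :=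
    have : IsScalarTower ℂ (homogeneousSubmodule σ ℂ 0) (MvPolynomial σ ℂ) :=
      ⟨fun c a f => smul_mul_assoc c (a : MvPolynomial σ ℂ) f⟩
    Algebra.FiniteType.of_restrictScalars_finiteType ℂ _ _
  delta ProjSpace.toSpec
  infer_instance

end ProjSpace

/-! ### Values of families of rational functions -/

section IsValueAt

open MvPolynomial

variable {k K S σ : Type*} [Field k] [Field K] [Algebra k K] {v : S → Valuation K (WithZero (Multiplicative ℤ))}

/-- The family `s` has the value `w ≠ 0` at the point `x`, with respect to the generator `t`. -/
def IsValueAt (v : S → Valuation K (WithZero (Multiplicative ℤ))) (s : σ → K) (x : S) (t : K)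
    (w : σ → k) : Prop :=
  w ≠ 0 ∧ ∀ i, v x (s i - t * algebraMap k K (w i)) < v x t

lemma IsValueAt.ne_zero {s : σ → K} {x : S} {t : K} {w : σ → k} (h : IsValueAt v s x t w) :
    t ≠ 0 := by
  obtain ⟨i, -⟩ := Function.ne_iff.1 h.1
  rintro rfl
  simpa using h.2 i

lemma IsValueAt.inv_mul_sub_lt {s : σ → K} {x : S} {t : K} {w : σ → k} (h : IsValueAt v s x t w)
    (i : σ) : v x (t⁻¹ * s i - algebraMap k K (w i)) < 1 := by
  have ht := h.ne_zero
  have : t⁻¹ * s i - algebraMap k K (w i) = t⁻¹ * (s i - t * algebraMap k K (w i)) := by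
    field_simp
  rw [this, map_mul, map_inv₀]
  exact (inv_mul_lt_one₀ (zero_lt_iff.2 ((v x).ne_zero_iff.2 ht))).2 (h.2 i)

lemma exists_isValueAt [Finite σ] (hv : IsCurve k v) {s : σ → K} (hs : s ≠ 0) (x : S) :
    ∃ t, ∃ w : σ → k, IsValueAt v s x t w := by
  obtain ⟨i, hi⟩ := Function.ne_iff.1 hs
  have : Nonempty σ := ⟨i⟩
  -- A coordinate of largest valuation serves as generator; its own value cannot be zero.
  obtain ⟨j, hj⟩ := Finite.exists_max fun j => v x (s j)
  have hj0 : s j ≠ 0 := fun h => hi (by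
    have := hj i
    rwa [h, map_zero, le_zero_iff, map_eq_zero] at this)
  choose w hw using fun i => hv.exists_sub_lt x (f := s j) (g := s i) hj0 (hj i)
  refine ⟨s j, w, fun h0 => ?_, fun i => ?_⟩
  · have := hw j
    rw [h0] at this
    simp at this
  · have := hw i
    rwa [Algebra.smul_def, mul_comm] at this

end IsValueAt

/-! ### Morphisms from a curve to projective space given by rational functions -/

section ProjMap

open MvPolynomial

variable {C : Scheme.{0}} [IsIntegral C] (p : C ⟶ Spec (.of ℂ))

/-- The inclusion of a local ring into the function field. -/
def stalkToFunctionField (x : C) :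
    letI := functionFieldAlgebra p
    letI := stalkAlgebra p x
    C.presheaf.stalk x →ₐ[ℂ] C.functionField :=
  letI := functionFieldAlgebra p
  letI := stalkAlgebra p x
  { algebraMap (C.presheaf.stalk x) C.functionField with
    commutes' := fun c => (algebraMap_functionField p x c).symm }

variable [SmoothOfRelativeDimension 1 p] {σ : Type}

/-- The local coordinates of a point given by rational functions. -/
lemma IsValueAt.exists_local {x : closedPoints C} {s : σ → C.functionField} {t : C.functionField}
    {w : σ → ℂ}
    (h : letI := functionFieldAlgebra p; IsValueAt (valuationAt p) s x t w) :
    ∃ w' : σ → C.presheaf.stalk x.1,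
      (∀ i, algebraMap (C.presheaf.stalk x.1) C.functionField (w' i) = t⁻¹ * s i) ∧
      letI := stalkAlgebra p x.1
      ∀ F : MvPolynomial σ ℂ, IsUnit (aeval w' F) ↔ eval w F ≠ 0 := by
  let := functionFieldAlgebra p
  let := stalkAlgebra p x.1
  have h1 := h.inv_mul_sub_lt
  have h2 (i : σ) : ∃ a, algebraMap (C.presheaf.stalk x.1) C.functionField a = t⁻¹ * s i := by
    rw [← valuationAt_le_one_iff p x, ← sub_add_cancel (t⁻¹ * s i) (algebraMap ℂ _ (w i))]
    exact (valuationAt p x).map_add_le (h1 i).le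
      ((valuationAt_le_one_iff p x).2 ⟨_, (algebraMap_functionField p x.1 (w i)).symm⟩)
  choose w' hw' using h2
  refine ⟨w', hw', fun F => ?_⟩
  -- In the residue field `ℂ` the local coordinates `w'` reduce to `w`, so a form at `w'` is a unit
  -- exactly when its value at `w` is nonzero.
  have h3 : (IsLocalRing.residue (C.presheaf.stalk x.1)).comp (aeval (R := ℂ) w').toRingHom =
      (IsLocalRing.residue (C.presheaf.stalk x.1)).comp
        ((algebraMap ℂ (C.presheaf.stalk x.1)).comp (MvPolynomial.eval w)) := by
    refine MvPolynomial.ringHom_ext (fun c => by simp) fun i => ?_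
    rw [RingHom.comp_apply, RingHom.comp_apply, RingHom.comp_apply, eval_X, ← sub_eq_zero, ← map_sub,
      IsLocalRing.residue_eq_zero_iff, ← valuationAt_lt_one_iff p x, map_sub]
    convert h1 i using 3
    · simpa using hw' i
    · exact (algebraMap_functionField p x.1 (w i)).symm
  rw [← IsLocalRing.residue_ne_zero_iff_isUnit]
  have h4 := congr($h3 F)
  simp only [RingHom.comp_apply, AlgHom.toRingHom_eq_coe, RingHom.coe_coe] at h4
  rw [h4, ← RingHom.comp_apply]
  exact map_ne_zero _

/-- The morphism to the projective space given by rational functions. -/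
theorem exists_projMap [IsProper p] [Finite σ] {s : σ → C.functionField} {i₀ : σ} (hs : s i₀ ≠ 0) :
    letI := functionFieldAlgebra p
    ∃ φ : C ⟶ ProjSpace σ, φ ≫ ProjSpace.toSpec σ = p ∧
      C.fromSpecStalk (genericPoint C) ≫ φ = projChart s (f := X i₀) (m := 1)
        (isHomogeneous_X ℂ i₀) one_pos (by rw [aeval_X]; exact hs.isUnit) ∧
      ∀ x t w, IsValueAt (valuationAt p) s x t w → HasCoords (φ x.1) w ∧
        ∀ (n : ℕ) (A B : MvPolynomial σ ℂ), A.IsHomogeneous n → B.IsHomogeneous n →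
          eval w B ≠ 0 → aeval s A / aeval s B ∈ imageSubring φ x.1 := by
  let := functionFieldAlgebra p
  have hC : CompactSpace C := (quasiCompact_iff_compactSpace p).1 inferInstance
  have hs' : IsUnit (aeval s (X i₀ : MvPolynomial σ ℂ)) := by rw [aeval_X]; exact hs.isUnit
  let α : Spec C.functionField ⟶ ProjSpace σ := projChart (R := C.functionField) s (f := X i₀)
    (m := 1) (isHomogeneous_X ℂ i₀) one_pos hs'
  have hα : α ≫ ProjSpace.toSpec σ = C.fromSpecStalk (genericPoint C) ≫ p := by
    rw [fromSpecStalk_comp]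
    exact projChart_toSpec _ _ _ _
  obtain ⟨φ, hφ, hφ'⟩ := exists_extension p (ProjSpace.toSpec σ) (fun x =>
    (eq_genericPoint_or_isClosed p x).imp_right fun hx => isDiscreteValuationRing_stalk p hx) α hα
  refine ⟨φ, hφ, hφ', fun x t w h => ?_⟩
  let := stalkAlgebra p x.1
  obtain ⟨w', hw', hu⟩ := h.exists_local p
  have ht := h.ne_zero
  obtain ⟨j, hj⟩ := Function.ne_iff.1 h.1
  -- Near `x` the morphism is given by the regular coordinates `w' = t⁻¹ s`: the two maps agree
  -- generically because rescaling does not change a point.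
  have hchart {n : ℕ} {B : MvPolynomial σ ℂ} (hB : B ∈ homogeneousSubmodule σ ℂ n) (hn : 0 < n)
      (hB0 : IsUnit (aeval w' B)) : C.fromSpecStalk x.1 ≫ φ = projChart w' hB hn hB0 := by
    refine ext_toLocalRing (x := x.1) ?_
    rw [← Category.assoc, toLocalRing_fromSpecStalk, hφ']
    have h1 : (fun i => stalkToFunctionField p x.1 (w' i)) = fun i => t⁻¹ * s i := funext hw'
    have h2 : aeval (fun i => t⁻¹ * s i) B = stalkToFunctionField p x.1 (aeval w' B) := by
      rw [← h1, ← AlgHom.comp_apply, comp_aeval]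
    have h3 : IsUnit (aeval (fun i => t⁻¹ * s i) B) := h2 ▸ hB0.map _
    have h4 : IsUnit (aeval s B) := by
      rw [aeval_smul_of_isHomogeneous hB] at h3
      exact isUnit_of_mul_isUnit_right h3
    refine Eq.trans ?_ (SpecMap_projChart w' hB hn hB0 (stalkToFunctionField p x.1)
      (by rw [h1]; exact h3)).symm
    simp only [h1]
    rw [projChart_smul s hB hn h4]
    exact projChart_eq _ _ _ _ _ _ _
  have hXj : (X j : MvPolynomial σ ℂ) ∈ homogeneousSubmodule σ ℂ 1 := isHomogeneous_X ℂ j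
  have hj' : IsUnit (aeval w' (X j : MvPolynomial σ ℂ)) := (hu _).2 (by rw [eval_X]; exact hj)
  have key {n : ℕ} {F : MvPolynomial σ ℂ} (hF : F.IsHomogeneous n) (hn : 0 < n) :
      F ∈ (φ x.1).asHomogeneousIdeal ↔ eval w F = 0 := by
    let z : Spec (.of (C.presheaf.stalk x.1)) := IsLocalRing.closedPoint (C.presheaf.stalk x.1)
    have h1 : φ x.1 = projChart w' hXj one_pos hj' z := by
      refine Eq.trans ?_ congr($(hchart hXj one_pos hj') z)
      exact congr(φ $(Scheme.fromSpecStalk_closedPoint)).symm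
    rw [h1]
    refine (mem_asHomogeneousIdeal_projChart w' hXj one_pos hj' hF hn z).trans ?_
    refine Iff.trans (IsLocalRing.mem_maximalIdeal _) ?_
    rw [mem_nonunits_iff, hu, not_not]
  refine ⟨⟨h.1, fun n F hF => ?_⟩, fun n A B hA hB hB0 => ?_⟩
  · rcases n.eq_zero_or_pos with rfl | hn
    -- Forms of degree 0 define no chart; multiplication by a coordinate not vanishing at the point
    -- moves them to degree 1.
    · have h1 : X j ∉ (φ x.1).asHomogeneousIdeal := by
        rw [key hXj one_pos, eval_X]; exact hj
      have h2 := key (hF.mul hXj) (by omega)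
      rw [map_mul, eval_X, mul_eq_zero_iff_right hj] at h2
      rw [← h2]
      exact ⟨fun h => Ideal.mul_mem_right _ _ h,
        fun h => ((φ x.1).isPrime.mem_or_mem h).resolve_right h1⟩
    · exact key hF hn
  · have hpos {n : ℕ} {A B : MvPolynomial σ ℂ} (hn : 0 < n) (hA : A.IsHomogeneous n)
        (hB : B.IsHomogeneous n) (hB0 : eval w B ≠ 0) :
        aeval s A / aeval s B ∈ imageSubring φ x.1 := by
      have hB1 := (hu B).2 hB0
      have hB : B ∈ homogeneousSubmodule σ ℂ n := hB
      have h1 := algebraMap_mem_imageSubring (φ := φ) (x := x.1) _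
        (Proj.awayι (homogeneousSubmodule σ ℂ) B hB hn) (hchart hB hn hB1)
        (HomogeneousLocalization.Away.mk _ hB 1 A (by rw [one_smul]; exact hA))
      have h2 := congr(stalkToFunctionField p x.1
        $(evalAway_mk_mul w' hB1 hB 1 A (by rw [one_smul]; exact hA)))
      have h3 (F : MvPolynomial σ ℂ) (hF : F.IsHomogeneous n) :
          stalkToFunctionField p x.1 (aeval w' F) = (t⁻¹) ^ n * aeval s F := by
        rw [← aeval_smul_of_isHomogeneous hF, ← AlgHom.comp_apply, comp_aeval]
        congr 2
        exact funext hw'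
      rw [pow_one, map_mul, h3 _ hA, h3 _ hB] at h2
      have h4 : aeval s B ≠ 0 := by
        have h5 := hB1.map (stalkToFunctionField p x.1)
        rw [h3 _ hB] at h5
        exact right_ne_zero_of_mul h5.ne_zero
      have h6 : (t⁻¹) ^ n ≠ 0 := pow_ne_zero _ (inv_ne_zero ht)
      convert h1 using 1
      rw [div_eq_iff h4]
      refine mul_left_cancel₀ h6 ?_
      rw [← h2]
      exact mul_left_comm _ _ _
    rcases n.eq_zero_or_pos with rfl | hn
    · have hj0 : aeval s (X j : MvPolynomial σ ℂ) ≠ 0 := by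
        have h5 := hj'.map (stalkToFunctionField p x.1)
        rw [aeval_X] at h5
        have h6 : stalkToFunctionField p x.1 (w' j) = t⁻¹ * s j := hw' j
        rw [h6] at h5
        rw [aeval_X]
        exact right_ne_zero_of_mul h5.ne_zero
      rw [← mul_div_mul_right _ _ hj0, ← map_mul, ← map_mul]
      exact hpos (by omega) (hA.mul hXj) (hB.mul hXj)
        (by rw [map_mul, eval_X]; exact mul_ne_zero hB0 hj)
    · exact hpos hn hA hB hB0

end ProjMap

attribute [local instance] MvPolynomial.gradedAlgebra

/-! ### Closed points of projective space and their coordinates -/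

section HasCoords

open MvPolynomial

variable {σ : Type}

open scoped Classical in
lemma le_of_homogeneous {P Q : ProjSpace σ} (h : ∀ (n : ℕ) (f : MvPolynomial σ ℂ),
    f.IsHomogeneous n → f ∈ P.asHomogeneousIdeal → f ∈ Q.asHomogeneousIdeal) :
    P.asHomogeneousIdeal ≤ Q.asHomogeneousIdeal := by
  intro f hf
  change f ∈ Q.asHomogeneousIdeal.toIdeal
  rw [← DirectSum.sum_support_decompose (homogeneousSubmodule σ ℂ) f]
  refine Ideal.sum_mem _ fun i _ => h i _ ?_ (P.asHomogeneousIdeal.2 i hf)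
  exact (DirectSum.decompose (homogeneousSubmodule σ ℂ) f i).2

lemma specializes_of_homogeneous {P Q : ProjSpace σ} (h : ∀ (n : ℕ) (f : MvPolynomial σ ℂ),
    f.IsHomogeneous n → f ∈ P.asHomogeneousIdeal → f ∈ Q.asHomogeneousIdeal) : P ⤳ Q := by
  rw [specializes_iff_mem_closure]
  exact (ProjectiveSpectrum.le_iff_mem_closure _ P Q).1 (le_of_homogeneous h)

lemma HasCoords.unique {P Q : ProjSpace σ} {w : σ → ℂ} (hP : HasCoords P w) (hQ : HasCoords Q w) :
    P = Q :=
  ProjectiveSpectrum.ext (le_antisymm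
    (le_of_homogeneous fun n f hf h => (hQ.2 n f hf).2 ((hP.2 n f hf).1 h))
    (le_of_homogeneous fun n f hf h => (hP.2 n f hf).2 ((hQ.2 n f hf).1 h)))

lemma HasCoords.exists_eq_smul_of_specializes {P Q : ProjSpace σ} (hPQ : P ⤳ Q) {w w' : σ → ℂ}
    (h : HasCoords P w) (h' : HasCoords Q w') : ∃ c : ℂ, c ≠ 0 ∧ w' = c • w := by
  obtain ⟨i, hi⟩ := Function.ne_iff.1 h.1
  rw [Pi.zero_apply] at hi
  -- The linear forms `w i X j - w j X i` vanish at `P`, hence at its specialization `Q`.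
  have key (j : σ) : w i * w' j = w j * w' i := by
    have hF : (C (w i) * X j - C (w j) * X i : MvPolynomial σ ℂ).IsHomogeneous 1 :=
      (isHomogeneous_C_mul_X _ _).sub (isHomogeneous_C_mul_X _ _)
    have h1 : _ ∈ Q.asHomogeneousIdeal := (ProjectiveSpectrum.le_iff_mem_closure _ P Q).2
      (specializes_iff_mem_closure.1 hPQ) ((h.2 1 _ hF).2 (by simp [mul_comm]))
    have h2 := (h'.2 1 _ hF).1 h1
    simp only [map_sub, map_mul, eval_C, eval_X] at h2
    exact sub_eq_zero.1 h2
  have hi' : w' i ≠ 0 := fun h0 => h'.1 (funext fun j => by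
    have := key j
    rw [h0, mul_zero] at this
    exact (mul_eq_zero.1 this).resolve_left hi)
  refine ⟨w' i / w i, div_ne_zero hi' hi, funext fun j => ?_⟩
  rw [Pi.smul_apply, smul_eq_mul, div_mul_eq_mul_div, eq_div_iff hi]
  linear_combination key j

lemma HasCoords.smul {P : ProjSpace σ} {w : σ → ℂ} (h : HasCoords P w) {c : ℂ} (hc : c ≠ 0) :
    HasCoords P (c • w) := by
  refine ⟨smul_ne_zero hc h.1, fun n f hf => ?_⟩
  rw [h.2 n f hf, eval_smul_of_isHomogeneous hf, mul_eq_zero_iff_left (pow_ne_zero n hc)]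

lemma exists_hasCoords {w : σ → ℂ} (hw : w ≠ 0) : ∃ P : ProjSpace σ, HasCoords P w := by
  obtain ⟨i, hi⟩ := Function.ne_iff.1 hw
  rw [Pi.zero_apply] at hi
  have hX : (X i : MvPolynomial σ ℂ) ∈ homogeneousSubmodule σ ℂ 1 := isHomogeneous_X ℂ i
  have hu : IsUnit (aeval w (X i : MvPolynomial σ ℂ)) := by rw [aeval_X]; exact hi.isUnit
  let z : Spec (.of ℂ) := IsLocalRing.closedPoint ℂ
  let P := projChart w hX one_pos hu z
  have key {n : ℕ} {F : MvPolynomial σ ℂ} (hF : F.IsHomogeneous n) (hn : 0 < n) :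
      F ∈ P.asHomogeneousIdeal ↔ eval w F = 0 := by
    refine (mem_asHomogeneousIdeal_projChart w hX one_pos hu hF hn z).trans ?_
    refine Iff.trans (IsLocalRing.mem_maximalIdeal _) ?_
    rw [mem_nonunits_iff, isUnit_iff_ne_zero, not_not]
    rfl
  refine ⟨P, hw, fun n F hF => ?_⟩
  have h1 : X i ∉ P.asHomogeneousIdeal := by
    rw [key hX one_pos, eval_X]; exact hi
  have h2 := key (hF.mul hX) (by omega)
  rw [map_mul, eval_X, mul_eq_zero_iff_right hi] at h2
  rw [← h2]
  exact ⟨fun h => Ideal.mul_mem_right _ _ h, fun h => (P.isPrime.mem_or_mem h).resolve_right h1⟩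

end HasCoords

/-! ### The curve as a smooth plane cubic -/

section PlaneModel

open MvPolynomial

variable {C : Scheme.{0}} [IsIntegral C]

lemma IsCurve.IsValue.isValueAt {k K S σ : Type*} [Field k] [Field K] [Algebra k K]
    {v : S → Valuation K (WithZero (Multiplicative ℤ))} {hv : IsCurve k v} {N : S →₀ ℤ} {s : σ → K}
    {x : S} {t : K} {w : σ → k} (h : hv.IsValue N s x t w) (hw : w ≠ 0) : IsValueAt v s x t w :=
  ⟨hw, fun i => by rw [h.gen, lt_exp_iff]; exact h.le i⟩

/-- The curve is embedded in the plane as the smooth cubic `V(g)` by the sections `s`. -/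
structure IsPlaneModel [Algebra ℂ C.functionField]
    {v : closedPoints C → Valuation C.functionField (WithZero (Multiplicative ℤ))}
    (hv : IsCurve ℂ v) (N : closedPoints C →₀ ℤ) (s : Fin 3 → C.functionField)
    (g : MvPolynomial (Fin 3) ℂ) (φ : C ⟶ ProjSpace (Fin 3)) : Prop where
  mem : ∀ i, s i ∈ hv.sections N
  ne_zero : s 0 ≠ 0
  exists_form : ∀ n, ∀ f ∈ hv.sections (n • N), ∃ F : MvPolynomial (Fin 3) ℂ,
    F.IsHomogeneous n ∧ aeval s F = f
  isEquation : IsCurve.IsEquation ℂ s g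
  exists_pderiv_ne_zero : ∀ x t w, hv.IsValue N s x t w → ∃ i, eval w (pderiv i g) ≠ 0
  hasCoords : ∀ x t w, hv.IsValue N s x t w → HasCoords (φ x.1) w
  mem_imageSubring : ∀ (x : closedPoints C) f, v x f ≤ 1 → f ∈ imageSubring φ x.1
  exists_isValue : ∀ w : Fin 3 → ℂ, w ≠ 0 → eval w g = 0 → ∃ x t, hv.IsValue N s x t w

variable (p : C ⟶ Spec (.of ℂ)) [IsProper p] [SmoothOfRelativeDimension 1 p]

include p in
lemma isClosedImmersion_of_imageSubring {Y : Scheme.{0}} (ψ : C ⟶ Y) [UniversallyClosed ψ]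
    (h : ∀ (x : closedPoints C) f, valuationAt p x f ≤ 1 → f ∈ imageSubring ψ x.1) :
    IsClosedImmersion ψ := by
  have hC : CompactSpace C := (quasiCompact_iff_compactSpace p).1 inferInstance
  have hsep : C.IsSeparated := by
    have : IsSeparated p := inferInstance
    rw [Scheme.isSeparated_iff, ← terminal.comp_from p]
    infer_instance
  have h1 (x : closedPoints C) : Function.Surjective (ψ.stalkMap x.1) :=
    stalkMap_surjective_of_imageSubring fun a => h x _ ((valuationAt_le_one_iff p x).2 ⟨a, rfl⟩)
  refine isClosedImmersion_of_stalkMap_surjective ψ fun x => ?_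
  rcases eq_genericPoint_or_isClosed p x with rfl | hx
  · obtain ⟨y, -, hy⟩ := (isClosed_univ (X := C)).exists_closed_singleton ⟨genericPoint C, trivial⟩
    exact stalkMap_genericPoint_surjective ψ (h1 ⟨y, hy⟩)
  · exact h1 ⟨x, hx⟩

omit [IsIntegral C] in
include p in
/-- The closure of the image of the closed points. -/
lemma closure_eq_range {Y : Scheme.{0}} (ψ : C ⟶ Y) [IsClosedImmersion ψ] {S : Set Y}
    (h : ∀ x : closedPoints C, ψ x.1 ∈ S) (hS : S ⊆ Set.range ψ) : closure S = Set.range ψ := by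
  have : Smooth p := SmoothOfRelativeDimension.smooth 1 p
  have : JacobsonSpace C := LocallyOfFiniteType.jacobsonSpace p
  refine (closure_minimal hS ψ.isClosedEmbedding.isClosed_range).antisymm ?_
  rw [← Set.image_univ, ← closure_closedPoints]
  refine (image_closure_subset_closure_image ψ.continuous).trans (closure_mono ?_)
  rintro _ ⟨x, hx, rfl⟩
  exact h ⟨x, hx⟩

theorem exists_isPlaneModel (hgenus : genus p = 1) {N : closedPoints C →₀ ℤ}
    (hN : IsCurve.degree N = 3) :
    letI := functionFieldAlgebra p
    ∃ s g φ, IsPlaneModel (isCurve p) N s g φ ∧ φ ≫ ProjSpace.toSpec (Fin 3) = p ∧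
      ∃ e : C ≅ (planeCurve g).subscheme, e.hom ≫ (planeCurve g).subschemeι = φ := by
  let := functionFieldAlgebra p
  have hv := isCurve p
  have hg := isGenusOne p hgenus
  have hC : CompactSpace C := (quasiCompact_iff_compactSpace p).1 inferInstance
  obtain ⟨P, P', s, g, hs, he⟩ := hv.exists_equation hg hN
  obtain ⟨φ, hφ, hφη, hφx⟩ := exists_projMap p (s := s) (i₀ := 0) hs.ne_zero
  have hpd x t w (h : hv.IsValue N s x t w) : ∃ i, eval w (pderiv i g) ≠ 0 :=
    hs.exists_pderiv_ne_zero hg hN he h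
  have hw0 x t w (h : hv.IsValue N s x t w) : w ≠ 0 := by
    rintro rfl
    obtain ⟨i, hi⟩ := hpd x t _ h
    exact hi (eval_zero_of_isHomogeneous (he.isHomogeneous.pderiv (i := i)) two_ne_zero)
  have hval (x : closedPoints C) : ∃ t w, hv.IsValue N s x t w := by
    obtain ⟨t, ht⟩ := hv.exists_zpow x (N x)
    obtain ⟨w, hw⟩ := hv.exists_isValue ht hs.mem
    exact ⟨t, w, hw⟩
  have hcoords x t w (h : hv.IsValue N s x t w) := hφx x t w (h.isValueAt (hw0 x t w h))
  have hloc (x : closedPoints C) (f : C.functionField) (hf : valuationAt p x f ≤ 1) :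
      f ∈ imageSubring φ x.1 := by
    obtain ⟨t, w, hw⟩ := hval x
    obtain ⟨n, A, B, hA, hB, hB0, hAB⟩ := hs.exists_quotient hg hN hf hw
    have h1 := (hcoords x t w hw).2 n A B hA hB hB0
    have h2 : aeval s B ≠ 0 := fun h0 => hB0 (hw.eval_eq_zero hB h0)
    rwa [← hAB, mul_div_cancel_right₀ _ h2] at h1
  have : UniversallyClosed φ := by
    have : UniversallyClosed (φ ≫ ProjSpace.toSpec (Fin 3)) := hφ ▸ inferInstance
    exact .of_comp_of_isSeparated φ (ProjSpace.toSpec (Fin 3))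
  have hcl := isClosedImmersion_of_imageSubring p φ hloc
  have hrange : planeCurvePoints g ⊆ Set.range φ := by
    rintro Q ⟨w, hQ, hw⟩
    -- A form that vanishes at the image of the generic point is a relation between the sections,
    -- hence a multiple of `g`, and so vanishes at `Q`. The factor `X i` only makes the degree
    -- positive. As the image is closed, it contains `Q`.
    have : φ (genericPoint C) ⤳ Q := by
      refine specializes_of_homogeneous fun n F hF h => ?_
      rw [hQ.2 n F hF]
      obtain ⟨i, hi⟩ := Function.ne_iff.1 hQ.1
      have hX := isHomogeneous_X ℂ i
      have h1 : F * X i ∈ (φ (genericPoint C)).asHomogeneousIdeal := Ideal.mul_mem_right _ _ h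
      have hu : IsUnit (aeval s (X 0 : MvPolynomial (Fin 3) ℂ)) := by
        rw [aeval_X]; exact hs.ne_zero.isUnit
      let z : Spec (.of C.functionField) := IsLocalRing.closedPoint C.functionField
      have h2 : φ (genericPoint C) = projChart s (isHomogeneous_X ℂ 0) one_pos hu z := by
        refine Eq.trans ?_ congr($hφη z)
        exact congr(φ $(Scheme.fromSpecStalk_closedPoint)).symm
      rw [h2] at h1
      have h3 := (mem_asHomogeneousIdeal_projChart s (isHomogeneous_X ℂ 0) one_pos hu
        (hF.mul hX) (by omega) z).1 h1
      have h4 : aeval s (F * X i) = 0 := by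
        by_contra h0
        exact (IsLocalRing.mem_maximalIdeal _).1 h3 (isUnit_iff_ne_zero.2 h0)
      obtain ⟨G, hG⟩ := he.dvd (n + 1) _ (hF.mul hX) h4
      have h5 := congr(eval w $hG)
      rw [map_mul, map_mul, hw, zero_mul, eval_X] at h5
      exact (mul_eq_zero.1 h5).resolve_right hi
    exact hcl.isClosedEmbedding.isClosed_range.stableUnderSpecialization this ⟨_, rfl⟩
  have hS := closure_eq_range p φ (S := planeCurvePoints g) (fun x => by
    obtain ⟨t, w, hw⟩ := hval x
    exact ⟨w, (hcoords x t w hw).1, hw.eval_eq_zero he.isHomogeneous he.aeval_eq_zero⟩) hrange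
  refine ⟨s, g, φ, ⟨hs.mem, hs.ne_zero, fun n f hf => hs.exists_form hg n hf, he, hpd,
    fun x t w h => (hcoords x t w h).1, hloc, fun w hw hgw => ?_⟩, hφ,
    exists_iso_reducedClosure φ hS⟩
  obtain ⟨Q, hQ⟩ := exists_hasCoords hw
  obtain ⟨y, rfl⟩ := hrange ⟨w, hQ, hgw⟩
  -- The preimage `y` is replaced by a closed point of its closure. Its coordinates are proportional
  -- to `w`, and the factor is absorbed in the generator `t`.
  obtain ⟨x, hx, hxc⟩ := (isClosed_closure (s := {y})).exists_closed_singleton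
    ⟨y, subset_closure rfl⟩
  obtain ⟨t, w', hw'⟩ := hval ⟨x, hxc⟩
  obtain ⟨c, hc, rfl⟩ := hQ.exists_eq_smul_of_specializes
    ((specializes_iff_mem_closure.2 hx).map φ.continuous) (hcoords _ t w' hw').1
  refine ⟨⟨x, hxc⟩, c • t, by rw [hv.map_smul _ hc, hw'.gen], fun i => ?_⟩
  convert hw'.le i using 3
  rw [Pi.smul_apply, smul_eq_mul, map_mul, Algebra.smul_def]
  ring

end PlaneModel

/-! ### Function fields of coverings -/

section FunctionFieldMap

variable {C' C : Scheme.{0}} [IsIntegral C'] [IsIntegral C] {π : C' ⟶ C}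
  {ι : C.functionField ⟶ C'.functionField}

variable (π ι) in
/-- The homomorphism `ι` of function fields is induced by the morphism `π`. -/
def IsInducedBy : Prop :=
  C'.fromSpecStalk (genericPoint C') ≫ π = Spec.map ι ≫ C.fromSpecStalk (genericPoint C)

lemma exists_isInducedBy (π : C' ⟶ C) [IsDominant π] :
    ∃ ι : C.functionField ⟶ C'.functionField, IsInducedBy π ι := by
  have h : π (genericPoint C') ⤳ genericPoint C := by
    have h1 := (genericPoint_spec C').image π.continuous
    rw [Set.image_univ, π.denseRange.closure_eq] at h1
    exact h1.specializes trivial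
  refine ⟨C.presheaf.stalkSpecializes h ≫ π.stalkMap (genericPoint C'), ?_⟩
  rw [IsInducedBy, Spec.map_comp, Category.assoc, Scheme.SpecMap_stalkSpecializes_fromSpecStalk,
    Scheme.SpecMap_stalkMap_fromSpecStalk]

variable (h : IsInducedBy π ι)
include h

/-- Both sides describe the map from the generic point of the cover to `C`, which factors through
the monomorphism from the spectrum of the local ring at `π x`. -/
lemma IsInducedBy.algebraMap_stalkMap (x : C') (a : C.presheaf.stalk (π x)) :
    algebraMap (C'.presheaf.stalk x) C'.functionField (π.stalkMap x a) =
      ι (algebraMap (C.presheaf.stalk (π x)) C.functionField a) := by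
  have h1 : Spec.map (π.stalkMap x ≫ C'.presheaf.stalkSpecializes (genericPoint_specializes x)) ≫
      C.fromSpecStalk (π x) = Spec.map (C.presheaf.stalkSpecializes (genericPoint_specializes (π x))
        ≫ ι) ≫ C.fromSpecStalk (π x) := by
    rw [Spec.map_comp, Spec.map_comp, Category.assoc, Category.assoc,
      Scheme.SpecMap_stalkSpecializes_fromSpecStalk, Scheme.SpecMap_stalkMap_fromSpecStalk, ← h,
      Scheme.SpecMap_stalkSpecializes_fromSpecStalk_assoc]
  rw [cancel_mono, Spec.map_inj] at h1
  exact congr($h1 a)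

lemma IsInducedBy.map_mem_imageSubring {Y : Scheme.{0}} (φ : C ⟶ Y) (x : C') {f : C.functionField}
    (hf : f ∈ imageSubring φ (π x)) : ι f ∈ imageSubring (π ≫ φ) x := by
  obtain ⟨a, rfl⟩ := hf
  have h1 := congr(algebraMap (C'.presheaf.stalk x) C'.functionField
    ($(Scheme.Hom.stalkMap_comp π φ x) a))
  exact ⟨a, h1.trans (h.algebraMap_stalkMap x _)⟩

lemma IsInducedBy.map_algebraMap (p : C ⟶ Spec (.of ℂ)) (c : ℂ) :
    letI := functionFieldAlgebra p
    letI := functionFieldAlgebra (π ≫ p)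
    ι (algebraMap ℂ C.functionField c) = algebraMap ℂ C'.functionField c := by
  have h1 := congr($h ≫ p)
  rw [Category.assoc, fromSpecStalk_comp, Category.assoc, fromSpecStalk_comp, ← Spec.map_comp,
    Spec.map_inj] at h1
  exact congr($h1 c).symm

variable {p : C ⟶ Spec (.of ℂ)} [SmoothOfRelativeDimension 1 p]
  [SmoothOfRelativeDimension 1 (π ≫ p)]

lemma IsInducedBy.valuationAt_le_one {x' : closedPoints C'} {x : closedPoints C} (hx : π x'.1 = x.1)
    {f : C.functionField} (hf : valuationAt p x f ≤ 1) : valuationAt (π ≫ p) x' (ι f) ≤ 1 := by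
  obtain ⟨x, hx'⟩ := x
  subst hx
  obtain ⟨a, rfl⟩ := (valuationAt_le_one_iff p _).1 hf
  rw [← h.algebraMap_stalkMap]
  exact (valuationAt_le_one_iff (π ≫ p) x').2 ⟨_, rfl⟩

lemma IsInducedBy.valuationAt_lt_one {x' : closedPoints C'} {x : closedPoints C} (hx : π x'.1 = x.1)
    {f : C.functionField} (hf : valuationAt p x f < 1) : valuationAt (π ≫ p) x' (ι f) < 1 := by
  obtain ⟨x, hx'⟩ := x
  subst hx
  obtain ⟨a, rfl⟩ := (valuationAt_le_one_iff p _).1 hf.le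
  rw [← h.algebraMap_stalkMap]
  refine (valuationAt_lt_one_iff (π ≫ p) x').2 ?_
  have ha := (valuationAt_lt_one_iff p _).1 hf
  rw [IsLocalRing.mem_maximalIdeal] at ha ⊢
  exact fun hu => ha (isUnit_of_map_unit (π.stalkMap x'.1).hom a hu)

omit [SmoothOfRelativeDimension 1 p] [SmoothOfRelativeDimension 1 (π ≫ p)] in
/-- The degree of the extension of function fields. -/
lemma IsInducedBy.finrank_eq [IsFinite π] [Flat π] [IsDominant π] {d : ℕ}
    (hd : ∀ y, π.finrank y = d) :
    letI := ι.hom.toAlgebra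
    Module.finrank C.functionField C'.functionField = d := by
  obtain ⟨U, hU, hx, -⟩ := exists_isAffineOpen_mem_and_subset
    (x := π (genericPoint C')) (U := ⊤) trivial
  have hV : IsAffineOpen (π ⁻¹ᵁ U) := hU.preimage π
  have hx' : genericPoint C' ∈ π ⁻¹ᵁ U := hx
  have : Nonempty U := ⟨⟨_, hx⟩⟩
  have : Nonempty (π ⁻¹ᵁ U : C'.Opens) := ⟨⟨_, hx'⟩⟩
  have := functionField_isFractionRing_of_isAffineOpen C U hU
  have := functionField_isFractionRing_of_isAffineOpen C' _ hV
  let g := π.appLE U (π ⁻¹ᵁ U) le_rfl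
  have hpb : IsPullback hV.fromSpec (Spec.map g) π hU.fromSpec := by
    refine (IsOpenImmersion.isPullback _ _ _ _ (hU.SpecMap_appLE_fromSpec π hV le_rfl).symm ?_).flip
    rw [hU.opensRange_fromSpec, hV.opensRange_fromSpec]
  let : Algebra Γ(C, U) Γ(C', π ⁻¹ᵁ U) := g.hom.toAlgebra
  have hfin : Module.Finite Γ(C, U) Γ(C', π ⁻¹ᵁ U) := by
    have := π.finite_app U hU
    rw [← Scheme.Hom.appLE_eq_app] at this
    exact this
  have hflat : Module.Flat Γ(C, U) Γ(C', π ⁻¹ᵁ U) := π.flat_appLE hU hV le_rfl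
  -- The rank of the finite flat algebra is read off at the zero prime, where the fibre is the
  -- extension of fraction fields.
  have h1 := Scheme.Hom.finrank_of_isPullback _ _ _ _ hpb ⟨⊥, Ideal.isPrime_bot⟩
  rw [hd] at h1
  have h2 := (Scheme.Hom.finrank_SpecMap_algebraMap Γ(C, U) Γ(C', π ⁻¹ᵁ U)
    ⟨⊥, Ideal.isPrime_bot⟩).symm.trans h1
  rw [Module.rankAtStalk_eq, Ideal.finrank_fiber_eq_finrank] at h2
  let := ι.hom.toAlgebra
  let : Algebra Γ(C, U) C'.functionField :=
    ((algebraMap Γ(C', π ⁻¹ᵁ U) C'.functionField).comp g.hom).toAlgebra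
  have : IsScalarTower Γ(C, U) Γ(C', π ⁻¹ᵁ U) C'.functionField := .of_algebraMap_eq fun _ => rfl
  have : IsScalarTower Γ(C, U) C.functionField C'.functionField := .of_algebraMap_eq fun r => by
    have h3 := h.algebraMap_stalkMap (genericPoint C') (C.presheaf.germ U _ hx r)
    rw [Scheme.Hom.germ_stalkMap_apply, Scheme.algebraMap_germ_eq_germToFunctionField,
      ← Scheme.Hom.appLE_eq_app] at h3
    exact ((Scheme.algebraMap_germ_eq_germToFunctionField _ hx' _).symm.trans h3)
  rw [← h2]
  exact IsFractionRing.finrank_eq Γ(C, U) C.functionField Γ(C', π ⁻¹ᵁ U) C'.functionField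

end FunctionFieldMap

/-! ### Valuations in a quadratic extension -/

section QuadraticExtension

open WithZero

variable {k K K' S S' : Type*} [Field k] [Field K] [Field K'] [Algebra k K] [Algebra k K']
  [Algebra K K'] [IsScalarTower k K K'] {v : S → Valuation K ℤᵐ⁰} {v' : S' → Valuation K' ℤᵐ⁰}
  {x : S} {x' : S'}

/-- The local ring of `x'` dominates the local ring of `x`. -/
structure LiesOver (v : S → Valuation K ℤᵐ⁰) (v' : S' → Valuation K' ℤᵐ⁰) (x : S) (x' : S') :
    Prop where
  le_one : ∀ f, v x f ≤ 1 → v' x' (algebraMap K K' f) ≤ 1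
  lt_one : ∀ f, v x f < 1 → v' x' (algebraMap K K' f) < 1

namespace LiesOver

variable (h : LiesOver v v' x x')
include h

lemma le_one_iff (f : K) : v' x' (algebraMap K K' f) ≤ 1 ↔ v x f ≤ 1 := by
  refine ⟨fun h1 => ?_, h.le_one f⟩
  by_contra! h2
  have h3 := h.lt_one f⁻¹ (by rw [map_inv₀]; exact inv_lt_one_of_one_lt₀ h2)
  rw [map_inv₀, map_inv₀] at h3
  have hf : f ≠ 0 := by rintro rfl; simp at h2
  exact h3.not_ge ((one_le_inv₀ (zero_lt_iff.2 (by simpa using hf))).2 h1)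

lemma lt_one_iff (f : K) : v' x' (algebraMap K K' f) < 1 ↔ v x f < 1 := by
  refine ⟨fun h1 => ?_, h.lt_one f⟩
  by_contra! h2
  have hf : f ≠ 0 := by rintro rfl; simp at h2
  have h3 := h.le_one f⁻¹ (by rw [map_inv₀]; exact inv_le_one_of_one_le₀ h2)
  rw [map_inv₀, map_inv₀] at h3
  exact h3.not_gt ((one_lt_inv₀ (zero_lt_iff.2 (by simpa using hf))).2 h1)

lemma le_iff (f g : K) : v' x' (algebraMap K K' f) ≤ v' x' (algebraMap K K' g) ↔ v x f ≤ v x g := by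
  rcases eq_or_ne g 0 with rfl | hg
  · simp
  rw [← div_le_one₀ (zero_lt_iff.2 (by simpa using hg)), ← map_div₀, ← map_div₀, h.le_one_iff,
    map_div₀, div_le_one₀ (zero_lt_iff.2 (by simpa using hg))]

lemma eq_iff (f g : K) : v' x' (algebraMap K K' f) = v' x' (algebraMap K K' g) ↔ v x f = v x g := by
  rw [le_antisymm_iff, le_antisymm_iff, h.le_iff, h.le_iff]

/-- The value of a square root of a unit. -/
lemma exists_sqrt_value [IsAlgClosed k] (hv : IsCurve k v) {z : K'} {u : K}
    (hz : z ^ 2 = algebraMap K K' u) (hu : v x u = 1) :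
    ∃ d : k, d ≠ 0 ∧ v' x' (z - algebraMap k K' d) < 1 := by
  obtain ⟨c, hc⟩ := hv.residue x u hu.le
  obtain ⟨d, rfl⟩ := IsAlgClosed.exists_pow_nat_eq c two_pos
  have hd : d ≠ 0 := by
    rintro rfl
    rw [zero_pow two_ne_zero, map_zero, sub_zero, hu] at hc
    exact hc.false
  have h1 := h.lt_one _ hc
  -- `u - d²` has positive order upstairs and factors as `(z - d)(z + d)`, so one of the two factors
  -- has positive order.
  have h2 : algebraMap K K' (u - algebraMap k K (d ^ 2)) =
      (z - algebraMap k K' d) * (z - algebraMap k K' (-d)) := by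
    rw [map_sub, ← hz, ← IsScalarTower.algebraMap_apply, map_pow, map_neg]
    ring
  rw [h2, map_mul] at h1
  by_contra! h3
  exact h1.not_ge (one_le_mul (h3 d hd) (h3 (-d) (neg_ne_zero.2 hd)))

/-- Over a point where the discriminant is a unit, the elements of a quadratic extension differ
from elements of the base by units. -/
lemma exists_unit_of_even [IsAlgClosed k] [NeZero (2 : k)] (hv : IsCurve k v) (hv' : IsCurve k v')
    {z : K'} {u : K} (hz : z ^ 2 = algebraMap K K' u) (hu : v x u = 1)
    (hspan : ∀ f : K', ∃ a b : K, f = algebraMap K K' a + algebraMap K K' b * z) {f : K'}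
    (hf : f ≠ 0) : ∃ r a b : K, v x a ≤ 1 ∧ v x b ≤ 1 ∧
      v' x' (algebraMap K K' a + algebraMap K K' b * z) = 1 ∧
      (f = algebraMap K K' r * (algebraMap K K' a + algebraMap K K' b * z) ∨
        f = algebraMap K K' r * (algebraMap K K' a + algebraMap K K' b * z)⁻¹) := by
  obtain ⟨d, hd, hzd⟩ := h.exists_sqrt_value (x' := x') hv hz hu
  have hz1 : v' x' z ≤ 1 := by
    rw [← sub_add_cancel z (algebraMap k K' d)]
    exact (v' x').map_add_le hzd.le (hv'.const_le _ _)
  -- Factor out the coefficient of larger valuation.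
  obtain ⟨r, a, b, ha, hb, hab, rfl⟩ : ∃ r a b : K, v x a ≤ 1 ∧ v x b ≤ 1 ∧ (v x a = 1 ∨ v x b = 1)
      ∧ f = algebraMap K K' r * (algebraMap K K' a + algebraMap K K' b * z) := by
    obtain ⟨a, b, rfl⟩ := hspan f
    rcases le_total (v x a) (v x b) with hab | hab
    · have hb : b ≠ 0 := by
        rintro rfl
        rw [map_zero, le_zero_iff, map_eq_zero] at hab
        exact hf (by simp [hab])
      have hb' := (v x).ne_zero_iff.2 hb
      refine ⟨b, a / b, 1, ?_, by simp, by simp, ?_⟩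
      · rw [map_div₀]; exact div_le_one_of_le₀ hab zero_le
      · rw [mul_add, ← map_mul, mul_div_cancel₀ _ hb, map_one, one_mul]
    · have ha : a ≠ 0 := by
        rintro rfl
        rw [map_zero, le_zero_iff, map_eq_zero] at hab
        exact hf (by simp [hab])
      refine ⟨a, 1, b / a, by simp, ?_, by simp, ?_⟩
      · rw [map_div₀]; exact div_le_one_of_le₀ hab zero_le
      · rw [mul_add, ← mul_assoc, map_one, mul_one, ← map_mul, mul_div_cancel₀ _ ha]
  obtain ⟨α, hα⟩ := hv.residue x a ha
  obtain ⟨β, hβ⟩ := hv.residue x b hb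
  have hval (ε : k) (hε : ε = 1 ∨ ε = -1) (h0 : α + ε * β * d ≠ 0) :
      v' x' (algebraMap K K' a + algebraMap K K' (algebraMap k K ε * b) * z) = 1 := by
    rw [← hv'.const x' _ h0]
    refine Valuation.map_eq_of_sub_lt _ ?_
    rw [hv'.const x' _ h0]
    have e : algebraMap K K' a + algebraMap K K' (algebraMap k K ε * b) * z -
        algebraMap k K' (α + ε * β * d) = algebraMap K K' (a - algebraMap k K α) +
        (algebraMap k K' ε * (algebraMap K K' (b - algebraMap k K β) * z) +
        algebraMap k K' (ε * β) * (z - algebraMap k K' d)) := by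
      simp only [map_add, map_sub, map_mul, ← IsScalarTower.algebraMap_apply]
      ring
    rw [e]
    refine (v' x').map_add_lt (h.lt_one _ hα) ((v' x').map_add_lt ?_ ?_)
    · rw [map_mul, map_mul]
      exact (mul_le_of_le_one_left' (hv'.const_le _ _)).trans_lt
        ((mul_le_of_le_one_right' hz1).trans_lt (h.lt_one _ hβ))
    · rw [map_mul]
      exact (mul_le_of_le_one_left' (hv'.const_le _ _)).trans_lt hzd
  -- The residues of `a + bz` and of its conjugate `a - bz` are `α + βd` and `α - βd`; they cannot
  -- both vanish since `α` and `β` are not both zero. In the first case the conjugate is a unit and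
  -- `a + bz` is the norm `a² - b²u` divided by it.
  by_cases h0 : α + 1 * β * d = 0
  · have h1 : α + -1 * β * d ≠ 0 := by
      intro h1
      have h2 : β = 0 := by
        have : 2 * (β * d) = 0 := by linear_combination h0 - h1
        exact (mul_eq_zero.1 ((mul_eq_zero.1 this).resolve_left two_ne_zero)).resolve_right hd
      have h3 : α = 0 := by rw [h2] at h0; simpa using h0
      rw [h3, map_zero, sub_zero] at hα
      rw [h2, map_zero, sub_zero] at hβ
      exact hab.elim hα.ne hβ.ne
    have h2 := hval (-1) (.inr rfl) h1
    refine ⟨r * (a ^ 2 - b ^ 2 * u), a, algebraMap k K (-1) * b, ha, ?_, h2, .inr ?_⟩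
    · rw [map_mul]; exact mul_le_one' (hv.const_le _ _) hb
    · have h3 : algebraMap K K' a + algebraMap K K' (algebraMap k K (-1) * b) * z ≠ 0 := by
        intro h3
        rw [h3, map_zero] at h2
        exact zero_ne_one h2
      rw [eq_mul_inv_iff_mul_eq₀ h3]
      simp only [map_mul, map_sub, map_pow, ← hz, map_neg, map_one]
      ring
  · have h2 := hval 1 (.inl rfl) h0
    rw [map_one, one_mul] at h2
    exact ⟨r, a, b, ha, hb, h2, .inl rfl⟩

/-- Over a point where the discriminant is a uniformizer, the regular elements of a quadratic
extension have regular coefficients. -/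
lemma le_one_of_odd {z : K'} {u : K} (hz : z ^ 2 = algebraMap K K' u) (hu : v x u = exp (-1))
    {a b : K} (hab : v' x' (algebraMap K K' a + algebraMap K K' b * z) ≤ 1) :
    v x a ≤ 1 ∧ v x b ≤ 1 := by
  have hbz : v' x' (algebraMap K K' b * z) ^ 2 = v' x' (algebraMap K K' (b ^ 2 * u)) := by
    rw [← map_pow, mul_pow, hz, ← map_pow, ← map_mul]
  have hb2 : v x (b ^ 2 * u) = v x b ^ 2 * exp (-1) := by rw [map_mul, map_pow, hu]
  have h1 : v' x' (algebraMap K K' b * z) ≤ 1 → v x b ≤ 1 := fun h1 => by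
    have h2 : v' x' (algebraMap K K' (b ^ 2 * u)) ≤ 1 := hbz ▸ pow_le_one₀ zero_le h1
    rw [h.le_one_iff, hb2] at h2
    rcases eq_or_ne (v x b) 0 with h3 | h3
    · rw [h3]; exact zero_le
    obtain ⟨n, hn⟩ := exists_exp_eq h3
    rw [hn, ← exp_nsmul, ← exp_add, ← exp_zero, exp_le_exp] at h2
    rw [hn, ← exp_zero, exp_le_exp]
    simp at h2
    omega
  -- The orders of `a²` and `b²u` have different parity, so no cancellation occurs between `a` and
  -- `bz`.
  have hne : v' x' (algebraMap K K' a) ≠ v' x' (algebraMap K K' b * z) ∨ a = 0 := by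
    by_contra! hcon
    have h2 : v' x' (algebraMap K K' (a ^ 2)) = v' x' (algebraMap K K' (b ^ 2 * u)) := by
      rw [← hbz, map_pow, map_pow, hcon.1]
    rw [h.eq_iff, hb2, map_pow] at h2
    obtain ⟨m, hm⟩ := exists_exp_eq ((v x).ne_zero_iff.2 hcon.2)
    rcases eq_or_ne (v x b) 0 with h3 | h3
    · rw [hm, h3, zero_pow two_ne_zero, zero_mul] at h2
      exact pow_ne_zero 2 exp_ne_zero h2
    obtain ⟨n, hn⟩ := exists_exp_eq h3
    rw [hm, hn, ← exp_nsmul, ← exp_nsmul, ← exp_add, exp_inj] at h2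
    simp at h2
    omega
  rcases hne with hne | rfl
  · rw [(v' x').map_add_of_distinct_val hne, max_le_iff] at hab
    exact ⟨(h.le_one_iff a).1 hab.1, h1 hab.2⟩
  · rw [map_zero, zero_add] at hab
    exact ⟨by simp, h1 hab⟩

/-- Over a point where the discriminant is a uniformizer, a uniformizer of the base is not a
uniformizer of the extension. -/
lemma ne_exp_of_odd {z : K'} {u : K} (hz : z ^ 2 = algebraMap K K' u) (hu : v x u = exp (-1))
    {t : K} (ht : v x t = exp (-1)) : v' x' (algebraMap K K' t) ≠ exp (-1) := by
  -- Upstairs `t` has the same order as `u = z²`, which is even.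
  rw [(h.eq_iff t u).2 (ht.trans hu.symm), ← hz, map_pow]
  intro h1
  rcases eq_or_ne (v' x' z) 0 with h3 | h3
  · rw [h3, zero_pow two_ne_zero] at h1
    exact exp_ne_zero h1.symm
  obtain ⟨n, hn⟩ := exists_exp_eq h3
  rw [hn, ← exp_nsmul, exp_inj] at h1
  simp at h1
  omega

end LiesOver

end QuadraticExtension

/-! ### Square root generators and half divisors -/

section Quadratic

lemma exists_sqrt_generator {K K' : Type*} [Field K] [Field K'] [Algebra K K'] [CharZero K]
    (h : Module.finrank K K' = 2) : ∃ (y : K') (f : K), y ^ 2 = algebraMap K K' f ∧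
      (∀ g : K', ∃ a b : K, g = algebraMap K K' a + algebraMap K K' b * y) ∧
      (∀ c, c ^ 2 ≠ f) ∧ ∃ σ : K' ≃ₐ[K] K', σ y = -y := by
  have hq : Algebra.IsQuadraticExtension K K' := ⟨h⟩
  have hfin : FiniteDimensional K K' := FiniteDimensional.of_finrank_pos (by omega)
  obtain ⟨θ, hθ⟩ : ∃ θ : K', θ ∉ Set.range (algebraMap K K') := by
    by_contra! hcon
    have := finrank_eq_one_iff_of_nonzero' (K := K) (1 : K') one_ne_zero
    have h1 := this.2 fun w => by
      obtain ⟨c, hc⟩ := hcon w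
      exact ⟨c, by rw [← hc, Algebra.smul_def, mul_one]⟩
    omega
  have hspan (y : K') (hy : y ∉ Set.range (algebraMap K K')) (g : K') :
      ∃ a b : K, g = algebraMap K K' a + algebraMap K K' b * y := by
    have hli : LinearIndependent K ![1, y] := by
      rw [LinearIndependent.pair_iff' one_ne_zero]
      intro a ha
      exact hy ⟨a, by rw [← ha, Algebra.smul_def, mul_one]⟩
    have h1 := hli.span_eq_top_of_card_eq_finrank' (by simp [h])
    have h2 : g ∈ Submodule.span K (Set.range ![1, y]) := h1 ▸ Submodule.mem_top
    rw [Matrix.range_cons, Matrix.range_cons, Matrix.range_empty, Set.union_empty,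
      Set.singleton_union, Submodule.mem_span_pair] at h2
    obtain ⟨a, b, rfl⟩ := h2
    exact ⟨a, b, by rw [Algebra.smul_def, Algebra.smul_def, mul_one]⟩
  obtain ⟨a, b, hab⟩ := hspan θ hθ (θ ^ 2)
  have hy : θ - algebraMap K K' (b / 2) ∉ Set.range (algebraMap K K') := by
    rintro ⟨c, hc⟩
    exact hθ ⟨c + b / 2, by rw [map_add, hc, sub_add_cancel]⟩
  -- Completing the square in `θ² = a + bθ`.
  set y := θ - algebraMap K K' (b / 2) with hyd
  have h2 : y ^ 2 = algebraMap K K' (a + (b / 2) ^ 2) := by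
    have hb : algebraMap K K' b = 2 * algebraMap K K' (b / 2) := by
      rw [← map_ofNat (algebraMap K K') 2, ← map_mul, mul_div_cancel₀ _ two_ne_zero]
    rw [hyd, map_add, map_pow]
    rw [hb] at hab
    linear_combination hab
  refine ⟨y, _, h2, hspan y hy, fun c hc => ?_, ?_⟩
  · rw [← hc, map_pow, sq_eq_sq_iff_eq_or_eq_neg] at h2
    rcases h2 with h2 | h2
    · exact hy ⟨c, h2.symm⟩
    · exact hy ⟨-c, by rw [map_neg, h2]⟩
  -- A quadratic extension in characteristic zero is Galois, so some automorphism moves `y`,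
  -- necessarily to the other root of `y²`.
  · have h3 : y ∉ (⊥ : IntermediateField K K') := by rwa [IntermediateField.mem_bot]
    rw [IsGalois.mem_bot_iff_fixed] at h3
    push Not at h3
    obtain ⟨σ, hσ⟩ := h3
    refine ⟨σ, ?_⟩
    have h4 : σ y ^ 2 = y ^ 2 := by rw [← map_pow, h2, σ.commutes]
    exact (sq_eq_sq_iff_eq_or_eq_neg.1 h4).resolve_left hσ

open WithZero in
/-- Half of the divisor of a function, rounded up. -/
lemma IsCurve.exists_half_div {k K S : Type*} [Field k] [Field K] [Algebra k K]
    {v : S → Valuation K ℤᵐ⁰} (hv : IsCurve k v) (hg : IsGenusOne k v) {f : K} (hf : f ≠ 0) {n : ℕ}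
    (hodd : {x | Odd (hv.div f x)}.encard = (2 * n : ℕ)) : ∃ N : S →₀ ℤ, degree N = n ∧
      ∀ x, v x f = exp (2 * N x) ∨ v x f = exp (2 * N x - 1) := by
  classical
  have hfin : {x | Odd (hv.div f x)}.Finite := Set.finite_of_encard_eq_coe hodd
  have hcard : hfin.toFinset.card = 2 * n := by
    rw [hfin.encard_eq_coe_toFinset_card] at hodd
    exact_mod_cast hodd
  let N : S →₀ ℤ := (-hv.div f).mapRange (fun m => (m + 1) / 2) (by norm_num)
  let B : S →₀ ℤ := ∑ x ∈ hfin.toFinset, Finsupp.single x 1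
  have hB (x : S) : B x = if Odd (hv.div f x) then 1 else 0 := by
    rw [Finsupp.finsetSum_apply]
    simp only [Finsupp.single_apply]
    rw [Finset.sum_ite_eq']
    simp
  have hN (x : S) : N x = (-hv.div f x + 1) / 2 := by simp [N]
  -- `B` is the sum of the points of odd order. Since `div f` has degree zero, `deg N` is half the
  -- number of these points.
  have key : N + N = B - hv.div f := by
    ext x
    rw [Finsupp.add_apply, Finsupp.sub_apply, hB, hN]
    split_ifs with h
    · obtain ⟨m, hm⟩ := h; omega
    · rw [Int.not_odd_iff_even] at h; obtain ⟨m, hm⟩ := h; omega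
  refine ⟨N, ?_, fun x => ?_⟩
  · have h1 := congr(degree $key)
    rw [map_sub, map_add, hv.degree_div hg hf, map_sum] at h1
    simp only [degree_single, Finset.sum_const, hcard] at h1
    simp at h1
    omega
  · rw [hv.exp_div hf, exp_inj, exp_inj, hN]
    omega

end Quadratic

/-! ### Ramification in terms of valuations -/

section Ramification

open WithZero

variable {C' C : Scheme.{0}} [IsIntegral C'] [IsIntegral C] {π : C' ⟶ C}
  {ι : C.functionField ⟶ C'.functionField} (h : IsInducedBy π ι) {p : C ⟶ Spec (.of ℂ)}
  [SmoothOfRelativeDimension 1 p] [SmoothOfRelativeDimension 1 (π ≫ p)]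
include h

lemma IsInducedBy.liesOver {x' : closedPoints C'} {x : closedPoints C} (hx : π x'.1 = x.1) :
    letI := ι.hom.toAlgebra
    LiesOver (valuationAt p) (valuationAt (π ≫ p)) x x' :=
  letI := ι.hom.toAlgebra
  ⟨fun _ hf => h.valuationAt_le_one hx hf, fun _ hf => h.valuationAt_lt_one hx hf⟩

/-- If every function upstairs is a function from below times a unit, then elements of the maximal
ideal upstairs are elements of the maximal ideal below times units. -/
lemma IsInducedBy.notMem_ramificationPoints (x' : closedPoints C') (hx : IsClosed {π x'.1})
    (H : ∀ g : C'.functionField, g ≠ 0 →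
      ∃ r w, g = ι r * w ∧ valuationAt (π ≫ p) x' w = 1) : x'.1 ∉ ramificationPoints π := by
  rw [ramificationPoints, Set.mem_ofPred, not_not]
  let := ι.hom.toAlgebra
  have hl := h.liesOver (p := p) (x' := x') (x := ⟨_, hx⟩) rfl
  refine le_antisymm (Ideal.map_le_iff_le_comap.2 fun a ha => ?_) fun c hc => ?_
  · rw [Ideal.mem_comap, IsLocalRing.mem_maximalIdeal]
    exact fun hu => (IsLocalRing.mem_maximalIdeal _).1 ha
      (isUnit_of_map_unit (π.stalkMap x'.1).hom a hu)
  rcases eq_or_ne c 0 with rfl | hc0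
  · exact zero_mem _
  obtain ⟨r, w, hr, hw⟩ := H (algebraMap _ _ c)
    ((map_ne_zero_iff _ (IsFractionRing.injective (C'.presheaf.stalk x'.1) C'.functionField)).2 hc0)
  have h1 := (valuationAt_lt_one_iff (π ≫ p) x').2 hc
  rw [hr, map_mul, hw, mul_one] at h1
  have h2 := (hl.lt_one_iff r).1 h1
  obtain ⟨a, rfl⟩ := (valuationAt_le_one_iff p _).1 h2.le
  obtain ⟨b, rfl⟩ := (valuationAt_le_one_iff (π ≫ p) _).1 hw.le
  have h3 : algebraMap (C'.presheaf.stalk x'.1) C'.functionField c =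
      algebraMap (C'.presheaf.stalk x'.1) C'.functionField (π.stalkMap x'.1 a * b) := by
    rw [hr, map_mul, h.algebraMap_stalkMap]
  have h4 := IsFractionRing.injective (C'.presheaf.stalk x'.1) C'.functionField h3
  have h5 : a ∈ IsLocalRing.maximalIdeal (C.presheaf.stalk (π x'.1)) :=
    (valuationAt_lt_one_iff p ⟨_, hx⟩).1 h2
  subst h4
  exact Ideal.mul_mem_right _ _ (Ideal.mem_map_of_mem (π.stalkMap x'.1).hom h5)

/-- If the maximal ideal from below generated the one upstairs, no element of the latter would have
larger valuation than a uniformizer `t` from below, so `t` would stay a uniformizer. -/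
lemma IsInducedBy.mem_ramificationPoints (x' : closedPoints C') (hx : IsClosed {π x'.1})
    (H : ∀ t, valuationAt p ⟨_, hx⟩ t = exp (-1) → valuationAt (π ≫ p) x' (ι t) ≠ exp (-1)) :
    x'.1 ∈ ramificationPoints π := by
  intro hram
  let := ι.hom.toAlgebra
  have hl := h.liesOver (p := p) (x' := x') (x := ⟨_, hx⟩) rfl
  obtain ⟨t, ht⟩ := exists_valuationAt_eq_exp p ⟨_, hx⟩
  obtain ⟨t', ht'⟩ := exists_valuationAt_eq_exp (π ≫ p) x'
  have hlt : (exp (-1) : ℤᵐ⁰) < 1 := by rw [← exp_zero, exp_lt_exp]; norm_num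
  have hle {a : ℤᵐ⁰} (ha : a < 1) : a ≤ exp (-1) := by
    rwa [← exp_zero, lt_exp_iff, zero_sub] at ha
  have key (c : C'.presheaf.stalk x'.1)
      (hc : c ∈ IsLocalRing.maximalIdeal (C'.presheaf.stalk x'.1)) :
      valuationAt (π ≫ p) x' (algebraMap _ _ c) ≤ valuationAt (π ≫ p) x' (ι t) := by
    rw [← hram] at hc
    refine Submodule.span_induction ?_ ?_ ?_ ?_ hc
    · rintro _ ⟨a, ha, rfl⟩
      have h1 := h.algebraMap_stalkMap x'.1 a
      refine (congrArg _ h1).trans_le ((hl.le_iff _ t).2 ?_)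
      rw [ht]
      exact hle ((valuationAt_lt_one_iff p _).2 ha)
    · simp
    · intro a b _ _ ha hb
      rw [map_add]
      exact (valuationAt (π ≫ p) x').map_add_le ha hb
    · intro a b _ hb
      rw [smul_eq_mul, map_mul, map_mul]
      exact (mul_le_of_le_one_left' ((valuationAt_le_one_iff (π ≫ p) x').2 ⟨a, rfl⟩)).trans hb
  obtain ⟨a, rfl⟩ := (valuationAt_le_one_iff (π ≫ p) x').1 (ht'.trans_lt hlt).le
  have h1 := key a ((valuationAt_lt_one_iff (π ≫ p) x').1 (ht'.trans_lt hlt))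
  exact H t ht (le_antisymm (hle (hl.lt_one t (ht.trans_lt hlt))) (ht' ▸ h1))

end Ramification

/-! ### Double covers as square root extractions -/

section DoubleCover

open WithZero

lemma IsCurve.exists_normalized {k K K' S : Type*} [Field k] [Field K] [Field K'] [Algebra k K]
    [Algebra K K'] {v : S → Valuation K ℤᵐ⁰} (hv : IsCurve k v) (x : S) {y : K'} {f : K}
    (hy : y ^ 2 = algebraMap K K' f)
    (hspan : ∀ g : K', ∃ a b : K, g = algebraMap K K' a + algebraMap K K' b * y) {n e : ℤ}
    (hf : v x f = exp (2 * n + e)) : ∃ t : K, v x t = exp n ∧ v x (f / t ^ 2) = exp e ∧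
      (y / algebraMap K K' t) ^ 2 = algebraMap K K' (f / t ^ 2) ∧
      ∀ g : K', ∃ a b : K, g = algebraMap K K' a + algebraMap K K' b * (y / algebraMap K K' t) := by
  obtain ⟨t, ht⟩ := hv.exists_zpow x n
  have ht0 : t ≠ 0 := ne_zero_of_eq_exp ht
  have ht0' : algebraMap K K' t ≠ 0 := by simpa using ht0
  refine ⟨t, ht, ?_, ?_, fun g => ?_⟩
  · rw [map_div₀, map_pow, hf, ht, ← exp_nsmul, ← exp_sub]
    simp
  · rw [div_pow, hy, map_div₀, map_pow]
  · obtain ⟨a, b, rfl⟩ := hspan g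
    refine ⟨a, b * t, ?_⟩
    rw [map_mul]
    field_simp

variable {C' C : Scheme.{0}} [IsIntegral C'] [IsIntegral C] {π : C' ⟶ C}
  {p : C ⟶ Spec (.of ℂ)} [SmoothOfRelativeDimension 1 p] [SmoothOfRelativeDimension 1 (π ≫ p)]
  [IsProper p]

omit [IsIntegral C'] [IsIntegral C] in
lemma isClosed_map [IsFinite π] (x' : closedPoints C') : IsClosed {π x'.1} := by
  have := π.isClosedMap _ x'.2
  rwa [Set.image_singleton] at this

omit [IsIntegral C'] [IsIntegral C] in
lemma exists_closedPoint_over [CompactSpace C'] [Surjective π] (x : closedPoints C) :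
    ∃ x' : closedPoints C', π x'.1 = x.1 := by
  obtain ⟨z, hz⟩ := π.surjective x.1
  obtain ⟨x', hx', hc⟩ := (x.2.preimage π.continuous).exists_closed_singleton ⟨z, hz⟩
  exact ⟨⟨x', hc⟩, hx'⟩

omit [IsIntegral C] in
lemma genericPoint_notMem_ramificationPoints (π : C' ⟶ C) :
    genericPoint C' ∉ ramificationPoints π := by
  rw [ramificationPoints, Set.mem_ofPred, not_not]
  have h : IsLocalRing.maximalIdeal (C'.presheaf.stalk (genericPoint C')) = ⊥ :=
    (IsLocalRing.isField_iff_maximalIdeal_eq (R := C'.functionField)).1 (Field.toIsField _)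
  refine le_antisymm (Ideal.map_le_iff_le_comap.2 fun a ha => ?_) (h.trans_le bot_le)
  rw [Ideal.mem_comap, IsLocalRing.mem_maximalIdeal]
  exact fun hu => (IsLocalRing.mem_maximalIdeal _).1 ha
    (isUnit_of_map_unit (π.stalkMap _).hom a hu)

/-- The double cover is given by extracting the square root `y` of the function `f`, whose divisor
is `-2N` up to simple zeros at some points. -/
structure IsSqrtCover (hv : letI := functionFieldAlgebra p; IsCurve ℂ (valuationAt p))
    (ι : C.functionField ⟶ C'.functionField) (y : C'.functionField)
    (f : C.functionField) (N : closedPoints C →₀ ℤ) : Prop where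
  sq_eq : y ^ 2 = ι f
  span : ∀ g, ∃ a b, g = ι a + ι b * y
  not_sq : ∀ c, c ^ 2 ≠ f
  conj : ∃ σ : C'.functionField ⟶ C'.functionField, ι ≫ σ = ι ∧ σ y = -y
  apply_eq : ∀ x, valuationAt p x f = exp (2 * N x) ∨ valuationAt p x f = exp (2 * N x - 1)

/-- After division by an even power of a uniformizer the discriminant is a unit or a uniformizer,
according to the parity of the order of `f`. The first case is unramified, the second ramified; the
generic point never is. -/
lemma branchPoints_eq [IsFinite π] [Surjective π] {ι : C.functionField ⟶ C'.functionField}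
    (h : IsInducedBy π ι) {y : C'.functionField} {f : C.functionField} (hy : y ^ 2 = ι f)
    (hspan : ∀ g, ∃ a b, g = ι a + ι b * y) (hf : f ≠ 0) :
    letI := functionFieldAlgebra p
    branchPoints π = Subtype.val '' {x | Odd ((isCurve p).div f x)} := by
  let := functionFieldAlgebra p
  let := functionFieldAlgebra (π ≫ p)
  let := ι.hom.toAlgebra
  have hv := isCurve p
  have hv' := isCurve (π ≫ p)
  have : IsScalarTower ℂ C.functionField C'.functionField :=
    .of_algebraMap_eq fun c => (h.map_algebraMap p c).symm
  have hC' : CompactSpace C' := (quasiCompact_iff_compactSpace (π ≫ p)).1 inferInstance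
  ext x
  constructor
  · rintro ⟨x', hx', rfl⟩
    rcases eq_genericPoint_or_isClosed (π ≫ p) x' with rfl | hc
    · exact absurd hx' (genericPoint_notMem_ramificationPoints π)
    let x : closedPoints C := ⟨π x', isClosed_map (π := π) ⟨x', hc⟩⟩
    refine ⟨x, ?_, rfl⟩
    by_contra hodd
    rw [Set.mem_ofPred, Int.not_odd_iff_even] at hodd
    obtain ⟨n, hn⟩ := hodd
    obtain ⟨t, -, hu, hz, hspan'⟩ := hv.exists_normalized x hy hspan (n := -n) (e := 0)
      (by rw [hv.exp_div hf, hn]; congr 1; ring)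
    refine h.notMem_ramificationPoints (p := p) ⟨x', hc⟩ (isClosed_map (π := π) ⟨x', hc⟩)
      (fun g hg => ?_) hx'
    obtain ⟨r, a, b, -, -, hab, hr | hr⟩ := (h.liesOver (x' := ⟨x', hc⟩) rfl).exists_unit_of_even
      hv hv' hz hu hspan' hg
    · exact ⟨r, _, hr, hab⟩
    · exact ⟨r, _, hr, by rw [map_inv₀, hab, inv_one]⟩
  · rintro ⟨x, ⟨n, hn⟩, rfl⟩
    obtain ⟨x', hx'⟩ := exists_closedPoint_over (π := π) x
    obtain ⟨x, hx⟩ := x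
    obtain rfl := hx'
    refine ⟨x'.1, h.mem_ramificationPoints (p := p) x' hx fun t ht => ?_, rfl⟩
    obtain ⟨t', -, hu, hz, -⟩ := hv.exists_normalized ⟨π x'.1, hx⟩ hy hspan (n := -n) (e := -1)
      (by rw [hv.exp_div hf, hn]; congr 1; ring)
    exact (h.liesOver rfl).ne_exp_of_odd hz hu ht

theorem exists_isSqrtCover [IsFinite π] [Flat π] (hgenus : genus p = 1)
    (hdeg : ∀ y : C, π.finrank y = 2) (hbranch : (branchPoints π).encard = 6) :
    Surjective π ∧ ∃ ι, IsInducedBy π ι ∧ ∃ y f N,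
      IsSqrtCover (isCurve p) ι y f N ∧ IsCurve.degree N = 3 := by
  have hs : Surjective π := π.one_le_finrank_iff_surjective.1 fun y => by rw [hdeg]; exact one_le_two
  refine ⟨hs, ?_⟩
  let := functionFieldAlgebra p
  obtain ⟨ι, h⟩ := exists_isInducedBy π
  have hfin := h.finrank_eq hdeg
  let := ι.hom.toAlgebra
  have : CharZero C.functionField := charZero_of_injective_algebraMap (algebraMap ℂ C.functionField).injective
  obtain ⟨y, f, hy, hspan, hsq, σ, hσ⟩ := exists_sqrt_generator hfin
  have hf : f ≠ 0 := by rintro rfl; exact hsq 0 (zero_pow two_ne_zero)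
  have hB := branchPoints_eq (p := p) h hy hspan hf
  rw [hB, Subtype.val_injective.encard_image] at hbranch
  obtain ⟨N, hN, hNf⟩ := (isCurve p).exists_half_div (isGenusOne p hgenus) hf (n := 3) hbranch
  let σ' : C'.functionField ⟶ C'.functionField := CommRingCat.ofHom σ.toAlgHom.toRingHom
  have hισ : ι ≫ σ' = ι := by
    ext a
    exact σ.commutes a
  exact ⟨ι, h, y, f, N, ⟨hy, hspan, hsq, ⟨σ', hισ, hσ⟩, hNf⟩, hN⟩

end DoubleCover

/-! ### Forms on lines and ternary quadratic forms -/

section Forms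

open MvPolynomial

lemma eval_eq_of_isHomogeneous_zero {σ : Type*} {F : MvPolynomial σ ℂ} (hF : F.IsHomogeneous 0)
    (v w : σ → ℂ) : eval v F = eval w F := by
  rw [← mem_homogeneousSubmodule, homogeneousSubmodule_zero] at hF
  obtain ⟨a, rfl⟩ := Submodule.mem_one.1 hF
  simp [algebraMap_eq]

lemma eval_eq_sum_of_isHomogeneous_one {σ : Type*} [Fintype σ] {F : MvPolynomial σ ℂ}
    (hF : F.IsHomogeneous 1) (v w : σ → ℂ) : eval v F = ∑ i, v i * eval w (pderiv i F) := by
  have h := congr(eval v $(hF.sum_X_mul_pderiv))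
  rw [one_smul, map_sum] at h
  rw [← h]
  refine Finset.sum_congr rfl fun i _ => ?_
  rw [map_mul, eval_X, eval_eq_of_isHomogeneous_zero (hF.pderiv (i := i)) v w]

lemma eval_eq_zero_of_isHomogeneous_one {σ : Type*} [Fintype σ] {F : MvPolynomial σ ℂ}
    (hF : F.IsHomogeneous 1) (w : σ → ℂ) (h : ∀ i, eval w (pderiv i F) = 0) : F = 0 :=
  MvPolynomial.funext fun v => by simp [eval_eq_sum_of_isHomogeneous_one hF v w, h]

lemma polynomial_eval_aeval {σ : Type*} (F : MvPolynomial σ ℂ) (P : σ → Polynomial ℂ) (t : ℂ) :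
    (aeval P F).eval t = eval (fun i => (P i).eval t) F := by
  induction F using MvPolynomial.induction_on with
  | C c => simp
  | add p q hp hq => simp [hp, hq]
  | mul_X p j hp => simp [hp]

/-- The restriction of a form to an affine line, as a polynomial. -/
lemma exists_polynomial_restrict {σ : Type*} (F : MvPolynomial σ ℂ) (a b : σ → ℂ) :
    ∃ P : Polynomial ℂ, ∀ t, P.eval t = eval (fun i => a i + t * b i) F :=
  ⟨aeval (fun i => Polynomial.C (a i) + Polynomial.X * Polynomial.C (b i)) F, fun t => by
    rw [polynomial_eval_aeval]
    exact congrArg (fun v => eval v F) (funext fun i => by simp [mul_comm (b i)])⟩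

/-- Over an algebraically closed field, a form of positive degree has a zero on each line. -/
lemma exists_zero_on_line {σ : Type*} {F : MvPolynomial σ ℂ} {n : ℕ} (hF : F.IsHomogeneous n)
    (hn : 0 < n) (a b : σ → ℂ) : ∃ s t : ℂ, (s ≠ 0 ∨ t ≠ 0) ∧ eval (s • a + t • b) F = 0 := by
  obtain ⟨P, hP⟩ := exists_polynomial_restrict F a b
  obtain ⟨Q, hQ⟩ := exists_polynomial_restrict F b a
  by_cases hdeg : P.degree = 0
  · rw [Polynomial.eq_C_of_degree_eq_zero hdeg] at hP
    -- If the restriction has no root in the chart of `a`, it is constant there, and homogeneity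
    -- makes it a multiple of `s ^ n`; so the point `b` is a zero.
    have h1 : Q = Polynomial.C (P.coeff 0) * Polynomial.X ^ n := by
      refine Polynomial.eq_of_infinite_eval_eq _ _ ((Set.finite_singleton (0 : ℂ)).infinite_compl.mono
        fun s hs => ?_)
      have hs : s ≠ 0 := hs
      change Q.eval s = _
      rw [hQ]
      have h2 : (fun i => b i + s * a i) = s • fun i => a i + s⁻¹ * b i := by
        ext i
        rw [Pi.smul_apply, smul_eq_mul, mul_add, mul_inv_cancel_left₀ hs, add_comm]
      rw [h2, eval_smul_of_isHomogeneous hF, ← hP, Polynomial.eval_mul, Polynomial.eval_pow,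
        Polynomial.eval_X, Polynomial.eval_C, Polynomial.eval_C]
      ring
    refine ⟨0, 1, .inr one_ne_zero, ?_⟩
    have h3 := hQ 0
    rw [h1] at h3
    simp only [Polynomial.eval_mul, Polynomial.eval_C, Polynomial.eval_pow, Polynomial.eval_X,
      zero_pow hn.ne', mul_zero, zero_mul, add_zero] at h3
    exact (congrArg (fun v => eval v F) (funext fun i => by simp)).trans h3.symm
  · obtain ⟨t, ht⟩ := IsAlgClosed.exists_root P hdeg
    refine ⟨1, t, .inl one_ne_zero, ?_⟩
    rw [Polynomial.IsRoot.def, hP] at ht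
    rw [← ht]
    exact congrArg (fun v => eval v F) (funext fun i => by simp)

lemma sum_pderiv_eq_zero_of_line {σ : Type*} [Fintype σ] {F : MvPolynomial σ ℂ} {a b : σ → ℂ}
    (h : ∀ t : ℂ, eval (fun i => a i + t * b i) F = 0) : ∑ i, b i * eval a (pderiv i F) = 0 := by
  let P : Polynomial ℂ := aeval (fun i => Polynomial.C (a i) + Polynomial.X * Polynomial.C (b i)) F
  have hP : P = 0 := by
    refine Polynomial.funext fun t => ?_
    rw [Polynomial.eval_zero, ← h t]
    rw [polynomial_eval_aeval]
    exact congrArg (fun v => eval v F) (funext fun i => by simp [mul_comm (b i)])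
  have h1 : Polynomial.aeval (DualNumber.eps : DualNumber ℂ) P = 0 := by rw [hP, map_zero]
  have h2 := (AlgHom.congr_fun (comp_aeval
    (fun i => Polynomial.C (a i) + Polynomial.X * Polynomial.C (b i))
    (Polynomial.aeval (DualNumber.eps : DualNumber ℂ))) F).symm.trans h1
  have h3 := (aeval_dualNumber_snd F (fun i => Polynomial.aeval (DualNumber.eps : DualNumber ℂ)
    (Polynomial.C (a i) + Polynomial.X * Polynomial.C (b i)))).2
  rw [h2] at h3
  simp only [map_add, map_mul, Polynomial.aeval_C, Polynomial.aeval_X] at h3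
  simpa [TrivSqZeroExt.algebraMap_eq_inl] using h3.symm

/-- A smooth plane curve of degree at least two contains no line. -/
lemma IsSmoothForm.exists_ne_zero {g : MvPolynomial (Fin 3) ℂ} (hg : IsSmoothForm g) {n : ℕ}
    (hgn : g.IsHomogeneous (n + 2)) {W : Submodule ℂ (Fin 3 → ℂ)} (hW : Module.finrank ℂ W = 2) :
    ∃ x ∈ W, eval x g ≠ 0 := by
  by_contra! hcon
  obtain ⟨c, hc⟩ : ∃ c, c ∉ W := by
    by_contra! h
    rw [(Submodule.eq_top_iff'.2 h : W = ⊤), finrank_top] at hW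
    simp at hW
  have hsup : W ⊔ Submodule.span ℂ {c} = ⊤ := by
    refine Submodule.eq_top_of_finrank_eq (le_antisymm (Submodule.finrank_le _) ?_)
    have h1 : W < W ⊔ Submodule.span ℂ {c} := lt_of_le_not_ge le_sup_left fun h =>
      hc (h (Submodule.mem_sup_right (Submodule.mem_span_singleton_self c)))
    have := Submodule.finrank_lt_finrank_of_lt h1
    simp
    omega
  let b := Module.finBasisOfFinrankEq ℂ W hW
  -- The derivative of `g` in a direction transversal to `W`, a form of positive degree. At a zero
  -- `w` of it on the line all derivatives vanish: along `W` because `g` vanishes on `W`, and along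
  -- `c` by the choice of `w`.
  let F : MvPolynomial (Fin 3) ℂ := ∑ i, C (c i) * pderiv i g
  have hF : F.IsHomogeneous (n + 1) := by
    refine IsHomogeneous.sum _ _ _ fun i _ => ?_
    rw [← zero_add (n + 1)]
    exact (isHomogeneous_C _ _).mul (hgn.pderiv (i := i))
  obtain ⟨s, t, hst, h0⟩ := exists_zero_on_line hF n.succ_pos (b 0 : Fin 3 → ℂ) (b 1)
  set w : Fin 3 → ℂ := s • b 0 + t • b 1 with hw
  have hwW : w ∈ W := W.add_mem (W.smul_mem _ (b 0).2) (W.smul_mem _ (b 1).2)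
  have hw0 : w ≠ 0 := by
    intro h
    have h1 : ∑ i, ![s, t] i • b i = 0 := by
      rw [Fin.sum_univ_two]
      exact Subtype.ext h
    have h2 := Fintype.linearIndependent_iff.1 b.linearIndependent _ h1
    exact hst.elim (fun h => h (h2 0)) (fun h => h (h2 1))
  obtain ⟨i, hi⟩ := hg w hw0 (hcon w hwW)
  obtain ⟨u, hu, r, hr, hur⟩ := Submodule.mem_sup.1
    (hsup ▸ Submodule.mem_top : (Pi.single i 1 : Fin 3 → ℂ) ∈ W ⊔ Submodule.span ℂ {c})
  obtain ⟨d, rfl⟩ := Submodule.mem_span_singleton.1 hr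
  have h1 : ∑ i, u i * eval w (pderiv i g) = 0 := sum_pderiv_eq_zero_of_line fun t =>
    hcon _ (W.add_mem hwW (W.smul_mem t hu))
  have h2 : ∑ i, c i * eval w (pderiv i g) = 0 := by simpa [F] using h0
  apply hi
  have h3 : ∑ j, (u + d • c) j * eval w (pderiv j g) = 0 := by
    simp only [Pi.add_apply, Pi.smul_apply, smul_eq_mul, add_mul, mul_assoc,
      Finset.sum_add_distrib, ← Finset.mul_sum, h1, h2, mul_zero, add_zero]
  rw [hur] at h3
  simpa [Pi.single_apply] using h3

/-- A quadratic form in three variables is a sum of squares of multiples of coordinates. -/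
lemma exists_eval_eq_sum_sq {q : MvPolynomial (Fin 3) ℂ} (hq : q.IsHomogeneous 2) :
    ∃ (a : Fin 3 → ℂ) (e : (Fin 3 → ℂ) ≃ₗ[ℂ] (Fin 3 → ℂ)),
      ∀ v, eval v q = ∑ i, (a i * e v i) ^ 2 := by
  let A : Matrix (Fin 3) (Fin 3) ℂ :=
    -- Half the Hessian; second partials of a quadratic form are constant, so they may be evaluated
    -- at 0.
    Matrix.of fun i j => 2⁻¹ * eval 0 (pderiv j (pderiv i q))
  obtain ⟨Q, hQ⟩ : ∃ Q : QuadraticForm ℂ (Fin 3 → ℂ), ∀ v, Q v = eval v q := by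
    refine ⟨A.toQuadraticForm', fun v => ?_⟩
    have h := congr(eval v $(hq.sum_X_mul_pderiv))
    rw [map_sum, two_smul, map_add] at h
    have h2 : A.toQuadraticForm' v = 2⁻¹ * ∑ i, eval v (X i * pderiv i q) := by
      simp only [Matrix.toQuadraticForm', LinearMap.BilinMap.toQuadraticMap_apply,
        Matrix.toLinearMap₂'_apply, A, Matrix.of_apply, smul_eq_mul, Finset.mul_sum]
      refine Finset.sum_congr rfl fun i _ => ?_
      rw [map_mul, eval_X, eval_eq_sum_of_isHomogeneous_one (hq.pderiv (i := i)) v 0,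
        Finset.mul_sum, Finset.mul_sum]
      exact Finset.sum_congr rfl fun j _ => by ring
    rw [h2, h]
    ring
  obtain ⟨w, ⟨e⟩⟩ := QuadraticForm.equivalent_weightedSumSquares Q
  choose a ha using fun i => IsAlgClosed.exists_pow_nat_eq (w i) two_pos
  have hd : Module.finrank ℂ (Fin 3 → ℂ) = 3 := Module.finrank_fin_fun ℂ
  -- The diagonal form is indexed by the dimension, which has to be replaced by the literal 3 in the
  -- types.
  generalize Module.finrank ℂ (Fin 3 → ℂ) = d at w e a ha hd
  subst hd
  refine ⟨a, e.toLinearEquiv, fun v => ?_⟩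
  rw [← hQ, ← e.map_app, QuadraticMap.weightedSumSquares_apply]
  refine Finset.sum_congr rfl fun i _ => ?_
  rw [← ha, smul_eq_mul, mul_pow, ← sq]
  rfl

/-- A quadratic form in three variables that is not a square is of the shape `ℓ₁ℓ₂ - ℓ₃²`. -/
lemma exists_eq_mul_sub_sq {q : MvPolynomial (Fin 3) ℂ} (hq : q.IsHomogeneous 2)
    (hsq : ∀ ℓ : MvPolynomial (Fin 3) ℂ, ℓ.IsHomogeneous 1 → q ≠ ℓ ^ 2) :
    ∃ ℓ₁ ℓ₂ ℓ₃ : MvPolynomial (Fin 3) ℂ, ℓ₁.IsHomogeneous 1 ∧ ℓ₂.IsHomogeneous 1 ∧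
      ℓ₃.IsHomogeneous 1 ∧ q = ℓ₁ * ℓ₂ - ℓ₃ ^ 2 ∧
      ∀ c₁ c₂ c₃ : ℂ, C c₁ * ℓ₁ + C c₂ * ℓ₂ + C c₃ * ℓ₃ = 0 → c₁ = 0 ∧ c₂ = 0 := by
  obtain ⟨a, e, hae⟩ := exists_eval_eq_sum_sq hq
  let M : Fin 3 → MvPolynomial (Fin 3) ℂ := fun i => ∑ j, C (a i * e (Pi.single j 1) i) * X j
  have hM (i) : (M i).IsHomogeneous 1 := IsHomogeneous.sum _ _ _ fun j _ =>
    (isHomogeneous_X ℂ j).C_mul _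
  have hMe (i) (v) : eval v (M i) = a i * e v i := by
    have h1 : e v = ∑ j, v j • e (Pi.single j 1) := by
      conv_lhs => rw [pi_eq_sum_univ' v]
      rw [map_sum]
      exact Finset.sum_congr rfl fun j _ => e.map_smul _ _
    rw [h1, Finset.sum_apply, Finset.mul_sum, map_sum]
    refine Finset.sum_congr rfl fun j _ => ?_
    simp
    ring
  have hqM : q = ∑ i, M i ^ 2 := MvPolynomial.funext fun v => by
    rw [hae, map_sum]
    exact Finset.sum_congr rfl fun i _ => by rw [map_pow, hMe]
  -- The form has rank at least two: with at most one nonzero coefficient it would be a square.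
  have hex (j : Fin 3) : ∃ i, i ≠ j ∧ a i ≠ 0 := by
    by_contra! h
    refine hsq (M j) (hM j) (hqM.trans (Finset.sum_eq_single j (fun i _ hi => ?_) (by simp)))
    have : M i = 0 := MvPolynomial.funext fun v => by rw [hMe, h i hi, zero_mul, map_zero]
    rw [this, zero_pow two_ne_zero]
  obtain ⟨j, -, hj⟩ := hex 0
  obtain ⟨k, hkj, hk⟩ := hex j
  obtain ⟨l, hlj, hlk, hl⟩ : ∃ l, l ≠ j ∧ l ≠ k ∧ Finset.univ = {j, k, l} :=
    (by decide : ∀ j k : Fin 3, k ≠ j → ∃ l, l ≠ j ∧ l ≠ k ∧ Finset.univ = {j, k, l}) j k hkj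
  have hCI : (C Complex.I : MvPolynomial (Fin 3) ℂ) ^ 2 = -1 := by
    rw [← map_pow, Complex.I_sq, map_neg, map_one]
  have hCM (i) : (C Complex.I * M i).IsHomogeneous 1 := (hM i).C_mul _
  have hsingle (i i') : eval (e.symm (Pi.single i 1)) (M i') = if i' = i then a i else 0 := by
    rw [hMe, LinearEquiv.apply_symm_apply, Pi.single_apply]
    split_ifs with h
    · rw [h, mul_one]
    · rw [mul_zero]
  -- `M j` and `M k` are nonzero and independent, and `M j² + M k²` splits into two linear factors.
  -- `M l` may vanish, so nothing can be said about the third coefficient of a relation.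
  refine ⟨M j + C Complex.I * M k, M j - C Complex.I * M k, C Complex.I * M l,
    (hM j).add (hCM k), (hM j).sub (hCM k), hCM l, ?_, fun c₁ c₂ c₃ h => ?_⟩
  · rw [hqM, hl, Finset.sum_insert (by simp [hkj.symm, hlj.symm]),
      Finset.sum_insert (by simp [hlk.symm]), Finset.sum_singleton]
    linear_combination (M k ^ 2 + M l ^ 2) * hCI
  · have h1 := congrArg (eval (e.symm (Pi.single j 1))) h
    have h2 := congrArg (eval (e.symm (Pi.single k 1))) h
    simp only [map_add, map_sub, map_mul, eval_C, hsingle, map_zero, hkj, hkj.symm, hlj, hlk,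
      if_true, if_false] at h1 h2
    have h3 : c₁ + c₂ = 0 := mul_right_cancel₀ hj (by linear_combination h1)
    have h4 : c₁ - c₂ = 0 := mul_right_cancel₀ (mul_ne_zero Complex.I_ne_zero hk)
      (by linear_combination h2)
    exact ⟨by linear_combination h3 / 2 + h4 / 2, by linear_combination h3 / 2 - h4 / 2⟩

end Forms

/-! ### The cubic threefold: discriminant, smoothness, fixed lines -/

section Threefold

open MvPolynomial

/-- The cubic form `ℓ₁x₃² + ℓ₂x₄² + 2ℓ₃x₃x₄ + g`, with `ℓ₁, ℓ₂, ℓ₃, g` forms in `x₀, x₁, x₂`. -/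
def threefoldForm (ℓ₁ ℓ₂ ℓ₃ g : MvPolynomial (Fin 3) ℂ) : MvPolynomial (Fin 5) ℂ :=
  rename ![0, 1, 2] ℓ₁ * X 3 ^ 2 + rename ![0, 1, 2] ℓ₂ * X 4 ^ 2 +
    C 2 * rename ![0, 1, 2] ℓ₃ * (X 3 * X 4) + rename ![0, 1, 2] g

/-- The conditions on the coefficients under which `threefoldForm` defines a smooth threefold. -/
structure IsTransversal (ℓ₁ ℓ₂ ℓ₃ g : MvPolynomial (Fin 3) ℂ) : Prop where
  hom₁ : ℓ₁.IsHomogeneous 1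
  hom₂ : ℓ₂.IsHomogeneous 1
  hom₃ : ℓ₃.IsHomogeneous 1
  hom : g.IsHomogeneous 3
  isSmoothForm : IsSmoothForm g
  indep : ∀ c₁ c₂ c₃ : ℂ, C c₁ * ℓ₁ + C c₂ * ℓ₂ + C c₃ * ℓ₃ = 0 → c₁ = 0 ∧ c₂ = 0
  exists_direction : ∀ x : Fin 3 → ℂ, x ≠ 0 → eval x g = 0 → eval x (ℓ₁ * ℓ₂ - ℓ₃ ^ 2) = 0 →
    ∃ u : Fin 3 → ℂ, ∑ i, u i * eval x (pderiv i g) = 0 ∧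
      ∑ i, u i * eval x (pderiv i (ℓ₁ * ℓ₂ - ℓ₃ ^ 2)) ≠ 0

lemma projection_apply (v : Fin 5 → ℂ) : projection v = ![v 0, v 1, v 2] := by
  ext i
  fin_cases i <;> rfl

lemma eval_rename_projection (f : MvPolynomial (Fin 3) ℂ) (v : Fin 5 → ℂ) :
    eval v (rename ![0, 1, 2] f) = eval (projection v) f :=
  eval_rename _ _ _

lemma injective_coordinates : Function.Injective (![0, 1, 2] : Fin 3 → Fin 5) := by decide

lemma pderiv_rename_coordinates (f : MvPolynomial (Fin 3) ℂ) {i : Fin 5}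
    (hi : ∀ j, (![0, 1, 2] : Fin 3 → Fin 5) j ≠ i) : pderiv i (rename ![0, 1, 2] f) = 0 := by
  refine pderiv_eq_zero_of_notMem_vars fun h => ?_
  classical
  obtain ⟨j, -, hj⟩ := Finset.mem_image.1 (vars_rename _ _ h)
  exact hi j hj

variable (ℓ₁ ℓ₂ ℓ₃ g : MvPolynomial (Fin 3) ℂ)

lemma eval_threefoldForm (v : Fin 5 → ℂ) : eval v (threefoldForm ℓ₁ ℓ₂ ℓ₃ g) =
    eval (projection v) ℓ₁ * v 3 ^ 2 + eval (projection v) ℓ₂ * v 4 ^ 2 +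
      2 * eval (projection v) ℓ₃ * (v 3 * v 4) + eval (projection v) g := by
  simp only [threefoldForm, map_add, map_mul, map_pow, eval_X, eval_C, eval_rename_projection]

lemma pderiv_three_threefoldForm : pderiv 3 (threefoldForm ℓ₁ ℓ₂ ℓ₃ g) =
    C 2 * (rename ![0, 1, 2] ℓ₁ * X 3) + C 2 * (rename ![0, 1, 2] ℓ₃ * X 4) := by
  have h (f : MvPolynomial (Fin 3) ℂ) : pderiv (3 : Fin 5) (rename ![0, 1, 2] f) = 0 :=
    pderiv_rename_coordinates f (by decide)
  have h4 : pderiv (3 : Fin 5) (X 4 : MvPolynomial (Fin 5) ℂ) = 0 := pderiv_X_of_ne (by decide)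
  simp only [threefoldForm, map_add, pderiv_mul, pderiv_pow, h, h4, pderiv_X_self, pderiv_C]
  rw [show (C 2 : MvPolynomial (Fin 5) ℂ) = 2 from map_ofNat C 2]
  ring

lemma pderiv_four_threefoldForm : pderiv 4 (threefoldForm ℓ₁ ℓ₂ ℓ₃ g) =
    C 2 * (rename ![0, 1, 2] ℓ₂ * X 4) + C 2 * (rename ![0, 1, 2] ℓ₃ * X 3) := by
  have h (f : MvPolynomial (Fin 3) ℂ) : pderiv (4 : Fin 5) (rename ![0, 1, 2] f) = 0 :=
    pderiv_rename_coordinates f (by decide)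
  have h4 : pderiv (4 : Fin 5) (X 3 : MvPolynomial (Fin 5) ℂ) = 0 := pderiv_X_of_ne (by decide)
  simp only [threefoldForm, map_add, pderiv_mul, pderiv_pow, h, h4, pderiv_X_self, pderiv_C]
  rw [show (C 2 : MvPolynomial (Fin 5) ℂ) = 2 from map_ofNat C 2]
  ring

lemma eval_pderiv_threefoldForm (v : Fin 5 → ℂ) (i : Fin 3) :
    eval v (pderiv (![0, 1, 2] i) (threefoldForm ℓ₁ ℓ₂ ℓ₃ g)) =
      eval (projection v) (pderiv i ℓ₁) * v 3 ^ 2 + eval (projection v) (pderiv i ℓ₂) * v 4 ^ 2 +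
        2 * eval (projection v) (pderiv i ℓ₃) * (v 3 * v 4) +
        eval (projection v) (pderiv i g) := by
  have h (f : MvPolynomial (Fin 3) ℂ) : pderiv ((![0, 1, 2] : Fin 3 → Fin 5) i)
      (rename ![0, 1, 2] f) = rename ![0, 1, 2] (pderiv i f) :=
    pderiv_rename injective_coordinates _ _
  have h3 : pderiv ((![0, 1, 2] : Fin 3 → Fin 5) i) (X 3 : MvPolynomial (Fin 5) ℂ) = 0 :=
    pderiv_X_of_ne (by clear h; revert i; decide)
  have h4 : pderiv ((![0, 1, 2] : Fin 3 → Fin 5) i) (X 4 : MvPolynomial (Fin 5) ℂ) = 0 :=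
    pderiv_X_of_ne (by clear h h3; revert i; decide)
  simp only [threefoldForm, map_add, pderiv_mul, pderiv_pow, h, h3, h4, pderiv_C, map_mul,
    map_pow, eval_X, eval_C, eval_rename_projection, map_zero]
  ring

/-- There are no terms linear in `(x₃, x₄)`, so the matrix splits into a block for the `ℓᵢ` and the
entry `g`. -/
lemma det_conicMatrix : (conicMatrix (threefoldForm ℓ₁ ℓ₂ ℓ₃ g)).det =
    g * (ℓ₁ * ℓ₂ - ℓ₃ ^ 2) := by
  have hr (f : MvPolynomial (Fin 3) ℂ) :
      aeval ![(X 0 : MvPolynomial (Fin 3) ℂ), X 1, X 2, 0, 0] (rename ![0, 1, 2] f) = f := by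
    rw [aeval_rename]
    conv_rhs => rw [← aeval_X_left_apply f]
    congr 2
    ext i
    fin_cases i <;> rfl
  have h3 (f : MvPolynomial (Fin 3) ℂ) : pderiv (3 : Fin 5) (rename ![0, 1, 2] f) = 0 :=
    pderiv_rename_coordinates f (by decide)
  have h4 (f : MvPolynomial (Fin 3) ℂ) : pderiv (4 : Fin 5) (rename ![0, 1, 2] f) = 0 :=
    pderiv_rename_coordinates f (by decide)
  have h34 : pderiv (3 : Fin 5) (X 4 : MvPolynomial (Fin 5) ℂ) = 0 := pderiv_X_of_ne (by decide)
  have h43 : pderiv (4 : Fin 5) (X 3 : MvPolynomial (Fin 5) ℂ) = 0 := pderiv_X_of_ne (by decide)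
  have hC : C (1 / 2 : ℂ) * C 2 = (1 : MvPolynomial (Fin 3) ℂ) := by
    rw [← C_mul]
    norm_num
  have hmul (f : MvPolynomial (Fin 3) ℂ) : C (1 / 2 : ℂ) * (C 2 * f) = f := by
    rw [← mul_assoc, hC, one_mul]
  have h0 : threefoldForm ℓ₁ ℓ₂ ℓ₃ g = rename ![0, 1, 2] ℓ₁ * X 3 ^ 2 +
    rename ![0, 1, 2] ℓ₂ * X 4 ^ 2 + C 2 * rename ![0, 1, 2] ℓ₃ * (X 3 * X 4) +
    rename ![0, 1, 2] g := rfl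
  have hM : conicMatrix (threefoldForm ℓ₁ ℓ₂ ℓ₃ g) = !![ℓ₁, ℓ₃, 0; ℓ₃, ℓ₂, 0; 0, 0, g] := by
    simp only [conicMatrix, pderiv_three_threefoldForm, pderiv_four_threefoldForm]
    rw [h0]
    simp only [map_add, pderiv_mul, h3, h4, h34, h43, pderiv_X_self, pderiv_C, map_mul, hr,
      aeval_X, map_pow, zero_mul, mul_zero, zero_add, add_zero, mul_one, aeval_C, algebraMap_eq,
      hmul]
    simp
  rw [hM, Matrix.det_fin_three]
  simp
  ring

lemma nonEckardtInvolution_apply (v : Fin 5 → ℂ) :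
    nonEckardtInvolution v = ![v 0, v 1, v 2, -v 3, -v 4] := by
  rw [nonEckardtInvolution, Matrix.toLin'_apply]
  ext i
  rw [Matrix.mulVec_diagonal]
  fin_cases i <;> simp

lemma eval_nonEckardtInvolution (v : Fin 5 → ℂ) :
    eval (nonEckardtInvolution v) (threefoldForm ℓ₁ ℓ₂ ℓ₃ g) =
      eval v (threefoldForm ℓ₁ ℓ₂ ℓ₃ g) := by
  have h : projection (nonEckardtInvolution v) = projection v := by
    rw [nonEckardtInvolution_apply, projection_apply, projection_apply]
    rfl
  rw [eval_threefoldForm, eval_threefoldForm, h, nonEckardtInvolution_apply]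
  simp

lemma mem_fixedLine {v : Fin 5 → ℂ} : v ∈ fixedLine ↔ projection v = 0 := Iff.rfl

lemma finrank_fixedLine : Module.finrank ℂ fixedLine = 2 := by
  have h1 := LinearMap.finrank_range_add_finrank_ker projection
  have h2 : LinearMap.range projection = ⊤ := LinearMap.range_eq_top.2
    (LinearMap.funLeft_surjective_of_injective ℂ ℂ _ injective_coordinates)
  rw [h2, finrank_top, Module.finrank_fin_fun, Module.finrank_fin_fun] at h1
  exact Nat.add_left_cancel h1

variable {ℓ₁ ℓ₂ ℓ₃ g}

namespace IsTransversal

variable (h : IsTransversal ℓ₁ ℓ₂ ℓ₃ g)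

include h

lemma isHomogeneous : (threefoldForm ℓ₁ ℓ₂ ℓ₃ g).IsHomogeneous 3 := by
  have h3 : (X 3 : MvPolynomial (Fin 5) ℂ).IsHomogeneous 1 := isHomogeneous_X _ _
  have h4 : (X 4 : MvPolynomial (Fin 5) ℂ).IsHomogeneous 1 := isHomogeneous_X _ _
  exact (((h.hom₁.rename_isHomogeneous.mul (h3.pow 2)).add
    (h.hom₂.rename_isHomogeneous.mul (h4.pow 2))).add
    ((h.hom₃.rename_isHomogeneous.C_mul 2).mul (h3.mul h4))).add h.hom.rename_isHomogeneous

theorem isSmoothForm_threefoldForm : IsSmoothForm (threefoldForm ℓ₁ ℓ₂ ℓ₃ g) := by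
  intro v hv hF
  by_contra! hd
  have e3 := hd 3
  have e4 := hd 4
  have e (i : Fin 3) := hd (![0, 1, 2] i)
  simp only [eval_pderiv_threefoldForm] at e
  simp only [pderiv_three_threefoldForm, pderiv_four_threefoldForm, map_add, map_mul, eval_C,
    eval_X, eval_rename_projection] at e3 e4
  rw [eval_threefoldForm] at hF
  have hv34 (h3 : v 3 = 0) (h4 : v 4 = 0) : projection v ≠ 0 := by
    intro h0
    apply hv
    rw [projection_apply] at h0
    ext i
    fin_cases i
    exacts [congrFun h0 0, congrFun h0 1, congrFun h0 2, h3, h4]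
  generalize projection v = x at e e3 e4 hF hv34
  -- At a point of `L` the remaining partial derivatives are those of the linear form `v₃²ℓ₁ + v₄²ℓ₂
  -- + 2v₃v₄ℓ₃`, which is nonzero by independence.
  by_cases hx : x = 0
  · subst hx
    have h1 : C (v 3 ^ 2) * ℓ₁ + C (v 4 ^ 2) * ℓ₂ + C (2 * (v 3 * v 4)) * ℓ₃ = 0 := by
      refine eval_eq_zero_of_isHomogeneous_one (((h.hom₁.C_mul _).add (h.hom₂.C_mul _)).add
        (h.hom₃.C_mul _)) 0 fun i => ?_
      have hi := e i
      rw [eval_zero_of_isHomogeneous (h.hom.pderiv (i := i)) two_ne_zero] at hi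
      simp only [map_add, pderiv_C_mul]
      simp only [map_mul, eval_C]
      linear_combination hi
    obtain ⟨h3, h4⟩ := h.indep _ _ _ h1
    exact hv34 (pow_eq_zero_iff two_ne_zero |>.1 h3) (pow_eq_zero_iff two_ne_zero |>.1 h4) rfl
  have k3 : eval x ℓ₁ * v 3 + eval x ℓ₃ * v 4 = 0 := by linear_combination e3 / 2
  have k4 : eval x ℓ₃ * v 3 + eval x ℓ₂ * v 4 = 0 := by linear_combination e4 / 2
  have hg : eval x g = 0 := by linear_combination hF - v 3 * k3 - v 4 * k4
  -- `(v₃, v₄)` lies in the kernel of the symmetric matrix of the `ℓᵢ`, so either it is zero, which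
  -- is excluded by smoothness of `g`, or the determinant vanishes at `x`.
  have hq : eval x (ℓ₁ * ℓ₂ - ℓ₃ ^ 2) = 0 ∨ (v 3 = 0 ∧ v 4 = 0) := by
    by_cases h3 : v 3 = 0
    · by_cases h4 : v 4 = 0
      · exact .inr ⟨h3, h4⟩
      · refine .inl (mul_right_cancel₀ h4 ?_)
        simp only [map_sub, map_mul, map_pow]
        linear_combination eval x ℓ₁ * k4 - eval x ℓ₃ * k3
    · refine .inl (mul_right_cancel₀ h3 ?_)
      simp only [map_sub, map_mul, map_pow]
      linear_combination eval x ℓ₂ * k3 - eval x ℓ₃ * k4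
  by_cases h34 : v 3 = 0 ∧ v 4 = 0
  · obtain ⟨i, hi⟩ := h.isSmoothForm x hx hg
    refine hi ?_
    have := e i
    rw [h34.1, h34.2] at this
    linear_combination this
  obtain ⟨u, hu, huq⟩ := h.exists_direction x hx hg (hq.resolve_right h34)
  have hsum : ∑ i, u i * (eval x (pderiv i ℓ₁) * v 3 ^ 2 + eval x (pderiv i ℓ₂) * v 4 ^ 2 +
      2 * eval x (pderiv i ℓ₃) * (v 3 * v 4)) = 0 := by
    have h1 := Finset.sum_congr (rfl : (Finset.univ : Finset (Fin 3)) = _) fun i _ =>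
      congrArg (u i * ·) (e i)
    simp only [mul_zero, Finset.sum_const_zero, mul_add _ _ (eval x (pderiv _ g)),
      Finset.sum_add_distrib, hu, add_zero] at h1
    simpa only [mul_add, Finset.sum_add_distrib] using h1
  -- Along the direction `u` tangent to `V(g)`, the derivative of the quadratic part at `(v₃, v₄)`
  -- vanishes. Since `(v₃, v₄)` is a kernel vector, `v₄²` times the derivative of the determinant is
  -- `ℓ₁` times that derivative, and `v₃²` times it is `ℓ₂` times it. So the determinant has
  -- derivative zero along `u`, against transversality.
  apply huq
  by_cases h3 : v 3 = 0
  · have h4 : v 4 ≠ 0 := fun h4 => h34 ⟨h3, h4⟩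
    refine mul_left_cancel₀ (pow_ne_zero 2 h4) ?_
    rw [mul_zero, ← mul_zero (eval x ℓ₁), ← hsum, Finset.mul_sum, Finset.mul_sum]
    refine Finset.sum_congr rfl fun i _ => ?_
    simp only [map_sub, pderiv_mul, pderiv_pow, map_add, map_mul, map_pow, map_natCast]
    push_cast
    linear_combination u i * (eval x (pderiv i ℓ₁) * (v 4 * k4 - v 3 * k3) -
      2 * eval x (pderiv i ℓ₃) * (v 4 * k3))
  · refine mul_left_cancel₀ (pow_ne_zero 2 h3) ?_
    rw [mul_zero, ← mul_zero (eval x ℓ₂), ← hsum, Finset.mul_sum, Finset.mul_sum]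
    refine Finset.sum_congr rfl fun i _ => ?_
    simp only [map_sub, pderiv_mul, pderiv_pow, map_add, map_mul, map_pow, map_natCast]
    push_cast
    linear_combination u i * (eval x (pderiv i ℓ₂) * (v 3 * k3 - v 4 * k4) -
      2 * eval x (pderiv i ℓ₃) * (v 3 * k4))

theorem isPointwiseFixedLine_iff (M : Submodule ℂ (Fin 5 → ℂ)) :
    IsPointwiseFixedLine (threefoldForm ℓ₁ ℓ₂ ℓ₃ g) M ↔ M = fixedLine := by
  constructor
  · rintro ⟨hM, hF, hfix⟩
    have hv34 {v} (hv : v ∈ M) (h0 : projection v ≠ 0) : v 3 = 0 ∧ v 4 = 0 := by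
      obtain ⟨c, hc⟩ := hfix v hv
      rw [nonEckardtInvolution_apply] at hc
      have hc1 : c = 1 := by
        by_contra hc1
        have hz {a : ℂ} (ha : a = c * a) : a = 0 :=
          (mul_eq_zero.1 (by linear_combination ha : (1 - c) * a = 0)).resolve_left
            (sub_ne_zero.2 (Ne.symm hc1))
        apply h0
        rw [projection_apply]
        ext i
        fin_cases i
        exacts [hz (congrFun hc 0), hz (congrFun hc 1), hz (congrFun hc 2)]
      subst hc1
      have h3 : -v 3 = 1 * v 3 := congrFun hc 3
      have h4 : -v 4 = 1 * v 4 := congrFun hc 4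
      exact ⟨by linear_combination -h3 / 2, by linear_combination -h4 / 2⟩
    by_cases hall : M ≤ fixedLine
    · exact Submodule.eq_of_le_of_finrank_eq hall (hM.trans finrank_fixedLine.symm)
    obtain ⟨v, hv, hv0⟩ := SetLike.not_le_iff_exists.1 hall
    rw [mem_fixedLine] at hv0
    -- `M` consists of eigenvectors, so it lies in a single eigenspace; if not in `L`, then in `x₃ =
    -- x₄ = 0`, and it projects to a line on `V(g)`.
    have hM34 {w} (hw : w ∈ M) : w 3 = 0 ∧ w 4 = 0 := by
      by_cases h0 : projection w = 0
      · have h1 := hv34 (M.add_mem hw hv) (by rwa [map_add, h0, zero_add])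
        have h2 := hv34 hv hv0
        simpa [h2.1, h2.2] using h1
      · exact hv34 hw h0
    have hinj : Function.Injective (projection.domRestrict M) := by
      rw [injective_iff_map_eq_zero]
      rintro ⟨w, hw⟩ h0
      rw [LinearMap.domRestrict_apply, projection_apply] at h0
      ext i
      fin_cases i
      exacts [congrFun h0 0, congrFun h0 1, congrFun h0 2, (hM34 hw).1, (hM34 hw).2]
    have hW : Module.finrank ℂ (LinearMap.range (projection.domRestrict M)) = 2 :=
      (LinearMap.finrank_range_of_inj hinj).trans hM
    obtain ⟨x, ⟨⟨w, hw⟩, rfl⟩, hx⟩ := h.isSmoothForm.exists_ne_zero h.hom hW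
    refine absurd ?_ hx
    have h1 := hF w hw
    rw [eval_threefoldForm, (hM34 hw).1, (hM34 hw).2] at h1
    simpa using h1
  · rintro rfl
    refine ⟨finrank_fixedLine, fun v hv => ?_, fun v hv => ⟨-1, ?_⟩⟩
    · rw [eval_threefoldForm, mem_fixedLine.1 hv, eval_zero_of_isHomogeneous h.hom₁ one_ne_zero,
        eval_zero_of_isHomogeneous h.hom₂ one_ne_zero,
        eval_zero_of_isHomogeneous h.hom₃ one_ne_zero,
        eval_zero_of_isHomogeneous h.hom three_ne_zero]
      ring
    · have h0 := mem_fixedLine.1 hv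
      rw [projection_apply] at h0
      have k0 : v 0 = 0 := congrFun h0 0
      have k1 : v 1 = 0 := congrFun h0 1
      have k2 : v 2 = 0 := congrFun h0 2
      rw [nonEckardtInvolution_apply]
      ext i
      fin_cases i <;> simp [k0, k1, k2]

/-- If all `ℓᵢ` vanished at `x`, the conic `ℓ₁ℓ₂ - ℓ₃²` would be singular there and not transversal
to `V(g)`. -/
lemma exists_eval_ne_zero {x : Fin 3 → ℂ} (hx : x ≠ 0) (hg : eval x g = 0) :
    eval x ℓ₁ ≠ 0 ∨ eval x ℓ₂ ≠ 0 ∨ eval x ℓ₃ ≠ 0 := by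
  by_contra! h0
  obtain ⟨h1, h2, h3⟩ := h0
  obtain ⟨u, -, hu⟩ := h.exists_direction x hx hg (by simp [h1, h2, h3])
  exact hu (Finset.sum_eq_zero fun i _ => by simp [h1, h2, h3])

end IsTransversal

end Threefold

/-! ### Residual lines over the cubic component -/

section ResidualLines

open MvPolynomial

/-- The point `(x, 0, 0)` of `ℂ⁵`. -/
def planeVec (x : Fin 3 → ℂ) : Fin 5 → ℂ := ![x 0, x 1, x 2, 0, 0]

/-- The point `(0, 0, 0, α, β)` of `ℂ⁵`. -/
def lineVec (α β : ℂ) : Fin 5 → ℂ := ![0, 0, 0, α, β]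

lemma projection_planeVec (x : Fin 3 → ℂ) : projection (planeVec x) = x := by
  rw [projection_apply]
  ext i
  fin_cases i <;> rfl

lemma projection_lineVec (α β : ℂ) : projection (lineVec α β) = 0 := by
  rw [projection_apply]
  ext i
  fin_cases i <;> rfl

lemma eq_planeVec_add_lineVec {v : Fin 5 → ℂ} {x : Fin 3 → ℂ} {c : ℂ} (h : projection v = c • x) :
    v = c • planeVec x + lineVec (v 3) (v 4) := by
  rw [projection_apply] at h
  have h0 := congrFun h 0
  have h1 := congrFun h 1
  have h2 := congrFun h 2
  ext i
  fin_cases i <;> simp_all [planeVec, lineVec]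

lemma lineVec_eq (α β : ℂ) : lineVec α β = α • lineVec 1 0 + β • lineVec 0 1 := by
  ext i
  fin_cases i <;> simp [lineVec]

lemma mem_planeThroughLine {x : Fin 3 → ℂ} {v : Fin 5 → ℂ} :
    v ∈ planeThroughLine x ↔ ∃ c : ℂ, projection v = c • x := by
  simp [planeThroughLine, Submodule.mem_span_singleton, eq_comm]

lemma linearIndependent_planeVec_lineVec {x : Fin 3 → ℂ} (hx : x ≠ 0) {α β : ℂ}
    (hαβ : α ≠ 0 ∨ β ≠ 0) : LinearIndependent ℂ ![planeVec x, lineVec α β] := by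
  rw [LinearIndependent.pair_iff]
  intro s t h
  have h1 := congrArg projection h
  rw [map_add, map_smul, map_smul, projection_planeVec, projection_lineVec, smul_zero, add_zero,
    map_zero, smul_eq_zero] at h1
  have hs := h1.resolve_right hx
  have h3 := congrFun h 3
  have h4 := congrFun h 4
  simp [planeVec, lineVec] at h3 h4
  exact ⟨hs, by tauto⟩

/-- The trace of a plane through `L` on a hyperplane through `(x, 0, 0)`. -/
lemma planeThroughLine_inf_ker {x : Fin 3 → ℂ} {b : Module.Dual ℂ (Fin 5 → ℂ)}
    (hb : b (planeVec x) = 0) {α β : ℂ} (hαβ : α ≠ 0 ∨ β ≠ 0)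
    (hb0 : b (lineVec 1 0) ≠ 0 ∨ b (lineVec 0 1) ≠ 0)
    (h : α * b (lineVec 1 0) + β * b (lineVec 0 1) = 0) :
    planeThroughLine x ⊓ LinearMap.ker b = Submodule.span ℂ {planeVec x, lineVec α β} := by
  ext v
  rw [Submodule.mem_inf, mem_planeThroughLine, LinearMap.mem_ker, Submodule.mem_span_pair]
  constructor
  · rintro ⟨⟨c, hc⟩, hv⟩
    have hv' := eq_planeVec_add_lineVec hc
    rw [hv', lineVec_eq, map_add, map_smul, hb, smul_zero, zero_add, map_add, map_smul, map_smul,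
      smul_eq_mul, smul_eq_mul] at hv
    have hdet : v 3 * β = v 4 * α := by
      rcases hb0 with h0 | h0
      · exact mul_right_cancel₀ h0 (by linear_combination β * hv - v 4 * h)
      · exact mul_right_cancel₀ h0 (by linear_combination -α * hv + v 3 * h)
    obtain ⟨d, h3, h4⟩ : ∃ d, d * α = v 3 ∧ d * β = v 4 := by
      rcases hαβ with h0 | h0
      · exact ⟨v 3 / α, div_mul_cancel₀ _ h0, by field_simp; linear_combination hdet⟩
      · exact ⟨v 4 / β, by field_simp; linear_combination -hdet, div_mul_cancel₀ _ h0⟩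
    refine ⟨c, d, ?_⟩
    conv_rhs => rw [hv', ← h3, ← h4]
    congr 1
    ext i
    fin_cases i <;> simp [lineVec]
  · rintro ⟨c, d, rfl⟩
    refine ⟨⟨c, ?_⟩, ?_⟩
    · rw [map_add, map_smul, map_smul, projection_planeVec, projection_lineVec, smul_zero, add_zero]
    · rw [map_add, map_smul, map_smul, hb, lineVec_eq α β, map_add, map_smul, map_smul,
        smul_zero, zero_add, smul_eq_mul, smul_eq_mul, smul_eq_mul, h, mul_zero]

variable {ℓ₁ ℓ₂ ℓ₃ g : MvPolynomial (Fin 3) ℂ}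

namespace IsTransversal

variable (h : IsTransversal ℓ₁ ℓ₂ ℓ₃ g)

include h

lemma eval_planeVec_add_lineVec {x : Fin 3 → ℂ} (hg : eval x g = 0) (c s t : ℂ) :
    eval (c • planeVec x + lineVec s t) (threefoldForm ℓ₁ ℓ₂ ℓ₃ g) =
      c * (eval x ℓ₁ * s ^ 2 + 2 * eval x ℓ₃ * (s * t) + eval x ℓ₂ * t ^ 2) := by
  rw [eval_threefoldForm, map_add, map_smul, projection_planeVec, projection_lineVec, add_zero,
    eval_smul_of_isHomogeneous h.hom₁, eval_smul_of_isHomogeneous h.hom₂,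
    eval_smul_of_isHomogeneous h.hom₃, eval_smul_of_isHomogeneous h.hom, hg]
  simp [planeVec, lineVec]
  ring

theorem isResidualLine {x : Fin 3 → ℂ} (hx : x ≠ 0) (hg : eval x g = 0) {α β : ℂ}
    (hαβ : α ≠ 0 ∨ β ≠ 0)
    (hB : eval x ℓ₁ * α ^ 2 + 2 * eval x ℓ₃ * (α * β) + eval x ℓ₂ * β ^ 2 = 0) :
    IsResidualLine (threefoldForm ℓ₁ ℓ₂ ℓ₃ g) x (Submodule.span ℂ {planeVec x, lineVec α β}) := by
  obtain ⟨i, hi⟩ := Function.ne_iff.1 hx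
  have hi : x i ≠ 0 := hi
  -- A binary quadratic form with zero `(α, β)` is divisible by `β s - α t`.
  obtain ⟨c₃, c₄, hc⟩ : ∃ c₃ c₄ : ℂ, ∀ s t : ℂ,
      eval x ℓ₁ * s ^ 2 + 2 * eval x ℓ₃ * (s * t) + eval x ℓ₂ * t ^ 2 =
        (β * s - α * t) * (c₃ * s + c₄ * t) := by
    rcases hαβ with h0 | h0
    · refine ⟨(-eval x ℓ₂ * β - 2 * eval x ℓ₃ * α) / α ^ 2, -eval x ℓ₂ / α, fun s t => ?_⟩
      field_simp
      linear_combination s ^ 2 * hB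
    · refine ⟨eval x ℓ₁ / β, (α * eval x ℓ₁ + 2 * eval x ℓ₃ * β) / β ^ 2, fun s t => ?_⟩
      field_simp
      linear_combination t ^ 2 * hB
  -- The first linear form reads off the factor `c` in `projection v = c • x`, so its zero locus in
  -- the plane is `L`.
  refine ⟨?_, (x i)⁻¹ • (LinearMap.proj i ∘ₗ projection), β • LinearMap.proj 3 - α • LinearMap.proj 4,
    c₃ • LinearMap.proj 3 + c₄ • LinearMap.proj 4, ?_, ?_, ?_⟩
  · have h1 := finrank_span_eq_card (linearIndependent_planeVec_lineVec hx hαβ)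
    rwa [Matrix.range_cons, Matrix.range_cons, Matrix.range_empty, Set.union_empty,
      Set.singleton_union, Fintype.card_fin] at h1
  · ext v
    rw [Submodule.mem_inf, mem_planeThroughLine, LinearMap.mem_ker, mem_fixedLine]
    constructor
    · rintro ⟨⟨c, hc⟩, h0⟩
      simp only [LinearMap.smul_apply, LinearMap.comp_apply, hc, LinearMap.proj_apply,
        Pi.smul_apply, smul_eq_mul, mul_eq_zero, inv_eq_zero, hi, or_false, false_or] at h0
      rw [hc, h0, zero_smul]
    · intro h0
      exact ⟨⟨0, by rw [h0, zero_smul]⟩, by simp [h0]⟩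
  · refine planeThroughLine_inf_ker ?_ hαβ ?_ ?_
    · simp [planeVec]
    · simpa [lineVec, or_comm] using hαβ
    · simp [lineVec]
      ring
  · intro v hv
    obtain ⟨c, hcv⟩ := mem_planeThroughLine.1 hv
    conv_lhs => rw [eq_planeVec_add_lineVec hcv]
    rw [h.eval_planeVec_add_lineVec hg, hc]
    simp [hcv]
    field_simp

theorem exists_eq_span_of_isResidualLine {x : Fin 3 → ℂ} (hx : x ≠ 0) (hg : eval x g = 0)
    {m : Submodule ℂ (Fin 5 → ℂ)} (hm : IsResidualLine (threefoldForm ℓ₁ ℓ₂ ℓ₃ g) x m) :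
    ∃ α β : ℂ, (α ≠ 0 ∨ β ≠ 0) ∧
      eval x ℓ₁ * α ^ 2 + 2 * eval x ℓ₃ * (α * β) + eval x ℓ₂ * β ^ 2 = 0 ∧
      m = Submodule.span ℂ {planeVec x, lineVec α β} := by
  obtain ⟨-, a, b, c, ha, rfl, hF⟩ := hm
  have hL (s t : ℂ) : a (lineVec s t) = 0 := by
    have h1 : lineVec s t ∈ fixedLine := projection_lineVec s t
    rw [← ha] at h1
    exact h1.2
  have hB (d s t : ℂ) :
      d * (eval x ℓ₁ * s ^ 2 + 2 * eval x ℓ₃ * (s * t) + eval x ℓ₂ * t ^ 2) =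
        d * a (planeVec x) * (d * b (planeVec x) + s * b (lineVec 1 0) + t * b (lineVec 0 1)) *
          (d * c (planeVec x) + s * c (lineVec 1 0) + t * c (lineVec 0 1)) := by
    rw [← h.eval_planeVec_add_lineVec hg, hF, map_add, hL, lineVec_eq]
    · simp only [map_add, map_smul, smul_eq_mul]
      ring
    · rw [mem_planeThroughLine]
      exact ⟨d, by rw [map_add, map_smul, projection_planeVec, projection_lineVec, add_zero]⟩
  generalize a (planeVec x) = a₀ at hB
  generalize hb0 : b (planeVec x) = b₀ at hB
  generalize hb3 : b (lineVec 1 0) = b₃ at hB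
  generalize hb4 : b (lineVec 0 1) = b₄ at hB
  generalize c (planeVec x) = c₀ at hB
  generalize c (lineVec 1 0) = c₃ at hB
  generalize c (lineVec 0 1) = c₄ at hB
  have hne : ¬ ∀ s t : ℂ,
      eval x ℓ₁ * s ^ 2 + 2 * eval x ℓ₃ * (s * t) + eval x ℓ₂ * t ^ 2 = 0 := by
    intro h0
    have h1 : eval x ℓ₁ = 0 := by linear_combination h0 1 0
    have h2 : eval x ℓ₂ = 0 := by linear_combination h0 0 1
    have h3 : eval x ℓ₃ = 0 := by linear_combination (h0 1 1 - h1 - h2) / 2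
    have := h.exists_eval_ne_zero hx hg
    tauto
  -- Comparing coefficients of the powers of `d` through the values at `d = ±1`. The product has no
  -- terms involving `b₀` or `c₀`, which forces `b₀ = 0`: the line passes through `(x, 0, 0)`.
  have h1 (s t : ℂ) : eval x ℓ₁ * s ^ 2 + 2 * eval x ℓ₃ * (s * t) + eval x ℓ₂ * t ^ 2 =
      a₀ * (s * b₃ + t * b₄) * (s * c₃ + t * c₄) := by
    linear_combination (hB 1 s t - hB (-1) s t) / 2 - hB 1 0 0
  have h2 (s t : ℂ) : a₀ * (b₀ * (s * c₃ + t * c₄) + c₀ * (s * b₃ + t * b₄)) = 0 := by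
    linear_combination -(hB 1 s t + hB (-1) s t) / 2
  have h3 : a₀ * (b₀ * c₀) = 0 := by linear_combination -hB 1 0 0
  have ha0 : a₀ ≠ 0 := by
    rintro rfl
    exact hne fun s t => by rw [h1, zero_mul, zero_mul]
  have hb : b₀ = 0 := by
    by_contra hb
    have hc : c₀ = 0 := ((mul_eq_zero.1 ((mul_eq_zero.1 h3).resolve_left ha0)).resolve_left hb)
    refine hne fun s t => ?_
    have h4 := (mul_eq_zero.1 (h2 s t)).resolve_left ha0
    rw [hc, zero_mul, add_zero] at h4
    rw [h1, (mul_eq_zero.1 h4).resolve_left hb, mul_zero]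
  have hb34 : b₃ ≠ 0 ∨ b₄ ≠ 0 := by
    by_contra! h0
    exact hne fun s t => by rw [h1, h0.1, h0.2]; ring
  refine ⟨b₄, -b₃, ?_, ?_, planeThroughLine_inf_ker (hb0.trans hb) ?_ ?_ ?_⟩
  · simpa [or_comm] using hb34
  · rw [h1]
    ring
  · simpa [or_comm] using hb34
  · rwa [hb3, hb4]
  · rw [hb3, hb4]
    ring

end IsTransversal

attribute [local instance] MvPolynomial.gradedAlgebra

lemma hasCoords_plucker_of_span_eq {P : ProjSpace (Fin 5 × Fin 5)} {u w u' w' : Fin 5 → ℂ}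
    (h : HasCoords P (plucker u w)) (hspan : Submodule.span ℂ {u, w} = Submodule.span ℂ {u', w'}) :
    HasCoords P (plucker u' w') := by
  obtain ⟨a, b, hu⟩ := Submodule.mem_span_pair.1
    (hspan ▸ Submodule.mem_span_of_mem (by simp) : u ∈ Submodule.span ℂ {u', w'})
  obtain ⟨c, d, hw⟩ := Submodule.mem_span_pair.1
    (hspan ▸ Submodule.mem_span_of_mem (by simp) : w ∈ Submodule.span ℂ {u', w'})
  -- A change of basis multiplies Plücker coordinates by its determinant.
  have h1 : plucker u w = (a * d - b * c) • plucker u' w' := by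
    ext ⟨i, j⟩
    simp only [plucker, ← hu, ← hw, Pi.add_apply, Pi.smul_apply, smul_eq_mul]
    ring
  have h2 : a * d - b * c ≠ 0 := fun h0 => h.1 (by rw [h1, h0, zero_smul])
  have h3 := h.smul (inv_ne_zero h2)
  rwa [h1, inv_smul_smul₀ h2] at h3

end ResidualLines

/-! ### The conic through the branch points -/

section ConicCoefficients

open MvPolynomial WithZero

variable {C' C : Scheme.{0}} [IsIntegral C'] [IsIntegral C] {π : C' ⟶ C}
  {p : C ⟶ Spec (.of ℂ)} [SmoothOfRelativeDimension 1 p] [SmoothOfRelativeDimension 1 (π ≫ p)]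
  [IsProper p]

theorem IsSqrtCover.exists_isTransversal {ι : C.functionField ⟶ C'.functionField}
    {y : C'.functionField} {f : C.functionField} {N : closedPoints C →₀ ℤ}
    (hc : IsSqrtCover (isCurve p) ι y f N) {s : Fin 3 → C.functionField}
    {g : MvPolynomial (Fin 3) ℂ} {φ : C ⟶ ProjSpace (Fin 3)}
    (hM : letI := functionFieldAlgebra p; IsPlaneModel (isCurve p) N s g φ) :
    letI := functionFieldAlgebra p
    ∃ ℓ₁ ℓ₂ ℓ₃, IsTransversal ℓ₁ ℓ₂ ℓ₃ g ∧ ℓ₁ * ℓ₂ - ℓ₃ ^ 2 ≠ 0 ∧ aeval s ℓ₃ ^ 2 - aeval s ℓ₁ * aeval s ℓ₂ = f := by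
  let := functionFieldAlgebra p
  have hv := isCurve p
  -- The sign makes `ℓ₃² - ℓ₁ℓ₂`, rather than its negative, restrict to `f`.
  obtain ⟨q, hq, hqf⟩ := hM.exists_form 2 (-f) (hv.mem_sections.2 fun x => by
    rw [Valuation.map_neg, Finsupp.smul_apply, nsmul_eq_mul, Nat.cast_ofNat]
    rcases hc.apply_eq x with h | h
    · exact h.le
    · rw [h, exp_le_exp]
      omega)
  have hI : (algebraMap ℂ C.functionField Complex.I) ^ 2 = -1 := by
    rw [← map_pow, Complex.I_sq, map_neg, map_one]
  obtain ⟨ℓ₁, ℓ₂, ℓ₃, h₁, h₂, h₃, hqℓ, hind⟩ := exists_eq_mul_sub_sq hq fun ℓ _ h0 =>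
    hc.not_sq (algebraMap ℂ C.functionField Complex.I * aeval s ℓ) (by
      rw [mul_pow, hI, ← map_pow, ← h0, hqf]
      ring)
  refine ⟨ℓ₁, ℓ₂, ℓ₃, ⟨h₁, h₂, h₃, hM.isEquation.isHomogeneous, fun w hw hgw => ?_, hind,
    fun w hw hgw hqw => ?_⟩, fun h0 => hc.not_sq 0 ?_, ?_⟩
  · obtain ⟨x, t, h⟩ := hM.exists_isValue w hw hgw
    exact hM.exists_pderiv_ne_zero x t w h
  · obtain ⟨x, t, h⟩ := hM.exists_isValue w hw hgw
    rw [← hqℓ] at hqw ⊢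
    have h1 := (h.eval_eq_zero_iff hq).1 hqw
    have h2 : ((2 : ℕ) • N) x = 2 * N x := by
      rw [Finsupp.smul_apply, nsmul_eq_mul, Nat.cast_ofNat]
    refine h.exists_transversal hM.isEquation.isHomogeneous hM.isEquation.aeval_eq_zero hq ?_
    rw [hqf, Valuation.map_neg, h2] at h1 ⊢
    -- Where `q` vanishes, `f` does not generate `2N`, so it has order one more than the generator:
    -- a simple zero, hence transversality.
    refine (hc.apply_eq x).resolve_left fun h3 => ?_
    rw [h3, exp_le_exp] at h1
    omega
  · rw [hqℓ, h0, map_zero] at hqf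
    rw [zero_pow two_ne_zero, ← neg_eq_zero.1 hqf.symm]
  · rw [hqℓ] at hqf
    simp only [map_sub, map_mul, map_pow] at hqf
    linear_combination -hqf

end ConicCoefficients

/-! ### Values of functions and generation of the local rings upstairs -/

section Values

open WithZero

variable {k K S : Type*} [Field k] [Field K] [Algebra k K] {v : S → Valuation K ℤᵐ⁰}

/-- The function `a` has the value `c` at `x`, with respect to the generator `t`. -/
def HasValue (v : S → Valuation K ℤᵐ⁰) (x : S) (t a : K) (c : k) : Prop :=
  v x (a - t * algebraMap k K c) < v x t

namespace HasValue

variable {x : S} {t t' a b : K} {c d : k}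

lemma ne_zero (h : HasValue v x t a c) : t ≠ 0 := by
  rintro rfl
  rw [HasValue, map_zero] at h
  exact not_lt_zero h

lemma zero (ht : t ≠ 0) : HasValue v x t 0 (0 : k) := by
  rw [HasValue, map_zero, mul_zero, sub_zero, map_zero]
  exact zero_lt_iff.2 ((v x).ne_zero_iff.2 ht)

lemma add (ha : HasValue v x t a c) (hb : HasValue v x t b d) : HasValue v x t (a + b) (c + d) := by
  have : a + b - t * algebraMap k K (c + d) =
      (a - t * algebraMap k K c) + (b - t * algebraMap k K d) := by
    rw [map_add]
    ring
  rw [HasValue, this]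
  exact (v x).map_add_lt ha hb

lemma neg (ha : HasValue v x t a c) : HasValue v x t (-a) (-c) := by
  have : -a - t * algebraMap k K (-c) = -(a - t * algebraMap k K c) := by
    rw [map_neg]
    ring
  rwa [HasValue, this, Valuation.map_neg]

lemma sub (ha : HasValue v x t a c) (hb : HasValue v x t b d) :
    HasValue v x t (a - b) (c - d) := by
  rw [sub_eq_add_neg, sub_eq_add_neg]
  exact ha.add hb.neg

lemma mul (hv : IsCurve k v) (ha : HasValue v x t a c) (hb : HasValue v x t' b d) :
    HasValue v x (t * t') (a * b) (c * d) := by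
  have ht : 0 < v x t := zero_lt_iff.2 ((v x).ne_zero_iff.2 ha.ne_zero)
  have ht' : 0 < v x t' := zero_lt_iff.2 ((v x).ne_zero_iff.2 hb.ne_zero)
  have hle {s e} : v x (s * algebraMap k K e) ≤ v x s := by
    rw [map_mul]
    exact mul_le_of_le_one_right' (hv.const_le x e)
  have : a * b - t * t' * algebraMap k K (c * d) =
      (a - t * algebraMap k K c) * (b - t' * algebraMap k K d) +
        (t * algebraMap k K c * (b - t' * algebraMap k K d) +
          (a - t * algebraMap k K c) * (t' * algebraMap k K d)) := by
    rw [map_mul]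
    ring
  rw [HasValue, this, map_mul (v x) t]
  refine (v x).map_add_lt ?_ ((v x).map_add_lt ?_ ?_)
  · rw [map_mul]
    exact mul_lt_mul'' ha hb zero_le zero_le
  · rw [map_mul]
    exact (mul_le_mul' hle le_rfl).trans_lt (mul_lt_mul_of_pos_left hb ht)
  · rw [map_mul]
    exact (mul_le_mul' le_rfl hle).trans_lt (mul_lt_mul_of_pos_right ha ht')

lemma eq_zero (hv : IsCurve k v) (h : HasValue v x t 0 c) : c = 0 := by
  by_contra hc
  rw [HasValue, zero_sub, Valuation.map_neg, map_mul, hv.const x c hc, mul_one] at h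
  exact h.false

lemma function_ne_zero (hv : IsCurve k v) (h : HasValue v x t a c) (hc : c ≠ 0) : a ≠ 0 := by
  rintro rfl
  exact hc (h.eq_zero hv)

lemma valuation_eq (hv : IsCurve k v) (h : HasValue v x t a c) (hc : c ≠ 0) : v x a = v x t := by
  have h1 : v x (t * algebraMap k K c) = v x t := by rw [map_mul, hv.const x c hc, mul_one]
  exact ((v x).map_eq_of_sub_lt (h.trans_eq h1.symm)).trans h1

/-- The kernel vectors of the matrix `!![a₁, a₃ - y; a₃ + y, a₂]` have values in the kernel of the
matrix of values. -/
lemma exists_kernel (hv : IsCurve k v) {a₁ a₂ a₃ y : K} {e₁ e₂ e₃ η : k} (h₁ : HasValue v x t a₁ e₁)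
    (h₂ : HasValue v x t a₂ e₂) (h₃ : HasValue v x t a₃ e₃) (hy : HasValue v x t y η)
    (hsq : y ^ 2 = a₃ ^ 2 - a₁ * a₂) (h0 : y - a₃ ≠ 0) : ∃ (t' : K) (α β : k), (α ≠ 0 ∨ β ≠ 0) ∧
      -- The vector `(y - a₃, a₁)` is killed by both rows of the matrix, the second because of `y² =
      -- a₃² - a₁a₂`. Its value at the point, taken after normalisation, is a nonzero kernel vector
      -- of the matrix of values.
      e₁ * α + (e₃ - η) * β = 0 ∧ (e₃ + η) * α + e₂ * β = 0 ∧
      HasValue v x t' (y - a₃) α ∧ HasValue v x t' a₁ β := by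
  obtain ⟨t', w, hw, hval⟩ := exists_isValueAt hv (s := ![y - a₃, a₁])
    (fun h => h0 (congrFun h 0)) x
  have hA : HasValue v x t' (y - a₃) (w 0) := hval 0
  have hB : HasValue v x t' a₁ (w 1) := hval 1
  refine ⟨t', w 0, w 1, ?_, ?_, ?_, hA, hB⟩
  · by_contra! h
    apply hw
    ext i
    fin_cases i
    exacts [h.1, h.2]
  · refine eq_zero (t := t * t') (x := x) hv ?_
    convert (h₁.mul hv hA).add ((h₃.sub hy).mul hv hB) using 1
    ring
  · refine eq_zero (t := t * t') (x := x) hv ?_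
    convert ((h₃.add hy).mul hv hA).add (h₂.mul hv hB) using 1
    linear_combination -hsq

end HasValue

variable {K' S' : Type*} [Field K'] [Algebra k K'] [Algebra K K'] [IsScalarTower k K K']
  {v' : S' → Valuation K' ℤᵐ⁰} {x : S} {x' : S'}

lemma LiesOver.lt_iff (h : LiesOver v v' x x') (f g : K) :
    v' x' (algebraMap K K' f) < v' x' (algebraMap K K' g) ↔ v x f < v x g := by
  rw [← not_le, h.le_iff, not_le]

lemma LiesOver.hasValue (h : LiesOver v v' x x') {t a : K} {c : k} (ha : HasValue v x t a c) :
    HasValue v' x' (algebraMap K K' t) (algebraMap K K' a) c := by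
  rw [HasValue, IsScalarTower.algebraMap_apply k K K', ← map_mul, ← map_sub, h.lt_iff]
  exact ha

/-- The local ring of `x'` is generated by that of `x` and the normalized square root. -/
lemma LiesOver.mem_of_valuation_le_one [IsAlgClosed k] [NeZero (2 : k)] (h : LiesOver v v' x x')
    (hv : IsCurve k v) (hv' : IsCurve k v') {y : K'} {f : K} (hy : y ^ 2 = algebraMap K K' f)
    (hspan : ∀ g : K', ∃ a b : K, g = algebraMap K K' a + algebraMap K K' b * y) {n : ℤ}
    (hf : v x f = exp (2 * n) ∨ v x f = exp (2 * n - 1)) {R : Subring K'}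
    (hR : ∀ a, v x a ≤ 1 → algebraMap K K' a ∈ R) (hinv : ∀ a ∈ R, v' x' a = 1 → a⁻¹ ∈ R) {t : K}
    (ht : v x t = exp n) (hyt : y / algebraMap K K' t ∈ R) {g : K'} (hg : v' x' g ≤ 1) : g ∈ R := by
  have hmem {t' : K} (ht' : v x t' = exp n) : y / algebraMap K K' t' ∈ R := by
    have h1 := R.mul_mem hyt (hR (t / t') (by rw [map_div₀, ht, ht', div_self exp_ne_zero]))
    have h2 : algebraMap K K' t ≠ 0 := by simpa using IsCurve.ne_zero_of_eq_exp ht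
    rwa [map_div₀, div_mul_div_cancel₀ h2] at h1
  -- Even order: up to a function from below, `g` is a unit `a + bz` or its inverse. Odd order: `g`
  -- itself has regular coefficients in the basis `1, z`.
  rcases hf with hf | hf
  · obtain ⟨t', ht', hu, hz, hspan'⟩ := hv.exists_normalized x hy hspan (n := n) (e := 0)
      (by rw [hf, add_zero])
    rcases eq_or_ne g 0 with rfl | hg0
    · exact R.zero_mem
    obtain ⟨r, a, b, ha, hb, hab, hr⟩ := h.exists_unit_of_even hv hv' hz hu hspan' hg0
    have habR := R.add_mem (hR a ha) (R.mul_mem (hR b hb) (hmem ht'))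
    have hvr : v' x' (algebraMap K K' r) ≤ 1 := by
      rcases hr with rfl | rfl
      · rwa [map_mul, hab, mul_one] at hg
      · rwa [map_mul, map_inv₀, hab, inv_one, mul_one] at hg
    have hrR := hR r ((h.le_one_iff r).1 hvr)
    rcases hr with rfl | rfl
    · exact R.mul_mem hrR habR
    · exact R.mul_mem hrR (hinv _ habR hab)
  · obtain ⟨t', ht', hu, hz, hspan'⟩ := hv.exists_normalized x hy hspan (n := n) (e := -1)
      (by rw [hf, sub_eq_add_neg])
    obtain ⟨a, b, rfl⟩ := hspan' g
    obtain ⟨ha, hb⟩ := h.le_one_of_odd hz hu hg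
    exact R.add_mem (hR a ha) (R.mul_mem (hR b hb) (hmem ht'))

end Values

/-! ### Plücker coordinates of a moving line -/

section PluckerValues

open WithZero

variable {K S : Type*} [Field K] [Algebra ℂ K] {v : S → Valuation K ℤᵐ⁰}

/-- The Plücker coordinates of the line spanned by `(S₀, S₁, S₂, 0, 0)` and `(0, 0, 0, A, B)`. -/
def pluckerFamily (S : Fin 3 → K) (A B : K) : Fin 5 × Fin 5 → K := fun ij =>
  (![S 0, S 1, S 2, 0, 0] : Fin 5 → K) ij.1 * (![0, 0, 0, A, B] : Fin 5 → K) ij.2 -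
    (![S 0, S 1, S 2, 0, 0] : Fin 5 → K) ij.2 * (![0, 0, 0, A, B] : Fin 5 → K) ij.1

omit [Algebra ℂ K] in
lemma pluckerFamily_three (S : Fin 3 → K) (A B : K) (i : Fin 3) :
    pluckerFamily S A B (Fin.castLE (by decide) i, 3) = S i * A := by
  fin_cases i <;> simp [pluckerFamily]

omit [Algebra ℂ K] in
lemma pluckerFamily_four (S : Fin 3 → K) (A B : K) (i : Fin 3) :
    pluckerFamily S A B (Fin.castLE (by decide) i, 4) = S i * B := by
  fin_cases i <;> simp [pluckerFamily]

lemma plucker_eq_pluckerFamily (w : Fin 3 → ℂ) (α β : ℂ) :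
    plucker (planeVec w) (lineVec α β) = pluckerFamily w α β := rfl

lemma isValueAt_pluckerFamily (hv : IsCurve ℂ v) {s : Fin 3 → K} {x : S} {t t' A B : K} {w : Fin 3 → ℂ}
    {α β : ℂ} (hs : ∀ i, HasValue v x t (s i) (w i)) (hA : HasValue v x t' A α)
    (hB : HasValue v x t' B β) (hw : w ≠ 0) (hαβ : α ≠ 0 ∨ β ≠ 0) :
    IsValueAt v (pluckerFamily s A B) x (t * t') (plucker (planeVec w) (lineVec α β)) := by
  have ht := (hs 0).ne_zero
  have ht' := hA.ne_zero
  have h1 (i : Fin 5) : HasValue v x t ((![s 0, s 1, s 2, 0, 0] : Fin 5 → K) i) (planeVec w i) := by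
    fin_cases i
    exacts [hs 0, hs 1, hs 2, .zero ht, .zero ht]
  have h2 (i : Fin 5) : HasValue v x t' ((![0, 0, 0, A, B] : Fin 5 → K) i) (lineVec α β i) := by
    fin_cases i
    exacts [.zero ht', .zero ht', .zero ht', hA, hB]
  refine ⟨fun h => ?_, fun ij => ((h1 ij.1).mul hv (h2 ij.2)).sub ((h1 ij.2).mul hv (h2 ij.1))⟩
  rw [plucker_eq_pluckerFamily] at h
  obtain ⟨i, hi⟩ := Function.ne_iff.1 hw
  have h3 := congrFun h (Fin.castLE (by decide) i, 3)
  have h4 := congrFun h (Fin.castLE (by decide) i, 4)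
  rw [pluckerFamily_three] at h3
  rw [pluckerFamily_four] at h4
  rcases hαβ with h0 | h0
  · exact mul_ne_zero hi h0 h3
  · exact mul_ne_zero hi h0 h4

end PluckerValues

attribute [local instance] MvPolynomial.gradedAlgebra

/-! ### The morphism from the double cover to pairs of a point and a line -/

section CoverMap

open MvPolynomial WithZero

variable {C' C : Scheme.{0}} [IsIntegral C'] [IsIntegral C] {π : C' ⟶ C}
  {p : C ⟶ Spec (.of ℂ)} [SmoothOfRelativeDimension 1 p] [SmoothOfRelativeDimension 1 (π ≫ p)]
  [IsProper p] {ι : C.functionField ⟶ C'.functionField}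
  {y : C'.functionField} {f : C.functionField} {N : closedPoints C →₀ ℤ}
  {s : Fin 3 → C.functionField} {g : MvPolynomial (Fin 3) ℂ} {φ : C ⟶ ProjSpace (Fin 3)}
  {ℓ₁ ℓ₂ ℓ₃ : MvPolynomial (Fin 3) ℂ}

lemma IsCurve.IsValue.hasValue {k K S σ : Type*} [Field k] [Field K] [Algebra k K]
    {v : S → Valuation K ℤᵐ⁰} {hv : IsCurve k v} {N : S →₀ ℤ} {s : σ → K} {x : S} {t : K} {w : σ → k}
    (h : hv.IsValue N s x t w) {F : MvPolynomial σ k} (hF : F.IsHomogeneous 1) :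
    HasValue v x t (aeval s F) (eval w F) := by
  have h1 := h.aeval_sub_le hF
  rw [one_smul, pow_one, ← lt_exp_iff, ← h.gen] at h1
  exact h1

omit [SmoothOfRelativeDimension 1 p] [SmoothOfRelativeDimension 1 (π ≫ p)] [IsProper p] in
lemma IsInducedBy.isScalarTower (h : IsInducedBy π ι) :
    letI := functionFieldAlgebra p
    letI := functionFieldAlgebra (π ≫ p)
    letI := ι.hom.toAlgebra
    IsScalarTower ℂ C.functionField C'.functionField :=
  letI := functionFieldAlgebra p
  letI := functionFieldAlgebra (π ≫ p)
  letI := ι.hom.toAlgebra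
  .of_algebraMap_eq fun c => (h.map_algebraMap p c).symm

lemma IsSqrtCover.exists_hasValue [IsFinite π] (hc : IsSqrtCover (isCurve p) ι y f N)
    (h : IsInducedBy π ι) {x' : closedPoints C'} {x : closedPoints C} (hx : π x'.1 = x.1)
    {t : C.functionField} (ht : valuationAt p x t = exp (N x)) :
    letI := functionFieldAlgebra (π ≫ p)
    ∃ η : ℂ, HasValue (valuationAt (π ≫ p)) x' (ι t) y η := by
  let := functionFieldAlgebra p
  let := functionFieldAlgebra (π ≫ p)
  let := ι.hom.toAlgebra
  have hl := h.liesOver (p := p) hx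
  have ht0 : ι t ≠ 0 :=
    (map_ne_zero (algebraMap C.functionField C'.functionField)).2 (IsCurve.ne_zero_of_eq_exp ht)
  -- The poles of `y² = f` are bounded by `2N`, so those of `y` are bounded by `N`.
  have h1 : valuationAt (π ≫ p) x' y ≤ valuationAt (π ≫ p) x' (ι t) := by
    refine le_of_pow_le_pow_left₀ two_ne_zero zero_le ?_
    rw [← map_pow, ← map_pow, hc.sq_eq, ← map_pow]
    refine (hl.le_iff f (t ^ 2)).2 ?_
    rw [map_pow, ht, ← exp_nsmul, nsmul_eq_mul, Nat.cast_ofNat]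
    rcases hc.apply_eq x with h | h
    · exact h.le
    · rw [h, exp_le_exp]
      omega
  obtain ⟨η, hη⟩ := (isCurve (π ≫ p)).exists_sub_lt x' ht0 h1
  refine ⟨η, ?_⟩
  rwa [Algebra.smul_def, mul_comm] at hη

variable (h : IsInducedBy π ι) (hc : IsSqrtCover (isCurve p) ι y f N)
  (hM : letI := functionFieldAlgebra p; IsPlaneModel (isCurve p) N s g φ)
  (hT : IsTransversal ℓ₁ ℓ₂ ℓ₃ g)
  (hf : letI := functionFieldAlgebra p; aeval s ℓ₃ ^ 2 - aeval s ℓ₁ * aeval s ℓ₂ = f)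

include h hc hT hf

lemma IsSqrtCover.exists_kernel [IsFinite π] {x' : closedPoints C'} {x : closedPoints C} (hx : π x'.1 = x.1)
    {t : C.functionField} {w : Fin 3 → ℂ} {η : ℂ} :
    letI := functionFieldAlgebra p
    letI := functionFieldAlgebra (π ≫ p)
    (isCurve p).IsValue N s x t w → HasValue (valuationAt (π ≫ p)) x' (ι t) y η →
    ∃ (t' : C'.functionField) (α β : ℂ), (α ≠ 0 ∨ β ≠ 0) ∧
      eval w ℓ₁ * α + (eval w ℓ₃ - η) * β = 0 ∧ (eval w ℓ₃ + η) * α + eval w ℓ₂ * β = 0 ∧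
      HasValue (valuationAt (π ≫ p)) x' t' (y - ι (aeval s ℓ₃)) α ∧
      HasValue (valuationAt (π ≫ p)) x' t' (ι (aeval s ℓ₁)) β := by
  let := functionFieldAlgebra p
  let := functionFieldAlgebra (π ≫ p)
  let := ι.hom.toAlgebra
  intro hw hη
  have := h.isScalarTower (p := p)
  have hl := h.liesOver (p := p) hx
  refine HasValue.exists_kernel (isCurve (π ≫ p)) (hl.hasValue (hw.hasValue hT.hom₁))
    (hl.hasValue (hw.hasValue hT.hom₂)) (hl.hasValue (hw.hasValue hT.hom₃)) hη ?_ ?_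
  · rw [hc.sq_eq, ← hf]
    exact (map_sub (algebraMap C.functionField C'.functionField) _ _).trans
      (congrArg₂ _ (map_pow _ _ _) (map_mul _ _ _))
  · intro h0
    refine hc.not_sq (aeval s ℓ₃) ((algebraMap C.functionField C'.functionField).injective ?_)
    rw [map_pow]
    exact (congrArg (· ^ 2) (sub_eq_zero.1 h0)).symm.trans hc.sq_eq

include hM

/-- The line over a point is spanned by `(S, 0, 0)` and `(0, 0, 0, A, B)`, where `(A, B) = (y - ℓ₃,
ℓ₁)` is the generic kernel vector. The local ring upstairs is recovered because functions from below
come from the plane embedding and the slope of the line determines `y`. -/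
theorem IsSqrtCover.exists_coverMap [IsFinite π] (hφ : φ ≫ ProjSpace.toSpec (Fin 3) = p) :
    letI := functionFieldAlgebra p
    letI := functionFieldAlgebra (π ≫ p)
    ∃ ψ : C' ⟶ PlaneTimesPlucker,
      ψ ≫ pullback.fst (ProjSpace.toSpec (Fin 3)) (ProjSpace.toSpec (Fin 5 × Fin 5)) = π ≫ φ ∧
      (∀ (x' : closedPoints C') (x : closedPoints C) t w (η : ℂ), π x'.1 = x.1 →
        (isCurve p).IsValue N s x t w → HasValue (valuationAt (π ≫ p)) x' (ι t) y η →
        ∃ α β : ℂ, (α ≠ 0 ∨ β ≠ 0) ∧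
          eval w ℓ₁ * α + (eval w ℓ₃ - η) * β = 0 ∧ (eval w ℓ₃ + η) * α + eval w ℓ₂ * β = 0 ∧
          HasCoords (pullback.snd (ProjSpace.toSpec (Fin 3)) (ProjSpace.toSpec (Fin 5 × Fin 5))
            (ψ x'.1)) (plucker (planeVec w) (lineVec α β))) ∧
      ∀ (x' : closedPoints C') a, valuationAt (π ≫ p) x' a ≤ 1 → a ∈ imageSubring ψ x'.1 := by
  let := functionFieldAlgebra p
  let := functionFieldAlgebra (π ≫ p)
  let := ι.hom.toAlgebra
  have := h.isScalarTower (p := p)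
  have hv := isCurve p
  have hv' := isCurve (π ≫ p)
  let S : Fin 3 → C'.functionField := fun i => ι (s i)
  let A : C'.functionField := y - ι (aeval s ℓ₃)
  let B : C'.functionField := ι (aeval s ℓ₁)
  have hS0 : S 0 ≠ 0 := (map_ne_zero (algebraMap C.functionField C'.functionField)).2 hM.ne_zero
  have hA0 : A ≠ 0 := by
    intro h0
    refine hc.not_sq (aeval s ℓ₃) ((algebraMap C.functionField C'.functionField).injective ?_)
    rw [map_pow]
    exact (congrArg (· ^ 2) (sub_eq_zero.1 h0)).symm.trans hc.sq_eq
  have hP0 : pluckerFamily S A B (0, 3) ≠ 0 := by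
    have h1 := pluckerFamily_three S A B 0
    exact fun h0 => mul_ne_zero hS0 hA0 (h1.symm.trans h0)
  obtain ⟨χ, hχ, -, hχx⟩ := exists_projMap (π ≫ p) hP0
  have hcomm : (π ≫ φ) ≫ ProjSpace.toSpec (Fin 3) = χ ≫ ProjSpace.toSpec (Fin 5 × Fin 5) := by
    rw [Category.assoc, hφ, hχ]
  let ψ : C' ⟶ PlaneTimesPlucker := pullback.lift (π ≫ φ) χ hcomm
  have hψ1 : ψ ≫ pullback.fst (ProjSpace.toSpec (Fin 3)) (ProjSpace.toSpec (Fin 5 × Fin 5)) =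
    π ≫ φ := pullback.lift_fst _ _ _
  have hψ2 : ψ ≫ pullback.snd (ProjSpace.toSpec (Fin 3)) (ProjSpace.toSpec (Fin 5 × Fin 5)) =
    χ := pullback.lift_snd _ _ _
  have key (x' : closedPoints C') (x : closedPoints C) (t) (w) (η : ℂ) (hx : π x'.1 = x.1)
      (hw : (isCurve p).IsValue N s x t w) (hη : HasValue (valuationAt (π ≫ p)) x' (ι t) y η) :
      ∃ (t' : C'.functionField) (α β : ℂ), (α ≠ 0 ∨ β ≠ 0) ∧
        (eval w ℓ₁ * α + (eval w ℓ₃ - η) * β = 0 ∧ (eval w ℓ₃ + η) * α + eval w ℓ₂ * β = 0) ∧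
        HasValue (valuationAt (π ≫ p)) x' t' A α ∧ HasValue (valuationAt (π ≫ p)) x' t' B β ∧
        IsValueAt (valuationAt (π ≫ p)) (pluckerFamily S A B) x' (ι t * t')
          (plucker (planeVec w) (lineVec α β)) := by
    obtain ⟨t', α, β, hαβ, h1, h2, hA, hB⟩ := hc.exists_kernel h hT hf hx hw hη
    have hw0 : w ≠ 0 := (hM.hasCoords x t w hw).1
    refine ⟨t', α, β, hαβ, ⟨h1, h2⟩, hA, hB, isValueAt_pluckerFamily hv' (fun i => ?_) hA hB hw0 hαβ⟩
    have h3 := hw.hasValue (isHomogeneous_X ℂ i)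
    rw [aeval_X, eval_X] at h3
    exact (h.liesOver (p := p) hx).hasValue h3
  refine ⟨ψ, hψ1, fun x' x t w η hx hw hη => ?_, fun x' a ha => ?_⟩
  · obtain ⟨t', α, β, hαβ, ⟨h1, h2⟩, -, -, hP⟩ := key x' x t w η hx hw hη
    refine ⟨α, β, hαβ, h1, h2, ?_⟩
    have h3 := (hχx x' _ _ hP).1
    rw [← hψ2] at h3
    exact h3
  · let x : closedPoints C := ⟨π x'.1, isClosed_map x'⟩
    obtain ⟨t, ht⟩ := hv.exists_zpow x (N x)
    obtain ⟨w, hw⟩ := hv.exists_isValue ht hM.mem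
    obtain ⟨η, hη⟩ := hc.exists_hasValue h (x' := x') (x := x) rfl ht
    obtain ⟨t', α, β, hαβ, -, hA, hB, hP⟩ := key x' x t w η rfl hw hη
    have hl := h.liesOver (p := p) (x' := x') (x := x) rfl
    have hw0 : w ≠ 0 := (hM.hasCoords x t w hw).1
    obtain ⟨i, hi⟩ := Function.ne_iff.1 hw0
    have hi : w i ≠ 0 := hi
    have hR (b : C.functionField) (hb : valuationAt p x b ≤ 1) : ι b ∈ imageSubring ψ x'.1 := by
      have h1 := h.map_mem_imageSubring φ x'.1 (hM.mem_imageSubring x b hb)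
      rw [← hψ1] at h1
      exact imageSubring_comp_le _ _ _ h1
    have hχR (b) (hb : b ∈ imageSubring χ x'.1) : b ∈ imageSubring ψ x'.1 := by
      rw [← hψ2] at hb
      exact imageSubring_comp_le _ _ _ hb
    have hsi : HasValue (valuationAt p) x t (s i) (w i) := by
      have h3 := hw.hasValue (isHomogeneous_X ℂ i)
      rwa [aeval_X, eval_X] at h3
    have hvsi := hsi.valuation_eq hv hi
    have hsi0 : s i ≠ 0 := hsi.function_ne_zero hv hi
    have hSi0 : S i ≠ 0 := (map_ne_zero (algebraMap C.functionField C'.functionField)).2 hsi0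
    have hℓ {ℓ : MvPolynomial (Fin 3) ℂ} (hℓ : ℓ.IsHomogeneous 1) :
        ι (aeval s ℓ) / S i ∈ imageSubring ψ x'.1 := by
      have h1 := hR (aeval s ℓ / s i) (by
        have h2 := hw.hasValue hℓ
        rw [map_div₀, hvsi]
        refine div_le_one_of_le₀ ?_ zero_le
        rw [← sub_add_cancel (aeval s ℓ) (t * algebraMap ℂ C.functionField (eval w ℓ))]
        refine (valuationAt p x).map_add_le h2.le ?_
        rw [map_mul]
        exact mul_le_of_le_one_right' (hv.const_le x _))
      rwa [map_div₀] at h1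
    have hw3 : plucker (planeVec w) (lineVec α β) (Fin.castLE (by decide) i, 3) = w i * α :=
      pluckerFamily_three w α β i
    have hw4 : plucker (planeVec w) (lineVec α β) (Fin.castLE (by decide) i, 4) = w i * β :=
      pluckerFamily_four w α β i
    -- The kernel equations give `y = -ℓ₃ - (B / A) ℓ₂` where `α ≠ 0`, and `y = ℓ₃ + (A / B) ℓ₁`
    -- where `β ≠ 0`; the slope in question is a quotient of Plücker coordinates that is regular at
    -- the point.
    have hyS : y / S i ∈ imageSubring ψ x'.1 := by
      rcases hαβ with h0 | h0
      · have hA0 := hA.function_ne_zero hv' h0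
        have h1 := hχR _ ((hχx x' _ _ hP).2 1 _ _ (isHomogeneous_X ℂ (Fin.castLE (by decide) i, 4))
          (isHomogeneous_X ℂ (Fin.castLE (by decide) i, 3))
          (by rw [eval_X, hw3]; exact mul_ne_zero hi h0))
        rw [aeval_X, aeval_X, pluckerFamily_three, pluckerFamily_four,
          mul_div_mul_left _ _ hSi0] at h1
        have h2 := Subring.sub_mem _ (Subring.neg_mem _ (hℓ hT.hom₃)) (Subring.mul_mem _ h1 (hℓ hT.hom₂))
        convert h2 using 1
        field_simp
        have h3 : y ^ 2 = ι (aeval s ℓ₃) ^ 2 - ι (aeval s ℓ₁) * ι (aeval s ℓ₂) := by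
          rw [hc.sq_eq, ← hf, map_sub, map_pow, map_mul]
        simp only [A, B]
        linear_combination h3
      · have hB0 := hB.function_ne_zero hv' h0
        have h1 := hχR _ ((hχx x' _ _ hP).2 1 _ _ (isHomogeneous_X ℂ (Fin.castLE (by decide) i, 3))
          (isHomogeneous_X ℂ (Fin.castLE (by decide) i, 4))
          (by rw [eval_X, hw4]; exact mul_ne_zero hi h0))
        rw [aeval_X, aeval_X, pluckerFamily_three, pluckerFamily_four,
          mul_div_mul_left _ _ hSi0] at h1
        have h2 := Subring.add_mem _ (hℓ hT.hom₃) (Subring.mul_mem _ h1 (hℓ hT.hom₁))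
        convert h2 using 1
        change y / S i = ι (aeval s ℓ₃) / S i + A / B * (B / S i)
        rw [div_mul_div_cancel₀ hB0, ← add_div]
        simp only [A, add_sub_cancel]
    refine hl.mem_of_valuation_le_one hv hv' hc.sq_eq hc.span (hc.apply_eq x) hR (fun b hb hb1 => ?_)
      ht ?_ ha
    · obtain ⟨c, rfl⟩ := (valuationAt_le_one_iff (π ≫ p) x').1 hb1.le
      refine inv_mem_imageSubring ?_ hb
      by_contra hu
      have := (valuationAt_lt_one_iff (π ≫ p) x').2 ((IsLocalRing.mem_maximalIdeal _).2 hu)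
      exact this.ne hb1
    · have h1 := Subring.mul_mem _ hyS (hR (s i / t) (by rw [map_div₀, hvsi]; exact div_self_le_one _))
      rw [map_div₀] at h1
      change y / S i * (S i / ι t) ∈ _ at h1
      rwa [div_mul_div_cancel₀ hSi0] at h1

end CoverMap

attribute [local instance] MvPolynomial.gradedAlgebra

/-! ### Closed points of products -/

section ClosedPoints

/-- A closed point of a product is determined by its projections. -/
lemma eq_of_isClosed_pullback {X Y : Scheme.{0}} (a : X ⟶ Spec (.of ℂ)) (b : Y ⟶ Spec (.of ℂ))
    [LocallyOfFiniteType a] [LocallyOfFiniteType b] {z z' : (pullback a b : Scheme.{0})}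
    (hz : IsClosed {z}) (hz' : IsClosed {z'}) (h₁ : pullback.fst a b z = pullback.fst a b z')
    (h₂ : pullback.snd a b z = pullback.snd a b z') : z = z' := by
  have : LocallyOfFiniteType (pullback.fst a b ≫ a) := inferInstance
  obtain ⟨⟨m, hm⟩, hmz⟩ := (pointEquivClosedPoint (pullback.fst a b ≫ a)).surjective ⟨z, hz⟩
  obtain ⟨⟨m', hm'⟩, hmz'⟩ := (pointEquivClosedPoint (pullback.fst a b ≫ a)).surjective ⟨z', hz'⟩
  have k : m (IsLocalRing.closedPoint ℂ) = z := congrArg Subtype.val hmz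
  have k' : m' (IsLocalRing.closedPoint ℂ) = z' := congrArg Subtype.val hmz'
  have hmm : m = m' := by
    refine pullback.hom_ext ?_ ?_
    · refine ext_of_apply_closedPoint_eq a (by rw [Category.assoc, hm]) (by rw [Category.assoc, hm']) ?_
      exact (congrArg (pullback.fst a b) k).trans (h₁.trans (congrArg (pullback.fst a b) k').symm)
    · refine ext_of_apply_closedPoint_eq b (by rw [Category.assoc, ← pullback.condition, hm])
        (by rw [Category.assoc, ← pullback.condition, hm']) ?_
      exact (congrArg (pullback.snd a b) k).trans (h₂.trans (congrArg (pullback.snd a b) k').symm)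
  rw [← k, ← k', hmm]

end ClosedPoints

/-! ### The covering involution -/

section Conjugation

variable {C' C : Scheme.{0}} [IsIntegral C'] [IsIntegral C] {π : C' ⟶ C}
  {p : C ⟶ Spec (.of ℂ)} [SmoothOfRelativeDimension 1 (π ≫ p)] [IsProper p] [IsFinite π]
  {ι : C.functionField ⟶ C'.functionField}

include p in
/-- An automorphism of the function field of a covering extends to the covering. -/
lemma IsInducedBy.exists_conjugate (h : IsInducedBy π ι) {σ : C'.functionField ⟶ C'.functionField}
    (hσ : ι ≫ σ = ι) : ∃ τ : C' ⟶ C', τ ≫ π = π ∧ IsInducedBy τ σ := by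
  have hC' : CompactSpace C' := (quasiCompact_iff_compactSpace (π ≫ p)).1 inferInstance
  have hsep : C'.IsSeparated := by
    have : IsSeparated (π ≫ p) := inferInstance
    rw [Scheme.isSeparated_iff, ← terminal.comp_from (π ≫ p)]
    infer_instance
  obtain ⟨τ, hτ, hτσ⟩ := exists_extension π π (fun x =>
    (eq_genericPoint_or_isClosed (π ≫ p) x).imp_right fun hx => isDiscreteValuationRing_stalk (π ≫ p) hx)
    (Spec.map σ ≫ C'.fromSpecStalk (genericPoint C')) (by
      rw [Category.assoc, h, ← Spec.map_comp_assoc, hσ])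
  exact ⟨τ, hτ, hτσ⟩

lemma IsInducedBy.exists_conjugate_point (h : IsInducedBy π ι)
    {σ : C'.functionField ⟶ C'.functionField} (hσ : ι ≫ σ = ι) (x' : closedPoints C') :
    ∃ x'' : closedPoints C', π x''.1 = π x'.1 ∧ ∀ a b,
      valuationAt (π ≫ p) x' (σ a) < valuationAt (π ≫ p) x' (σ b) →
        valuationAt (π ≫ p) x'' a < valuationAt (π ≫ p) x'' b := by
  obtain ⟨τ, hτ, hτσ⟩ := h.exists_conjugate (p := p) hσ
  have : UniversallyClosed τ := by
    have : UniversallyClosed (τ ≫ π) := by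
      rw [hτ]
      infer_instance
    exact .of_comp_of_isSeparated τ π
  have hcl : IsClosed {τ x'.1} := by
    have := τ.isClosedMap _ x'.2
    rwa [Set.image_singleton] at this
  refine ⟨⟨τ x'.1, hcl⟩, congr($hτ x'.1), fun a b hab => ?_⟩
  -- The comparison along `τ` uses the structure morphism `τ ≫ π ≫ p`, equal to `π ≫ p` but not
  -- definitionally.
  have key : ∀ (r : C' ⟶ Spec (.of ℂ)) [SmoothOfRelativeDimension 1 r], r = π ≫ p →
      valuationAt r x' (σ a) < valuationAt r x' (σ b) := by
    intro r _ hr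
    subst hr
    exact hab
  have hr : τ ≫ π ≫ p = π ≫ p := by rw [← Category.assoc, hτ]
  have : SmoothOfRelativeDimension 1 (τ ≫ π ≫ p) := by
    rw [hr]
    infer_instance
  let := σ.hom.toAlgebra
  have hl := hτσ.liesOver (p := π ≫ p) (x' := x') (x := ⟨τ x'.1, hcl⟩) rfl
  exact (hl.lt_iff a b).1 (key _ hr)

end Conjugation

/-! ### Identification with the discriminant double cover -/

section Range

open MvPolynomial WithZero

/-- A zero of the binary form singles out one of the two square roots: either kernel equation can be
solved for `ζ`, and the vanishing of the form yields the other equation and `ζ² = η²`. -/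
lemma exists_root_of_conic {e₁ e₂ e₃ α β η : ℂ} (hη : η ^ 2 = e₃ ^ 2 - e₁ * e₂)
    (hαβ : α ≠ 0 ∨ β ≠ 0) (hB : e₁ * α ^ 2 + 2 * e₃ * (α * β) + e₂ * β ^ 2 = 0) :
    ∃ ζ : ℂ, (ζ = η ∨ ζ = -η) ∧ e₁ * α + (e₃ - ζ) * β = 0 ∧ (e₃ + ζ) * α + e₂ * β = 0 := by
  obtain ⟨ζ, h1, h2, h3⟩ : ∃ ζ : ℂ, ζ ^ 2 = η ^ 2 ∧ e₁ * α + (e₃ - ζ) * β = 0 ∧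
      (e₃ + ζ) * α + e₂ * β = 0 := by
    rw [hη]
    rcases hαβ with h0 | h0
    · refine ⟨-(e₃ * α + e₂ * β) / α, ?_, ?_, ?_⟩
      · field_simp
        linear_combination e₂ * hB
      · field_simp
        linear_combination hB
      · field_simp
        ring
    · refine ⟨(e₃ * β + e₁ * α) / β, ?_, ?_, ?_⟩
      · field_simp
        linear_combination e₁ * hB
      · field_simp
        ring
      · field_simp
        linear_combination hB
  exact ⟨ζ, sq_eq_sq_iff_eq_or_eq_neg.1 h1, h2, h3⟩

/-- The matrix with rows `(e₁, e₃ - ζ)` and `(e₃ + ζ, e₂)` is nonzero, so its kernel is at most a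
line. -/
lemma mul_eq_mul_of_kernel {e₁ e₂ e₃ ζ α β α' β' : ℂ} (he : e₁ ≠ 0 ∨ e₂ ≠ 0 ∨ e₃ ≠ 0)
    (h₁ : e₁ * α + (e₃ - ζ) * β = 0) (h₂ : (e₃ + ζ) * α + e₂ * β = 0)
    (h₁' : e₁ * α' + (e₃ - ζ) * β' = 0) (h₂' : (e₃ + ζ) * α' + e₂ * β' = 0) :
    α * β' = α' * β := by
  by_contra hne
  have hd : α * β' - α' * β ≠ 0 := sub_ne_zero.2 hne
  have k1 : e₁ = 0 := (mul_eq_zero.1 (by linear_combination β' * h₁ - β * h₁' :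
    e₁ * (α * β' - α' * β) = 0)).resolve_right hd
  have k2 : e₂ = 0 := (mul_eq_zero.1 (by linear_combination α * h₂' - α' * h₂ :
    e₂ * (α * β' - α' * β) = 0)).resolve_right hd
  have k3 : e₃ - ζ = 0 := (mul_eq_zero.1 (by linear_combination α * h₁' - α' * h₁ :
    (e₃ - ζ) * (α * β' - α' * β) = 0)).resolve_right hd
  have k4 : e₃ + ζ = 0 := (mul_eq_zero.1 (by linear_combination β' * h₂ - β * h₂' :
    (e₃ + ζ) * (α * β' - α' * β) = 0)).resolve_right hd
  have k5 : e₃ = 0 := by linear_combination (k3 + k4) / 2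
  tauto

lemma hasCoords_plucker_of_mul_eq_mul {P : ProjSpace (Fin 5 × Fin 5)} {x : Fin 3 → ℂ}
    {α β α' β' : ℂ} (h : HasCoords P (plucker (planeVec x) (lineVec α β)))
    (hαβ' : α' ≠ 0 ∨ β' ≠ 0) (hαβ : α ≠ 0 ∨ β ≠ 0) (he : α * β' = α' * β) :
    HasCoords P (plucker (planeVec x) (lineVec α' β')) := by
  obtain ⟨c, hc, h1, h2⟩ : ∃ c : ℂ, c ≠ 0 ∧ α' = c * α ∧ β' = c * β := by
    rcases hαβ with h0 | h0
    · have h1 : α' = α' / α * α := (div_mul_cancel₀ _ h0).symm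
      have h2 : β' = α' / α * β := by
        field_simp
        linear_combination he
      refine ⟨α' / α, fun hc => ?_, h1, h2⟩
      rw [hc, zero_mul] at h1 h2
      tauto
    · have h1 : α' = β' / β * α := by
        field_simp
        linear_combination -he
      have h2 : β' = β' / β * β := (div_mul_cancel₀ _ h0).symm
      refine ⟨β' / β, fun hc => ?_, h1, h2⟩
      rw [hc, zero_mul] at h1 h2
      tauto
  have h3 : plucker (planeVec x) (lineVec α' β') = c • plucker (planeVec x) (lineVec α β) := by
    have h4 : lineVec α' β' = c • lineVec α β := by
      ext i
      fin_cases i <;> simp [lineVec, h1, h2]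
    ext ij
    rw [h4]
    simp only [plucker, Pi.smul_apply, smul_eq_mul]
    ring
  rw [h3]
  exact h.smul hc

variable {C' C : Scheme.{0}} [IsIntegral C'] [IsIntegral C] {π : C' ⟶ C}
  {p : C ⟶ Spec (.of ℂ)} [SmoothOfRelativeDimension 1 p] [SmoothOfRelativeDimension 1 (π ≫ p)]
  [IsProper p] {ι : C.functionField ⟶ C'.functionField}
  {y : C'.functionField} {f : C.functionField} {N : closedPoints C →₀ ℤ}
  {s : Fin 3 → C.functionField} {g : MvPolynomial (Fin 3) ℂ} {φ : C ⟶ ProjSpace (Fin 3)}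
  {ℓ₁ ℓ₂ ℓ₃ : MvPolynomial (Fin 3) ℂ}

/-- The map to pairs is a closed immersion by surjectivity on stalks. Its closed points are residual
pairs by the kernel equations; conversely every residual pair over `V(g)` is reached because both
square roots of `f` occur on the fibre of the cover. -/
theorem IsSqrtCover.exists_iso [IsFinite π] [Surjective π]
    (h : IsInducedBy π ι) (hc : IsSqrtCover (isCurve p) ι y f N)
    (hM : letI := functionFieldAlgebra p; IsPlaneModel (isCurve p) N s g φ)
    (hT : IsTransversal ℓ₁ ℓ₂ ℓ₃ g)
    (hf : letI := functionFieldAlgebra p; aeval s ℓ₃ ^ 2 - aeval s ℓ₁ * aeval s ℓ₂ = f)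
    (hφ : φ ≫ ProjSpace.toSpec (Fin 3) = p) :
    ∃ e : C' ≅ (discriminantCoverOver (threefoldForm ℓ₁ ℓ₂ ℓ₃ g) (planeCurvePoints g)).subscheme,
      e.hom ≫ discriminantCoverOver.toPlane (threefoldForm ℓ₁ ℓ₂ ℓ₃ g) (planeCurvePoints g) =
        π ≫ φ := by
  let := functionFieldAlgebra p
  let := functionFieldAlgebra (π ≫ p)
  have hv := isCurve p
  have hv' := isCurve (π ≫ p)
  have hC' : CompactSpace C' := (quasiCompact_iff_compactSpace (π ≫ p)).1 inferInstance
  obtain ⟨ψ, hψ, hψP, hψR⟩ := hc.exists_coverMap h hM hT hf hφ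
  have hprop : UniversallyClosed ψ := by
    have h1 : ψ ≫ pullback.fst (ProjSpace.toSpec (Fin 3)) (ProjSpace.toSpec (Fin 5 × Fin 5)) ≫
        ProjSpace.toSpec (Fin 3) = π ≫ p := by rw [← Category.assoc, hψ, Category.assoc, hφ]
    have h2 : UniversallyClosed (ψ ≫ pullback.fst (ProjSpace.toSpec (Fin 3))
        (ProjSpace.toSpec (Fin 5 × Fin 5)) ≫ ProjSpace.toSpec (Fin 3)) := h1 ▸ inferInstance
    exact .of_comp_of_isSeparated ψ (pullback.fst (ProjSpace.toSpec (Fin 3))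
        (ProjSpace.toSpec (Fin 5 × Fin 5)) ≫ ProjSpace.toSpec (Fin 3))
  have hcl := isClosedImmersion_of_imageSubring (π ≫ p) ψ hψR
  have hψcl (x' : closedPoints C') : IsClosed {ψ x'.1} := by
    have := ψ.isClosedMap _ x'.2
    rwa [Set.image_singleton] at this
  have hψfst (z : C') : pullback.fst (ProjSpace.toSpec (Fin 3)) (ProjSpace.toSpec (Fin 5 × Fin 5))
    (ψ z) = φ (π z) := congr($hψ z)
  have hvalue {x' : closedPoints C'} {x : closedPoints C} {t w} {η : ℂ} (hx : π x'.1 = x.1)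
      (hw : (isCurve p).IsValue N s x t w) (hη : HasValue (valuationAt (π ≫ p)) x' (ι t) y η) :
      η ^ 2 = eval w ℓ₃ ^ 2 - eval w ℓ₁ * eval w ℓ₂ := by
    obtain ⟨t', α, β, hαβ, h1, h2, -, -⟩ := hc.exists_kernel h hT hf hx hw hη
    have hdet : eval w ℓ₁ * eval w ℓ₂ - (eval w ℓ₃ - η) * (eval w ℓ₃ + η) = 0 := by
      rcases hαβ with h0 | h0
      · exact mul_right_cancel₀ h0
          (by linear_combination eval w ℓ₂ * h1 - (eval w ℓ₃ - η) * h2)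
      · exact mul_right_cancel₀ h0
          (by linear_combination eval w ℓ₁ * h2 - (eval w ℓ₃ + η) * h1)
    linear_combination hdet
  have hS : closure (residualPairs (threefoldForm ℓ₁ ℓ₂ ℓ₃ g) ∩ pullback.fst (ProjSpace.toSpec (Fin 3))
      (ProjSpace.toSpec (Fin 5 × Fin 5)) ⁻¹' planeCurvePoints g) = Set.range ψ := by
    refine closure_eq_range (π ≫ p) ψ (fun x' => ?_) ?_
    · let x : closedPoints C := ⟨π x'.1, isClosed_map x'⟩
      obtain ⟨t, ht⟩ := hv.exists_zpow x (N x)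
      obtain ⟨w, hw⟩ := hv.exists_isValue ht hM.mem
      obtain ⟨η, hη⟩ := hc.exists_hasValue h (x' := x') (x := x) rfl ht
      obtain ⟨α, β, hαβ, h1, h2, hP⟩ := hψP x' x t w η rfl hw hη
      have hcoord := hM.hasCoords x t w hw
      have hg : eval w g = 0 := hw.eval_eq_zero hM.isEquation.isHomogeneous hM.isEquation.aeval_eq_zero
      have hx1 : HasCoords (pullback.fst (ProjSpace.toSpec (Fin 3)) (ProjSpace.toSpec (Fin 5 × Fin 5))
        (ψ x'.1)) w := by
        rw [hψfst]
        exact hcoord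
      refine ⟨⟨hψcl x', w, _, _, hx1, hP, hT.isResidualLine hcoord.1 hg hαβ ?_⟩, w, hx1, hg⟩
      linear_combination α * h1 + β * h2
    · rintro z ⟨⟨hz, x₁, u₁, w₁, hzx, hzP, hres⟩, x₂, hzx₂, hgx₂⟩
      have hx₁ := hzx.1
      have hg : eval x₁ g = 0 := by
        rw [← hzx.2 3 g hT.hom, hzx₂.2 3 g hT.hom]
        exact hgx₂
      obtain ⟨α, β, hαβ, hB, hspan⟩ := hT.exists_eq_span_of_isResidualLine hx₁ hg hres
      have hzP' := hasCoords_plucker_of_span_eq hzP hspan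
      obtain ⟨x, t, hw⟩ := hM.exists_isValue x₁ hx₁ hg
      have hcoord := hM.hasCoords x t x₁ hw
      obtain ⟨x', hx'⟩ := exists_closedPoint_over (π := π) x
      obtain ⟨η, hη⟩ := hc.exists_hasValue h hx' hw.gen
      obtain ⟨ζ, hζ, h1, h2⟩ := exists_root_of_conic (hvalue hx' hw hη) hαβ hB
      obtain ⟨x'', hx'', hζ'⟩ : ∃ x'' : closedPoints C', π x''.1 = x.1 ∧
          HasValue (valuationAt (π ≫ p)) x'' (ι t) y ζ := by
        -- If the line belongs to the other root, the point is replaced by its conjugate under `y ↦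
        -- -y`, which lies over the same point of the base.
        rcases hζ with rfl | rfl
        · exact ⟨x', hx', hη⟩
        · obtain ⟨σ, hισ, hσ⟩ := hc.conj
          obtain ⟨x'', hx'', hlt⟩ := h.exists_conjugate_point (p := p) hισ x'
          refine ⟨x'', hx''.trans hx', hlt _ _ ?_⟩
          have h3 (a : C.functionField) : σ (ι a) = ι a := congr($hισ a)
          have h4 : σ (y - ι t * algebraMap ℂ C'.functionField (-η)) =
              -(y - ι t * algebraMap ℂ C'.functionField η) := by
            rw [map_neg, ← h.map_algebraMap p η, mul_neg, sub_neg_eq_add, ← map_mul, map_add, h3, hσ]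
            ring
          rw [h4, Valuation.map_neg, h3]
          exact hη
      obtain ⟨α', β', hαβ', h1', h2', hP⟩ := hψP x'' x t x₁ ζ hx'' hw hζ'
      have hP' := hasCoords_plucker_of_mul_eq_mul hP hαβ hαβ'
        (mul_eq_mul_of_kernel (hT.exists_eval_ne_zero hx₁ hg) h1' h2' h1 h2)
      refine ⟨x''.1, eq_of_isClosed_pullback _ _ (hψcl x'') hz ?_ ?_⟩
      · rw [hψfst, hx'']
        exact hcoord.unique hzx
      · exact hP'.unique hzP'
  obtain ⟨e, he⟩ := exists_iso_reducedClosure ψ hS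
  refine ⟨e, ?_⟩
  rw [← hψ, ← he, Category.assoc]
  rfl

end Range

end CubicThreefold

end

/-! ### The main theorem -/

theorem mainTheorem4 {C C' : Scheme.{0}} [IsIntegral C] [IsIntegral C']
    (p : C ⟶ Spec (.of ℂ)) [IsProper p] [SmoothOfRelativeDimension 1 p]
    (hgenus : CubicThreefold.genus p = 1)
    (π : C' ⟶ C) [SmoothOfRelativeDimension 1 (π ≫ p)]
    [IsFinite π] [Flat π] (hdeg : ∀ y : C, π.finrank y = 2)
    (hbranch : (CubicThreefold.branchPoints π).encard = 6) :
    ∃ F : MvPolynomial (Fin 5) ℂ,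
      -- a smooth cubic threefold `X = V(F)`
      F.IsHomogeneous 3 ∧ CubicThreefold.IsSmoothForm F ∧
      -- invariant under the involution of non-Eckardt type
      (∀ v, MvPolynomial.eval (CubicThreefold.nonEckardtInvolution v) F =
        MvPolynomial.eval v F) ∧
      -- `L` is the unique line on `X` that is fixed pointwise
      (∀ M, CubicThreefold.IsPointwiseFixedLine F M ↔ M = CubicThreefold.fixedLine) ∧
      ∃ g q : MvPolynomial (Fin 3) ℂ,
        -- the discriminant quintic is the union of a smooth cubic `V(g)` and a conic `V(q)`
        (CubicThreefold.conicMatrix F).det = g * q ∧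
        g.IsHomogeneous 3 ∧ CubicThreefold.IsSmoothForm g ∧ q.IsHomogeneous 2 ∧ q ≠ 0 ∧
        -- the given cover is the discriminant double cover restricted to the cubic
        ∃ (e : C ≅ (CubicThreefold.planeCurve g).subscheme)
          (e' : C' ≅ (CubicThreefold.discriminantCoverOver F
            (CubicThreefold.planeCurvePoints g)).subscheme),
          e.hom ≫ (CubicThreefold.planeCurve g).subschemeι ≫
            CubicThreefold.ProjSpace.toSpec (Fin 3) = p ∧
          e'.hom ≫ CubicThreefold.discriminantCoverOver.toPlane F (CubicThreefold.planeCurvePoints g) =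
            π ≫ e.hom ≫ (CubicThreefold.planeCurve g).subschemeι := by
  obtain ⟨hs, ι, h, y, f, N, hc, hN⟩ :=
    CubicThreefold.exists_isSqrtCover (p := p) hgenus hdeg hbranch
  obtain ⟨s, g, φ, hM, hφ, e, he⟩ := CubicThreefold.exists_isPlaneModel p hgenus hN
  obtain ⟨ℓ₁, ℓ₂, ℓ₃, hT, hq, hf⟩ := hc.exists_isTransversal hM
  obtain ⟨e', he'⟩ := hc.exists_iso h hM hT hf hφ
  refine ⟨CubicThreefold.threefoldForm ℓ₁ ℓ₂ ℓ₃ g, hT.isHomogeneous, hT.isSmoothForm_threefoldForm,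
    CubicThreefold.eval_nonEckardtInvolution ℓ₁ ℓ₂ ℓ₃ g, hT.isPointwiseFixedLine_iff, g,
    ℓ₁ * ℓ₂ - ℓ₃ ^ 2, CubicThreefold.det_conicMatrix ℓ₁ ℓ₂ ℓ₃ g, hT.hom, hT.isSmoothForm,
    (hT.hom₁.mul hT.hom₂).sub (hT.hom₃.pow 2), hq, e, e', ?_, ?_⟩
  · rw [← Category.assoc, he, hφ]
  · rw [he', he]
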